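/- Let $k$ be a field of characteristic zero and let $(H,R)$ be a semisimple quasi-triangular Hopf algebra over $k$ with antipode $S$. Thus $R=R^1\otimes R^2\in H\otimes H$ is invertible, $R\,\Delta(h)=\Delta^{\mathrm{cop}}(h)\,R$ for all $h\in H$, $(\Delta\otimes\mathrm{id})(R)=R^{13}R^{23}$ and $(\mathrm{id}\otimes\Delta)(R)=R^{13}R^{12}$. Let $A$ be a left $H$-module algebra that is - quantum commutative: $ab=(R^2\cdot b)(R^1\cdot a)$ for all $a,b\in A$; and - strongly separable: there is a symmetric separability idempotent $x=x^1\otimes x^2\in A\otimes A$, i.e. $x^1x^2=1$, $ax^1\otimes x^2=x^1\otimes x^2a$ for all $a\in A$, and $x^2\otimes x^1=x^1\otimes x^2$. Fix such an $x$. Assume that the Drinfeld element $u=S(R^2)R^1$ acts trivially on $A$, i.e. $u\cdot a=a$ for all $a\in A$. Let $A\#H$ be the smash product, that is, $A\otimes H$ with multiplication $(a\#h)(b\#g)=a(h_{(1)}\cdot b)\#h_{(2)}g$ and unit $1_A\#1_H$. Then there is a unique $\alpha_A\in A^*$ with $\langle\alpha_A,x^1\rangle x^2=1_A$, and the following hold.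 1. $A\#H$ is a weak Hopf algebra with comultiplication, counit and antipode $$\tilde\Delta(a\#h)=\bigl(a(R^2\cdot x^1)\#R^1h_{(1)}\bigr)\otimes\bigl(x^2\#h_{(2)}\bigr),\qquad \tilde\varepsilon(a\#h)=\langle\alpha_A,a\rangle\,\varepsilon(h),\qquad \tilde S(a\#h)=(1_A\#S(h))(R^2\cdot a\#R^1).$$ 2. Suppose that moreover $A$ belongs to the Müger center of the category of $H$-modules, i.e. $(R_2{}^2R_1{}^1)\cdot a\otimes R_2{}^1R_1{}^2=a\otimes 1_H$ for all $a\in A$, where $R_1=R_2=R$. Then $(A\#H,\mathcal R)$ is a quasi-triangular weak Hopf algebra, where, writing $\tilde 1_{(1)}\otimes\tilde 1_{(2)}=\tilde 1_{(1')}\otimes\tilde 1_{(2')}=\tilde\Delta(1_A\#1_H)$, $$\mathcal R=\tilde 1_{(2)}(1_A\#R^1)\tilde 1_{(1')}\otimes\tilde 1_{(1)}(1_A\#R^2)\tilde 1_{(2')}.$$ 3. If, in addition to the assumption of 2, $(H,R)$ is triangular (i.e. $R^{-1}=R^{21}$), then $(A\#H,\mathcal R)$ is a triangular weak Hopf algebra.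 Here a weak Hopf algebra is an algebra $B$ that is also a coalgebra with multiplicative $\Delta$, such that $(\Delta\otimes\mathrm{id})\Delta(1)=(\Delta(1)\otimes1)(1\otimes\Delta(1))=(1\otimes\Delta(1))(\Delta(1)\otimes1)$ and $\varepsilon(bcd)=\varepsilon(bc_{(1)})\varepsilon(c_{(2)}d)=\varepsilon(bc_{(2)})\varepsilon(c_{(1)}d)$, together with a linear map $S$ satisfying $b_{(1)}S(b_{(2)})=\varepsilon(1_{(1)}b)1_{(2)}$, $S(b_{(1)})b_{(2)}=1_{(1)}\varepsilon(b1_{(2)})$ and $S(b_{(1)})b_{(2)}S(b_{(3)})=S(b)$. It is quasi-triangular with R-matrix $\mathcal R\in\Delta^{\mathrm{cop}}(1)(B\otimes B)\Delta(1)$ if $\Delta^{\mathrm{cop}}(b)\mathcal R=\mathcal R\Delta(b)$ for all $b\in B$, $(\mathrm{id}\otimes\Delta)\mathcal R=\mathcal R^{13}\mathcal R^{12}$, $(\Delta\otimes\mathrm{id})\mathcal R=\mathcal R^{13}\mathcal R^{23}$, and there is $\bar{\mathcal R}\in\Delta(1)(B\otimes B)\Delta^{\mathrm{cop}}(1)$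 with $\mathcal R\bar{\mathcal R}=\Delta^{\mathrm{cop}}(1)$ and $\bar{\mathcal R}\mathcal R=\Delta(1)$. It is triangular if moreover $\bar{\mathcal R}=\mathcal R^{21}$. -/

import Mathlib

open scoped TensorProduct

set_option linter.unusedSectionVars false

namespace QTSmash

/-! ### Legs of two-tensors -/

section Legs

variable {k B : Type*} [CommRing k] [Ring B] [Algebra k B]

/-- `t ↦ t¹ ⊗ t² ⊗ 1`. -/
noncomputable def leg12 (t : B ⊗[k] B) : B ⊗[k] (B ⊗[k] B) :=
  TensorProduct.assoc k B B B (t ⊗ₜ[k] (1 : B))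

/-- `t ↦ t¹ ⊗ 1 ⊗ t²`. -/
noncomputable def leg13 (t : B ⊗[k] B) : B ⊗[k] (B ⊗[k] B) :=
  (TensorProduct.mk k B B 1).lTensor B t

/-- `t ↦ 1 ⊗ t¹ ⊗ t²`. -/
noncomputable def leg23 (t : B ⊗[k] B) : B ⊗[k] (B ⊗[k] B) :=
  (1 : B) ⊗ₜ[k] t

/-- The flip `t¹ ⊗ t² ↦ t² ⊗ t¹`. -/
noncomputable def flipT (t : B ⊗[k] B) : B ⊗[k] B := TensorProduct.comm k B B t

end Legs

/-! ### Quasi-triangular Hopf algebras -/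

section Quasitriangular

variable {k H : Type*} [CommRing k] [Ring H] [HopfAlgebra k H]

/-- `(H, R)` is a quasi-triangular Hopf algebra. -/
structure IsQuasitriangular (R : H ⊗[k] H) : Prop where
  isUnit : IsUnit R
  /-- `R Δ(h) = Δᶜᵒᵖ(h) R` -/
  mul_comul (h : H) : R * Coalgebra.comul h = flipT (Coalgebra.comul (R := k) h) * R
  /-- `(Δ ⊗ id)(R) = R¹³ R²³` -/
  comul_rTensor : TensorProduct.assoc k H H H (Coalgebra.comul.rTensor H R) = leg13 R * leg23 R
  /-- `(id ⊗ Δ)(R) = R¹³ R¹²` -/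
  comul_lTensor : Coalgebra.comul.lTensor H R = leg13 R * leg12 R

/-- `(H, R)` is a triangular Hopf algebra: quasi-triangular with `R⁻¹ = R²¹`. -/
structure IsTriangular (R : H ⊗[k] H) : Prop extends IsQuasitriangular R where
  flip_mul : flipT R * R = 1
  mul_flip : R * flipT R = 1

/-- The Drinfeld element `u = S(R²) R¹`. -/
noncomputable def drinfeldElement (R : H ⊗[k] H) : H :=
  LinearMap.mul' k H ((HopfAlgebra.antipode k).rTensor H (flipT R))

end Quasitriangular

/-! ### Module algebras -/

section Action

variable (k H A : Type*) [CommRing k] [Ring H] [HopfAlgebra k H] [Ring A] [Algebra k A]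
  [Module H A] [IsScalarTower k H A]

/-- The action of `H` on `A` as a bilinear map `(h, a) ↦ h • a`. -/
noncomputable def act : H →ₗ[k] A →ₗ[k] A := (Algebra.lsmul k k A : H →ₐ[k] Module.End k A).toLinearMap

/-- `(g ⊗ h) ↦ (a ⊗ b ↦ g • a ⊗ h • b)`. -/
noncomputable def actBoth : H ⊗[k] H →ₗ[k] A ⊗[k] A →ₗ[k] A ⊗[k] A :=
  TensorProduct.homTensorHomMap (RingHom.id k) A A A A ∘ₗ TensorProduct.map (act k H A) (act k H A)

/-- `(g ⊗ h) ↦ (a ↦ g • a ⊗ h)`. -/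
noncomputable def actFst : H ⊗[k] H →ₗ[k] A →ₗ[k] A ⊗[k] H :=
  (LinearMap.rTensorHom H ∘ₗ (act k H A).flip).flip

@[simp] theorem act_apply (h : H) (a : A) : act k H A h a = h • a := rfl

@[simp] theorem actBoth_tmul (g h : H) (a b : A) :
    actBoth k H A (g ⊗ₜ h) (a ⊗ₜ b) = (g • a) ⊗ₜ[k] (h • b) := rfl

@[simp] theorem actFst_tmul (g h : H) (a : A) :
    actFst k H A (g ⊗ₜ h) a = (g • a) ⊗ₜ[k] h := rfl

/-- `A` is a left `H`-module algebra:
`h • 1 = ε(h) 1` and `h • (a b) = (h₍₁₎ • a) (h₍₂₎ • b)`. -/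
class ModuleAlgebra : Prop where
  smul_one (h : H) : h • (1 : A) = Coalgebra.counit (R := k) h • (1 : A)
  smul_mul (h : H) (a b : A) :
    h • (a * b) = LinearMap.mul' k A (actBoth k H A (Coalgebra.comul h) (a ⊗ₜ b))

variable {k H}

/-- `A` is quantum commutative: `a b = (R² • b) (R¹ • a)`. -/
def IsQuantumCommutative (R : H ⊗[k] H) : Prop :=
  ∀ a b : A, a * b = LinearMap.mul' k A (actBoth k H A (flipT R) (b ⊗ₜ a))

/-- `A` lies in the Müger center of the category of `H`-modules:
`(R₂² R₁¹) • a ⊗ R₂¹ R₁² = a ⊗ 1` for all `a`. -/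
def IsInMuegerCenter (R : H ⊗[k] H) : Prop :=
  ∀ a : A, actFst k H A (flipT R * R) a = a ⊗ₜ[k] (1 : H)

end Action

/-- `x = x¹ ⊗ x²` is a symmetric separability idempotent of `A`. -/
structure IsSymmetricSeparabilityIdempotent {k A : Type*} [CommRing k] [Ring A] [Algebra k A]
    (x : A ⊗[k] A) : Prop where
  /-- `x¹ x² = 1` -/
  mul_eq_one : LinearMap.mul' k A x = 1
  /-- `a x¹ ⊗ x² = x¹ ⊗ x² a` -/
  central (a : A) : (a ⊗ₜ[k] (1 : A)) * x = x * ((1 : A) ⊗ₜ[k] a)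
  /-- `x² ⊗ x¹ = x¹ ⊗ x²` -/
  symm : flipT x = x

/-- The condition `⟨α, x¹⟩ x² = 1` on a linear form `α`. -/
def IsDualForm {k A : Type*} [CommRing k] [Ring A] [Algebra k A]
    (x : A ⊗[k] A) (α : A →ₗ[k] k) : Prop :=
  TensorProduct.lid k A (α.rTensor A x) = 1

/-! ### The smash product -/

/-- The smash product `A # H`, with underlying module `A ⊗ H`. -/
def SmashProduct (k H A : Type*) [CommRing k] [Ring H] [HopfAlgebra k H] [Ring A] [Algebra k A] :
    Type _ :=
  A ⊗[k] H

namespace SmashProduct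

section Basic

variable (k H A : Type*) [CommRing k] [Ring H] [HopfAlgebra k H] [Ring A] [Algebra k A]

noncomputable instance : AddCommGroup (SmashProduct k H A) :=
  inferInstanceAs (AddCommGroup (A ⊗[k] H))

noncomputable instance : Module k (SmashProduct k H A) :=
  inferInstanceAs (Module k (A ⊗[k] H))

/-- The identification of the underlying module of `A # H` with `A ⊗ H`. -/
noncomputable def ofTensor : A ⊗[k] H ≃ₗ[k] SmashProduct k H A := LinearEquiv.refl k _

variable {H A}

/-- The element `a # h`. -/
noncomputable def mk (a : A) (h : H) : SmashProduct k H A := ofTensor k H A (a ⊗ₜ[k] h)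

variable {k}

@[elab_as_elim]
theorem induction_on {p : SmashProduct k H A → Prop} (z : SmashProduct k H A)
    (zero : p 0) (mk : ∀ a h, p (mk k a h)) (add : ∀ y z, p y → p z → p (y + z)) : p z :=
  TensorProduct.induction_on (motive := p) z zero mk add

end Basic

section Mul

variable (k H A : Type*) [CommRing k] [Ring H] [HopfAlgebra k H] [Ring A] [Algebra k A]
  [Module H A] [IsScalarTower k H A]

/-- `(h, b) ↦ h₍₁₎ • b ⊗ h₍₂₎`. -/
noncomputable def twist : H →ₗ[k] A →ₗ[k] A ⊗[k] H := actFst k H A ∘ₗ Coalgebra.comul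

/-- The bilinear map `(a ⊗ h, b ⊗ g) ↦ a (h₍₁₎ • b) ⊗ h₍₂₎ g`. -/
noncomputable def mulMap : A ⊗[k] H →ₗ[k] A ⊗[k] H →ₗ[k] A ⊗[k] H :=
  TensorProduct.lift (LinearMap.mk₂ k (fun a h => TensorProduct.lift (LinearMap.mk₂ k
    (fun b g => (a ⊗ₜ[k] (1 : H)) * twist k H A h b * ((1 : A) ⊗ₜ[k] g))
    (fun _ _ _ => by simp only [map_add, mul_add, add_mul])
    (fun _ _ _ => by simp only [map_smul, mul_smul_comm, smul_mul_assoc])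
    (fun _ _ _ => by simp only [TensorProduct.tmul_add, mul_add])
    (fun _ _ _ => by simp only [TensorProduct.tmul_smul, mul_smul_comm])))
    (fun _ _ _ => by ext; simp [TensorProduct.add_tmul, add_mul])
    (fun c a h => by ext; simp [← TensorProduct.smul_tmul'])
    (fun _ _ _ => by ext; simp [add_mul, mul_add])
    (fun _ _ _ => by ext; simp))

noncomputable instance : Mul (SmashProduct k H A) :=
  ⟨fun y z => ofTensor k H A (mulMap k H A ((ofTensor k H A).symm y) ((ofTensor k H A).symm z))⟩

noncomputable instance : One (SmashProduct k H A) := ⟨mk k 1 1⟩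

theorem one_def : (1 : SmashProduct k H A) = mk k 1 1 := rfl

end Mul

section Ring

variable {k H A : Type*} [CommRing k] [Ring H] [HopfAlgebra k H] [Ring A] [Algebra k A]
  [Module H A] [IsScalarTower k H A]

theorem mulMap_tmul (a b : A) (h g : H) : mulMap k H A (a ⊗ₜ h) (b ⊗ₜ g) =
    (a ⊗ₜ[k] (1 : H)) * twist k H A h b * ((1 : A) ⊗ₜ[k] g) := rfl

theorem twist_repr {ι : Type*} {h : H} (s : Coalgebra.Repr k h ι) (b : A) :
    twist k H A h b = ∑ i ∈ s.index, (s.left i • b) ⊗ₜ[k] s.right i := by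
  simp [twist, ← s.eq]

/-- The multiplication of the smash product, `(a # h)(b # g) = a (h₍₁₎ • b) # h₍₂₎ g`. -/
theorem mk_mul_mk {ι : Type*} (a b : A) (h g : H) (s : Coalgebra.Repr k h ι) :
    mk k a h * mk k b g =
      ∑ i ∈ s.index, mk k (a * (s.left i • b)) (s.right i * g) := by
  change ofTensor k H A (mulMap k H A (a ⊗ₜ h) (b ⊗ₜ g)) = _
  rw [mulMap_tmul, twist_repr s]
  simp [mk, Finset.mul_sum, Finset.sum_mul]

theorem twist_mul_left (h g : H) (c : A) {ι : Type*} (s : Coalgebra.Repr k g ι) :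
    twist k H A (h * g) c =
      ∑ j ∈ s.index, twist k H A h (s.left j • c) * ((1 : A) ⊗ₜ[k] s.right j) := by
  let t := Coalgebra.Repr.arbitrary k h
  simp only [twist_repr t]
  simp only [twist, LinearMap.comp_apply, Bialgebra.comul_mul, ← s.eq, ← t.eq, Finset.sum_mul_sum]
  simp only [Algebra.TensorProduct.tmul_mul_tmul, map_sum, LinearMap.sum_apply, actFst_tmul,
    mul_smul, mul_one, Finset.sum_mul]
  rw [Finset.sum_comm]

theorem twist_mul_right [ModuleAlgebra k H A] (h : H) (b c : A) {ι : Type*}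
    (s : Coalgebra.Repr k h ι) :
    twist k H A h (b * c) =
      ∑ i ∈ s.index, ((s.left i • b) ⊗ₜ[k] (1 : H)) * twist k H A (s.right i) c := by
  let F : H ⊗[k] (H ⊗[k] H) →ₗ[k] A ⊗[k] H :=
    (LinearMap.mul' k A ∘ₗ (actBoth k H A).flip (b ⊗ₜ c)).rTensor H ∘ₗ
      (TensorProduct.assoc k H H H).symm.toLinearMap
  have hF : ∀ p q r, F (p ⊗ₜ (q ⊗ₜ r)) = ((p • b) * (q • c)) ⊗ₜ[k] r := fun _ _ _ => rfl
  have h1 : twist k H A h (b * c) =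
      F (TensorProduct.assoc k H H H (Coalgebra.comul.rTensor H (Coalgebra.comul h))) := by
    rw [twist_repr s, ← s.eq]
    simp [F, ModuleAlgebra.smul_mul (k := k)]
  rw [h1, Coalgebra.coassoc_apply, ← s.eq]
  simp only [map_sum, LinearMap.lTensor_tmul]
  refine Finset.sum_congr rfl fun i _ => ?_
  let t := Coalgebra.Repr.arbitrary k (s.right i)
  rw [twist_repr t, ← t.eq]
  simp [TensorProduct.tmul_sum, hF, Finset.mul_sum]

theorem mul_add_aux (x y z : SmashProduct k H A) : x * (y + z) = x * y + x * z :=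
  (mulMap k H A ((ofTensor k H A).symm x)).map_add ((ofTensor k H A).symm y)
    ((ofTensor k H A).symm z)

theorem add_mul_aux (x y z : SmashProduct k H A) : (x + y) * z = x * z + y * z :=
  (mulMap k H A).map_add₂ ((ofTensor k H A).symm x) ((ofTensor k H A).symm y)
    ((ofTensor k H A).symm z)

theorem zero_mul_aux (x : SmashProduct k H A) : 0 * x = 0 :=
  (mulMap k H A).map_zero₂ ((ofTensor k H A).symm x)

theorem mul_zero_aux (x : SmashProduct k H A) : x * 0 = 0 :=
  (mulMap k H A ((ofTensor k H A).symm x)).map_zero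

theorem smul_mul_aux (c : k) (x y : SmashProduct k H A) : c • x * y = c • (x * y) :=
  (mulMap k H A).map_smul₂ c ((ofTensor k H A).symm x) ((ofTensor k H A).symm y)

theorem mul_smul_aux (c : k) (x y : SmashProduct k H A) : x * c • y = c • (x * y) :=
  (mulMap k H A ((ofTensor k H A).symm x)).map_smul c ((ofTensor k H A).symm y)

variable [ModuleAlgebra k H A]

theorem mul_assoc_aux (x y z : SmashProduct k H A) : x * y * z = x * (y * z) := by
  have key : ∀ (a b c : A) (h g f : H),
      mulMap k H A (mulMap k H A (a ⊗ₜ h) (b ⊗ₜ g)) (c ⊗ₜ f) =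
        mulMap k H A (a ⊗ₜ h) (mulMap k H A (b ⊗ₜ g) (c ⊗ₜ f)) := by
    intro a b c h g f
    let s := Coalgebra.Repr.arbitrary k h
    let t := Coalgebra.Repr.arbitrary k g
    rw [mulMap_tmul a b h g, twist_repr s, mulMap_tmul b c g f, twist_repr t]
    simp only [Finset.mul_sum, Finset.sum_mul, Algebra.TensorProduct.tmul_mul_tmul, one_mul,
      mul_one, map_sum, LinearMap.sum_apply, mulMap_tmul, twist_mul_left _ g c t,
      twist_mul_right h b _ s]
    rw [Finset.sum_comm]
    refine Finset.sum_congr rfl fun i _ => Finset.sum_congr rfl fun j _ => ?_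
    rw [← mul_one (1 : H), ← Algebra.TensorProduct.tmul_mul_tmul,
      ← one_mul (1 : A), ← Algebra.TensorProduct.tmul_mul_tmul]
    simp only [mul_assoc, mul_one]
  induction x using induction_on with
  | zero => simp only [zero_mul_aux]
  | add x x' hx hx' => simp only [add_mul_aux, hx, hx']
  | mk a h =>
    induction y using induction_on with
    | zero => simp only [zero_mul_aux, mul_zero_aux]
    | add y y' hy hy' => simp only [add_mul_aux, mul_add_aux, hy, hy']
    | mk b g =>
      induction z using induction_on with
      | zero => simp only [mul_zero_aux]
      | add z z' hz hz' => simp only [mul_add_aux, hz, hz']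
      | mk c f => exact key a b c h g f

theorem one_mul_aux (x : SmashProduct k H A) : 1 * x = x := by
  induction x using induction_on with
  | zero => exact mul_zero_aux 1
  | add x y hx hy => rw [mul_add_aux, hx, hy]
  | mk b g =>
    change mulMap k H A (1 ⊗ₜ 1) (b ⊗ₜ g) = b ⊗ₜ g
    simp [mulMap_tmul, twist, Algebra.TensorProduct.one_def]

theorem mul_one_aux (x : SmashProduct k H A) : x * 1 = x := by
  induction x using induction_on with
  | zero => exact zero_mul_aux 1
  | add x y hx hy => rw [add_mul_aux, hx, hy]
  | mk a h =>
    change mulMap k H A (a ⊗ₜ h) (1 ⊗ₜ 1) = a ⊗ₜ h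
    let s := Coalgebra.Repr.arbitrary k h
    have : twist k H A h 1 = (1 : A) ⊗ₜ[k] h := by
      rw [twist_repr s]
      simp only [ModuleAlgebra.smul_one (k := k), TensorProduct.smul_tmul]
      rw [← TensorProduct.tmul_sum, Coalgebra.sum_counit_smul]
    simp [mulMap_tmul, this]

noncomputable instance : Ring (SmashProduct k H A) :=
  { (inferInstance : AddCommGroup (SmashProduct k H A)),
    (inferInstance : Mul (SmashProduct k H A)),
    (inferInstance : One (SmashProduct k H A)) with
    left_distrib := mul_add_aux
    right_distrib := add_mul_aux
    zero_mul := zero_mul_aux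
    mul_zero := mul_zero_aux
    mul_assoc := mul_assoc_aux
    one_mul := one_mul_aux
    mul_one := mul_one_aux }

noncomputable instance : Algebra k (SmashProduct k H A) :=
  Algebra.ofModule smul_mul_aux mul_smul_aux

end Ring

/-! ### The structure maps on the smash product -/

section Structure

variable {k H A : Type*} [CommRing k] [Ring H] [HopfAlgebra k H] [Ring A] [Algebra k A]

variable (k H A) in
/-- `a ↦ a # 1`. -/
noncomputable def inlMap : A →ₗ[k] SmashProduct k H A :=
  (ofTensor k H A).toLinearMap ∘ₗ (TensorProduct.mk k A H).flip 1

variable (k H A) in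
/-- `h ↦ 1 # h`. -/
noncomputable def inrMap : H →ₗ[k] SmashProduct k H A :=
  (ofTensor k H A).toLinearMap ∘ₗ TensorProduct.mk k A H 1

/-- The counit `a # h ↦ ⟨α, a⟩ ε(h)`. -/
noncomputable def counit (α : A →ₗ[k] k) : SmashProduct k H A →ₗ[k] k :=
  LinearMap.mul' k k ∘ₗ TensorProduct.map α Coalgebra.counit ∘ₗ (ofTensor k H A).symm.toLinearMap

theorem counit_mk (α : A →ₗ[k] k) (a : A) (h : H) :
    counit α (mk k a h) = α a * Coalgebra.counit (R := k) h := rfl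

variable [Module H A] [IsScalarTower k H A]

/-- `a ↦ R² • a # R¹`. -/
noncomputable def sourceMap (R : H ⊗[k] H) : A →ₗ[k] SmashProduct k H A :=
  (ofTensor k H A).toLinearMap ∘ₗ actFst k H A (flipT R)

variable [ModuleAlgebra k H A]

/-- The comultiplication `a # h ↦ (a (R² • x¹) # R¹ h₍₁₎) ⊗ (x² # h₍₂₎)`, written as the product
of `(a # 1) ⊗ 1`, `(R² • x¹ # R¹) ⊗ (x² # 1)` and `(1 # h₍₁₎) ⊗ (1 # h₍₂₎)`;
see `comul_mk` for the formula itself. -/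
noncomputable def comul (R : H ⊗[k] H) (x : A ⊗[k] A) :
    SmashProduct k H A →ₗ[k] SmashProduct k H A ⊗[k] SmashProduct k H A :=
  TensorProduct.lift (LinearMap.mk₂ k
    (fun a h => (inlMap k H A a ⊗ₜ[k] 1) *
      TensorProduct.map (sourceMap R) (inlMap k H A) x *
      TensorProduct.map (inrMap k H A) (inrMap k H A) (Coalgebra.comul h))
    (fun _ _ _ => by simp only [map_add, TensorProduct.add_tmul, add_mul])
    (fun _ _ _ => by simp only [map_smul, ← TensorProduct.smul_tmul', smul_mul_assoc])
    (fun _ _ _ => by simp only [map_add, mul_add])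
    (fun _ _ _ => by simp only [map_smul, mul_smul_comm])) ∘ₗ
  (ofTensor k H A).symm.toLinearMap

/-- The antipode `a # h ↦ (1 # S(h)) (R² • a # R¹)`. -/
noncomputable def antipode (R : H ⊗[k] H) : SmashProduct k H A →ₗ[k] SmashProduct k H A :=
  LinearMap.mul' k (SmashProduct k H A) ∘ₗ
  TensorProduct.map (inrMap k H A ∘ₗ HopfAlgebra.antipode k) (sourceMap R) ∘ₗ
  (TensorProduct.comm k A H).toLinearMap ∘ₗ
  (ofTensor k H A).symm.toLinearMap

/-- The element `1̃₍₂₎ (1 # R¹) 1̃₍₁'₎ ⊗ 1̃₍₁₎ (1 # R²) 1̃₍₂'₎`, where `1̃₍₁₎ ⊗ 1̃₍₂₎` is the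
comultiplication of the unit of `A # H`. -/
noncomputable def rMatrix (R : H ⊗[k] H) (x : A ⊗[k] A) :
    SmashProduct k H A ⊗[k] SmashProduct k H A :=
  flipT (comul R x 1) * TensorProduct.map (inrMap k H A) (inrMap k H A) R * comul R x 1

theorem mk_one_mul_mk (a b : A) (h : H) : mk k a 1 * mk k b h = mk k (a * b) h := by
  change mulMap k H A (a ⊗ₜ 1) (b ⊗ₜ h) = (a * b) ⊗ₜ h
  simp [mulMap_tmul, twist, Algebra.TensorProduct.one_def]

theorem mk_mul_mk_one (a : A) (h g : H) : mk k a h * mk k 1 g = mk k a (h * g) := by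
  have h1 : mk k a h = mk k a 1 * mk k 1 h := by rw [mk_one_mul_mk, mul_one]
  have h2 : mk (A := A) k 1 h * mk k 1 g = mk k 1 (h * g) := by
    rw [mk_mul_mk 1 1 h g (Coalgebra.Repr.arbitrary k h)]
    simp only [ModuleAlgebra.smul_one (k := k), one_mul, mk, TensorProduct.smul_tmul, ← map_sum,
      ← TensorProduct.tmul_sum, ← smul_mul_assoc, ← Finset.sum_mul, Coalgebra.sum_counit_smul]
  rw [h1, mul_assoc, h2, mk_one_mul_mk, mul_one]

/-- The comultiplication in terms of finite expansions `R = ∑ r ⊗ r'`, `x = ∑ y ⊗ y'` and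
`Δ(h) = ∑ h₍₁₎ ⊗ h₍₂₎`. -/
theorem comul_mk {ι κ σ : Type*} (I : Finset ι) (J : Finset κ) (r r' : ι → H) (y y' : κ → A)
    (a : A) (h : H) (s : Coalgebra.Repr k h σ) :
    comul (∑ i ∈ I, r i ⊗ₜ[k] r' i) (∑ j ∈ J, y j ⊗ₜ[k] y' j) (mk k a h) =
      ∑ i ∈ I, ∑ j ∈ J, ∑ l ∈ s.index,
        mk k (a * (r' i • y j)) (r i * s.left l) ⊗ₜ[k] mk k (y' j) (s.right l) := by
  have hs : ∀ b : A, sourceMap (∑ i ∈ I, r i ⊗ₜ[k] r' i) b = ∑ i ∈ I, mk k (r' i • b) (r i) := by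
    intro b; simp [sourceMap, flipT, mk]
  have hl : ∀ b : A, inlMap k H A b = mk k b 1 := fun _ => rfl
  have hr : ∀ g : H, inrMap k H A g = mk k 1 g := fun _ => rfl
  change (inlMap k H A a ⊗ₜ[k] 1) * TensorProduct.map (sourceMap _) (inlMap k H A) _ *
      TensorProduct.map (inrMap k H A) (inrMap k H A) (Coalgebra.comul h) = _
  rw [← s.eq]
  simp only [map_sum, TensorProduct.map_tmul, hs, hl, hr, TensorProduct.sum_tmul, Finset.mul_sum,
    Finset.sum_mul, Algebra.TensorProduct.tmul_mul_tmul, one_mul, mk_one_mul_mk, mk_mul_mk_one]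
  conv_lhs => enter [2, j]; rw [Finset.sum_comm]
  rw [Finset.sum_comm]
  refine Finset.sum_congr rfl fun i _ => ?_
  rw [Finset.sum_comm]

theorem antipode_mk {ι : Type*} (I : Finset ι) (r r' : ι → H) (a : A) (h : H) :
    antipode (∑ i ∈ I, r i ⊗ₜ[k] r' i) (mk k a h) =
      mk k 1 (HopfAlgebra.antipode k h) * ∑ i ∈ I, mk k (r' i • a) (r i) := by
  have hs : sourceMap (∑ i ∈ I, r i ⊗ₜ[k] r' i) a = ∑ i ∈ I, mk k (r' i • a) (r i) := by
    simp [sourceMap, flipT, mk]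
  rw [← hs]; rfl

end Structure

end SmashProduct

/-! ### Weak Hopf algebras -/

section Weak

variable {k B : Type*} [CommRing k] [Ring B] [Algebra k B]

/-- The algebra `B` with comultiplication `Δ` and counit `ε` is a weak bialgebra. -/
structure IsWeakBialgebra (Δ : B →ₗ[k] B ⊗[k] B) (ε : B →ₗ[k] k) : Prop where
  coassoc : (TensorProduct.assoc k B B B).toLinearMap ∘ₗ Δ.rTensor B ∘ₗ Δ = Δ.lTensor B ∘ₗ Δ
  rTensor_counit (b : B) : ε.rTensor B (Δ b) = 1 ⊗ₜ[k] b
  lTensor_counit (b : B) : ε.lTensor B (Δ b) = b ⊗ₜ[k] 1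
  comul_mul (b c : B) : Δ (b * c) = Δ b * Δ c
  /-- `(Δ ⊗ id) Δ(1) = (Δ(1) ⊗ 1)(1 ⊗ Δ(1))` -/
  comul_one : TensorProduct.assoc k B B B (Δ.rTensor B (Δ 1)) = leg12 (Δ 1) * leg23 (Δ 1)
  /-- `(Δ ⊗ id) Δ(1) = (1 ⊗ Δ(1))(Δ(1) ⊗ 1)` -/
  comul_one' : TensorProduct.assoc k B B B (Δ.rTensor B (Δ 1)) = leg23 (Δ 1) * leg12 (Δ 1)
  /-- `ε(b c d) = ε(b c₍₁₎) ε(c₍₂₎ d)` -/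
  counit_mul (b c d : B) : ε (b * c * d) = LinearMap.mul' k k
    (TensorProduct.map (ε ∘ₗ LinearMap.mulLeft k b) (ε ∘ₗ LinearMap.mulRight k d) (Δ c))
  /-- `ε(b c d) = ε(b c₍₂₎) ε(c₍₁₎ d)` -/
  counit_mul' (b c d : B) : ε (b * c * d) = LinearMap.mul' k k
    (TensorProduct.map (ε ∘ₗ LinearMap.mulLeft k b) (ε ∘ₗ LinearMap.mulRight k d) (flipT (Δ c)))

/-- The target counital map `b ↦ ε(1₍₁₎ b) 1₍₂₎`. -/
noncomputable def targetCounital (Δ : B →ₗ[k] B ⊗[k] B) (ε : B →ₗ[k] k) (b : B) : B :=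
  TensorProduct.lid k B ((ε ∘ₗ LinearMap.mulRight k b).rTensor B (Δ 1))

/-- The source counital map `b ↦ 1₍₁₎ ε(b 1₍₂₎)`. -/
noncomputable def sourceCounital (Δ : B →ₗ[k] B ⊗[k] B) (ε : B →ₗ[k] k) (b : B) : B :=
  TensorProduct.rid k B ((ε ∘ₗ LinearMap.mulLeft k b).lTensor B (Δ 1))

/-- `B` with comultiplication `Δ`, counit `ε` and antipode `S` is a weak Hopf algebra. -/
structure IsWeakHopfAlgebra (Δ : B →ₗ[k] B ⊗[k] B) (ε : B →ₗ[k] k) (S : B →ₗ[k] B) : Prop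
    extends IsWeakBialgebra Δ ε where
  /-- `b₍₁₎ S(b₍₂₎) = εₜ(b)` -/
  mul_antipode (b : B) : LinearMap.mul' k B (S.lTensor B (Δ b)) = targetCounital Δ ε b
  /-- `S(b₍₁₎) b₍₂₎ = εₛ(b)` -/
  antipode_mul (b : B) : LinearMap.mul' k B (S.rTensor B (Δ b)) = sourceCounital Δ ε b
  /-- `S(b₍₁₎) b₍₂₎ S(b₍₃₎) = S(b)` -/
  antipode_mul_antipode (b : B) : LinearMap.mul' k B
    (TensorProduct.map S (LinearMap.mul' k B ∘ₗ S.lTensor B ∘ₗ Δ) (Δ b)) = S b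

/-- `(B, 𝓡)` is a quasi-triangular weak Hopf algebra. -/
structure IsQuasitriangularWeakHopfAlgebra (Δ : B →ₗ[k] B ⊗[k] B) (ε : B →ₗ[k] k)
    (S : B →ₗ[k] B) (R : B ⊗[k] B) : Prop extends IsWeakHopfAlgebra Δ ε S where
  /-- `𝓡 ∈ Δᶜᵒᵖ(1) (B ⊗ B) Δ(1)` -/
  mem : ∃ t : B ⊗[k] B, R = flipT (Δ 1) * t * Δ 1
  /-- `Δᶜᵒᵖ(b) 𝓡 = 𝓡 Δ(b)` -/
  flip_comul_mul (b : B) : flipT (Δ b) * R = R * Δ b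
  /-- `(id ⊗ Δ)(𝓡) = 𝓡¹³ 𝓡¹²` -/
  comul_lTensor : Δ.lTensor B R = leg13 R * leg12 R
  /-- `(Δ ⊗ id)(𝓡) = 𝓡¹³ 𝓡²³` -/
  comul_rTensor : TensorProduct.assoc k B B B (Δ.rTensor B R) = leg13 R * leg23 R
  /-- There is `Q ∈ Δ(1) (B ⊗ B) Δᶜᵒᵖ(1)` with `𝓡 Q = Δᶜᵒᵖ(1)` and `Q 𝓡 = Δ(1)`. -/
  exists_inverse : ∃ Q : B ⊗[k] B, (∃ t : B ⊗[k] B, Q = Δ 1 * t * flipT (Δ 1)) ∧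
    R * Q = flipT (Δ 1) ∧ Q * R = Δ 1

/-- `(B, 𝓡)` is a triangular weak Hopf algebra: quasi-triangular, and the weak inverse of `𝓡`
is `𝓡²¹`. -/
structure IsTriangularWeakHopfAlgebra (Δ : B →ₗ[k] B ⊗[k] B) (ε : B →ₗ[k] k)
    (S : B →ₗ[k] B) (R : B ⊗[k] B) : Prop
    extends IsQuasitriangularWeakHopfAlgebra Δ ε S R where
  mul_flip : R * flipT R = flipT (Δ 1)
  flip_mul : flipT R * R = Δ 1

end Weak

end QTSmash

/-! Write `t(a) = a # 1`, `i(h) = 1 # h`, `s(a) = t(R²·a) i(R¹)`, and let `R̄` be the inverse of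
`R`. Quantum commutativity and the hexagon identities make `s` an anti-homomorphism `A → A # H`
whose image commutes with `t(A)`. So `e = s(x¹) ⊗ t(x²)`, the candidate for `Δ(1)`, is idempotent,
and `Δ = e δ` for the algebra map `δ(a # h) = (a # h₍₁₎) ⊗ (1 # h₍₂₎)`. If `e` commutes with the
image of `δ`, then `Δ` is multiplicative; coassociativity and the axioms on `Δ(1)` reduce to `e₁₂ (δ
⊗ id)(e) = e₁₂ e₂₃`, `(id ⊗ δ)(e) = e₁₂` and `e₁₂ e₂₃ = e₂₃ e₁₂`.

Commutation of `e` with `δ(i(h))` needs the invariance `S(h)·x¹ ⊗ x² = x¹ ⊗ h·x²`. The form `α` is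
the trace of the regular representation, hence unique and symmetric. Since `S²(h) u = u h` and `u`
acts trivially, `S²` is invisible on `A`; cyclicity of the trace then gives `α(h·a) = ε(h) α(a)`,
which dualizes to the invariance of `x` (`IsDualForm.antipode_smul_fst`). Triviality of `u` also
makes `S(R¹)R²` and `R²S(R¹)` act trivially, so that `i(S(R¹)) s(R²·a) = t(a)` (`placeRight_src`),
the identity behind the antipode axioms. For the counit, `A # H` acts on `A`, with `s(a)` acting as
right multiplication by `a`, and `ε(b) = α(b·1)`; the axioms become dual basis identities for `x`
and `α`.

For the R-matrix, the Müger condition says that on `A ⊗ H` the elements `R` and `R²¹` act as the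
inverses of `R²¹` and `R`. The decisive identity is `e²¹ R = R e` (`flipT_sepElement_mul_dblMap`).
Hence `𝓡 = e²¹ R = R e`, and its axioms follow from those of `R` together with rules for carrying
`s(a)` and `t(a)` through `R`; the weak inverse is `e R̄ e²¹`. -/

namespace QTSmash

/-! ### Legs and the flip -/

section Legs

variable {k B : Type*} [CommRing k] [Ring B] [Algebra k B]

@[simp] theorem leg12_tmul (p q : B) : leg12 (p ⊗ₜ[k] q) = p ⊗ₜ[k] (q ⊗ₜ[k] (1 : B)) := rfl

@[simp] theorem leg13_tmul (p q : B) : leg13 (p ⊗ₜ[k] q) = p ⊗ₜ[k] ((1 : B) ⊗ₜ[k] q) := rfl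

@[simp] theorem leg23_tmul (p q : B) : leg23 (p ⊗ₜ[k] q) = (1 : B) ⊗ₜ[k] (p ⊗ₜ[k] q) := rfl

@[simp] theorem flipT_tmul (p q : B) : flipT (p ⊗ₜ[k] q) = q ⊗ₜ[k] p := rfl

@[simp] theorem leg12_add (v w : B ⊗[k] B) : leg12 (v + w) = leg12 v + leg12 w := by
  simp [leg12, TensorProduct.add_tmul]

@[simp] theorem leg13_add (v w : B ⊗[k] B) : leg13 (v + w) = leg13 v + leg13 w := by
  simp [leg13]

@[simp] theorem leg23_add (v w : B ⊗[k] B) : leg23 (v + w) = leg23 v + leg23 w := by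
  simp [leg23, TensorProduct.tmul_add]

@[simp] theorem flipT_add (v w : B ⊗[k] B) : flipT (v + w) = flipT v + flipT w := by
  simp [flipT]

@[simp] theorem leg12_zero : leg12 (0 : B ⊗[k] B) = 0 := by simp [leg12]

@[simp] theorem leg13_zero : leg13 (0 : B ⊗[k] B) = 0 := by simp [leg13]

@[simp] theorem leg23_zero : leg23 (0 : B ⊗[k] B) = 0 := by simp [leg23]

@[simp] theorem flipT_zero : flipT (0 : B ⊗[k] B) = 0 := by simp [flipT]

@[simp] theorem flipT_flipT (w : B ⊗[k] B) : flipT (flipT w) = w := by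
  simp [flipT]

theorem flipT_mul (v w : B ⊗[k] B) : flipT (v * w) = flipT v * flipT w :=
  map_mul (Algebra.TensorProduct.comm k B B) v w

@[simp] theorem flipT_one : flipT (1 : B ⊗[k] B) = 1 := rfl

@[simp] theorem leg12_one : leg12 (1 : B ⊗[k] B) = 1 := rfl

@[simp] theorem leg13_one : leg13 (1 : B ⊗[k] B) = 1 := rfl

@[simp] theorem leg23_one : leg23 (1 : B ⊗[k] B) = 1 := rfl

theorem leg12_mul (v w : B ⊗[k] B) : leg12 (v * w) = leg12 v * leg12 w :=
  map_mul ((Algebra.TensorProduct.assoc k k k B B B).toAlgHom.comp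
    (Algebra.TensorProduct.includeLeft : B ⊗[k] B →ₐ[k] (B ⊗[k] B) ⊗[k] B)) v w

theorem leg13_mul (v w : B ⊗[k] B) : leg13 (v * w) = leg13 v * leg13 w :=
  map_mul (Algebra.TensorProduct.map (AlgHom.id k B)
    (Algebra.TensorProduct.includeRight : B →ₐ[k] B ⊗[k] B)) v w

theorem leg23_mul (v w : B ⊗[k] B) : leg23 (v * w) = leg23 v * leg23 w := by
  simp [leg23, Algebra.TensorProduct.tmul_mul_tmul]

end Legs

/-! ### The inverse of an R-matrix and the Drinfeld element -/

section Quasitriangular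

open Coalgebra HopfAlgebra

variable {k H : Type*} [CommRing k] [Ring H] [HopfAlgebra k H]

theorem comul_rTensor_mul (v w : H ⊗[k] H) :
    TensorProduct.assoc k H H H (comul.rTensor H (v * w)) =
      TensorProduct.assoc k H H H (comul.rTensor H v) *
        TensorProduct.assoc k H H H (comul.rTensor H w) :=
  map_mul ((Algebra.TensorProduct.assoc k k k H H H).toAlgHom.comp
    (Algebra.TensorProduct.map (Bialgebra.comulAlgHom k H) (AlgHom.id k H))) v w

theorem comul_lTensor_mul (v w : H ⊗[k] H) :
    comul.lTensor H (v * w) = comul.lTensor H v * comul.lTensor H w :=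
  map_mul (Algebra.TensorProduct.map (AlgHom.id k H) (Bialgebra.comulAlgHom k H)) v w

theorem comul_rTensor_one :
    TensorProduct.assoc k H H H (comul.rTensor H (1 : H ⊗[k] H)) = 1 :=
  map_one ((Algebra.TensorProduct.assoc k k k H H H).toAlgHom.comp
    (Algebra.TensorProduct.map (Bialgebra.comulAlgHom k H) (AlgHom.id k H)))

theorem comul_lTensor_one : comul.lTensor H (1 : H ⊗[k] H) = 1 :=
  map_one (Algebra.TensorProduct.map (AlgHom.id k H) (Bialgebra.comulAlgHom k H))

/-- `w ↦ S(w¹) ⊗ w²`; it sends an R-matrix to its inverse. -/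
noncomputable def antipodeFst : H ⊗[k] H →ₗ[k] H ⊗[k] H := (antipode k).rTensor H

@[simp] theorem antipodeFst_tmul (p q : H) :
    antipodeFst (p ⊗ₜ[k] q) = antipode k p ⊗ₜ[k] q := rfl

theorem drinfeldElement_tmul (p q : H) :
    drinfeldElement (p ⊗ₜ[k] q) = antipode k q * p := rfl

theorem drinfeldElement_add (v w : H ⊗[k] H) :
    drinfeldElement (v + w) = drinfeldElement v + drinfeldElement w := by
  simp [drinfeldElement]

@[simp] theorem drinfeldElement_zero : drinfeldElement (0 : H ⊗[k] H) = 0 := by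
  simp [drinfeldElement]

/-- `w ↦ ε(w¹) w²`. -/
noncomputable def counitFst : H ⊗[k] H →ₗ[k] H :=
  (TensorProduct.lid k H).toLinearMap ∘ₗ counit.rTensor H

/-- `w ↦ w¹ ε(w²)`. -/
noncomputable def counitSnd : H ⊗[k] H →ₗ[k] H :=
  (TensorProduct.rid k H).toLinearMap ∘ₗ counit.lTensor H

@[simp] theorem counitFst_tmul (p q : H) : counitFst (p ⊗ₜ[k] q) = counit (R := k) p • q := rfl

@[simp] theorem counitSnd_tmul (p q : H) : counitSnd (p ⊗ₜ[k] q) = counit (R := k) q • p := rfl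

theorem counitFst_comul (h : H) : counitFst (comul (R := k) h) = h := by
  simp [counitFst]

theorem counitSnd_comul (h : H) : counitSnd (comul (R := k) h) = h := by
  simp [counitSnd]

theorem counitSnd_mul (v w : H ⊗[k] H) : counitSnd (v * w) = counitSnd v * counitSnd w :=
  map_mul ((Algebra.TensorProduct.rid k k H).toAlgHom.comp
    (Algebra.TensorProduct.map (AlgHom.id k H) (Bialgebra.counitAlgHom k H))) v w

variable {R : H ⊗[k] H}

namespace IsQuasitriangular

/-- Apply `ε` to the first leg of `(Δ ⊗ id)(R) = R¹³ R²³` and cancel the invertible `R`. -/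
theorem counitFst_eq (hR : IsQuasitriangular R) : counitFst R = 1 := by
  let F : H ⊗[k] (H ⊗[k] H) →ₗ[k] H ⊗[k] H :=
    (TensorProduct.lid k (H ⊗[k] H)).toLinearMap ∘ₗ counit.rTensor (H ⊗[k] H)
  have h1 (w : H ⊗[k] H) : F (TensorProduct.assoc k H H H (comul.rTensor H w)) = w := by
    induction w with
    | zero => simp
    | add v w hv hw => simp only [map_add, hv, hw]
    | tmul p q =>
      have h3 (z : H ⊗[k] H) : F (TensorProduct.assoc k H H H (z ⊗ₜ q)) =
          counitFst z ⊗ₜ q := by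
        induction z with
        | zero => simp
        | add v w hv hw => simp only [map_add, TensorProduct.add_tmul, hv, hw]
        | tmul a b => simp [F, TensorProduct.smul_tmul']
      simp [h3, counitFst_comul]
  have h2 (v w : H ⊗[k] H) : F (leg13 v * leg23 w) = (1 ⊗ₜ counitFst v) * w := by
    induction v with
    | zero => simp
    | add v v' hv hv' => simp only [map_add, leg13_add, add_mul, hv, hv', TensorProduct.tmul_add]
    | tmul p q =>
      induction w with
      | zero => simp
      | add w w' hw hw' => simp only [map_add, leg23_add, mul_add, hw, hw']
      | tmul a b => simp [F]
  have h3 : (1 ⊗ₜ[k] counitFst R) * R = 1 * R := by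
    rw [← h2, ← hR.comul_rTensor, h1, one_mul]
  have h4 := hR.isUnit.mul_right_cancel h3
  have h5 := congrArg counitFst h4
  simpa [Algebra.TensorProduct.one_def] using h5

theorem counitSnd_eq (hR : IsQuasitriangular R) : counitSnd R = 1 := by
  let F : H ⊗[k] (H ⊗[k] H) →ₗ[k] H ⊗[k] H := counitSnd.lTensor H
  have h1 (w : H ⊗[k] H) : F (comul.lTensor H w) = w := by
    induction w with
    | zero => simp
    | add v w hv hw => simp only [map_add, hv, hw]
    | tmul p q => simp [F, counitSnd_comul]
  have h2 (v w : H ⊗[k] H) : F (leg13 v * leg12 w) = (counitSnd v ⊗ₜ 1) * w := by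
    induction v with
    | zero => simp
    | add v v' hv hv' => simp only [map_add, leg13_add, add_mul, hv, hv', TensorProduct.add_tmul]
    | tmul p q =>
      induction w with
      | zero => simp
      | add w w' hw hw' => simp only [map_add, leg12_add, mul_add, hw, hw']
      | tmul a b => simp [F, TensorProduct.smul_tmul']
  have h3 : (counitSnd R ⊗ₜ[k] 1) * R = 1 * R := by
    rw [← h2, ← hR.comul_lTensor, h1, one_mul]
  have h4 := hR.isUnit.mul_right_cancel h3
  have h5 := congrArg counitSnd h4
  simpa [Algebra.TensorProduct.one_def] using h5

/-- Contracting the first two legs of `(Δ ⊗ id)(R) = R¹³ R²³` by `p ⊗ q ↦ S(p) q` gives `ε(R¹) R² =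
1` on one side and `(S ⊗ id)(R) R` on the other. -/
theorem antipodeFst_mul (hR : IsQuasitriangular R) : antipodeFst R * R = 1 := by
  let F : H ⊗[k] (H ⊗[k] H) →ₗ[k] H ⊗[k] H :=
    (LinearMap.mul' k H ∘ₗ (antipode k).rTensor H).rTensor H ∘ₗ
      (TensorProduct.assoc k H H H).symm.toLinearMap
  have h1 (w : H ⊗[k] H) : F (TensorProduct.assoc k H H H (comul.rTensor H w)) =
      1 ⊗ₜ counitFst w := by
    induction w with
    | zero => simp
    | add v w hv hw => simp only [map_add, hv, hw, TensorProduct.tmul_add]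
    | tmul p q => simp [F, Algebra.algebraMap_eq_smul_one, TensorProduct.smul_tmul]
  have h2 (v w : H ⊗[k] H) : F (leg13 v * leg23 w) = antipodeFst v * w := by
    induction v with
    | zero => simp
    | add v v' hv hv' => simp only [map_add, leg13_add, add_mul, hv, hv']
    | tmul p q =>
      induction w with
      | zero => simp
      | add w w' hw hw' => simp only [map_add, leg23_add, mul_add, hw, hw']
      | tmul a b => simp [F]
  rw [← h2, ← hR.comul_rTensor, h1, hR.counitFst_eq, Algebra.TensorProduct.one_def]

theorem mul_antipodeFst (hR : IsQuasitriangular R) : R * antipodeFst R = 1 := by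
  obtain ⟨c, hc⟩ := hR.isUnit.exists_right_inv
  rwa [left_inv_eq_right_inv hR.antipodeFst_mul hc]

/-- The hexagon identities for `R̄` are the inverses of those for `R`, since `Δ ⊗ id` and `id ⊗ Δ`
are multiplicative. -/
theorem comul_rTensor_antipodeFst (hR : IsQuasitriangular R) :
    TensorProduct.assoc k H H H (comul.rTensor H (antipodeFst R)) =
      leg23 (antipodeFst R) * leg13 (antipodeFst R) := by
  refine left_inv_eq_right_inv (a := leg13 R * leg23 R) ?_ ?_
  · rw [← hR.comul_rTensor, ← comul_rTensor_mul, hR.antipodeFst_mul, comul_rTensor_one]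
  · rw [mul_assoc, ← mul_assoc (leg23 R), ← leg23_mul, hR.mul_antipodeFst, leg23_one, one_mul,
      ← leg13_mul, hR.mul_antipodeFst, leg13_one]

theorem comul_lTensor_antipodeFst (hR : IsQuasitriangular R) :
    comul.lTensor H (antipodeFst R) = leg12 (antipodeFst R) * leg13 (antipodeFst R) := by
  refine left_inv_eq_right_inv (a := leg13 R * leg12 R) ?_ ?_
  · rw [← hR.comul_lTensor, ← comul_lTensor_mul, hR.antipodeFst_mul, comul_lTensor_one]
  · rw [mul_assoc, ← mul_assoc (leg12 R), ← leg12_mul, hR.mul_antipodeFst, leg12_one, one_mul,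
      ← leg13_mul, hR.mul_antipodeFst, leg13_one]

theorem counitSnd_antipodeFst (hR : IsQuasitriangular R) : counitSnd (antipodeFst R) = 1 := by
  have h := congrArg counitSnd hR.antipodeFst_mul
  rwa [counitSnd_mul, hR.counitSnd_eq, mul_one, Algebra.TensorProduct.one_def, counitSnd_tmul,
    Bialgebra.counit_one, one_smul] at h

/-- `(S ⊗ S)(R) = R` -/
theorem antipode_map_antipode (hR : IsQuasitriangular R) :
    (antipode k).lTensor H (antipodeFst R) = R := by
  let F : H ⊗[k] (H ⊗[k] H) →ₗ[k] H ⊗[k] H :=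
    (LinearMap.mul' k H ∘ₗ (antipode k).lTensor H).lTensor H
  have h1 (w : H ⊗[k] H) : F (comul.lTensor H w) = counitSnd w ⊗ₜ 1 := by
    induction w with
    | zero => simp
    | add v w hv hw => simp only [map_add, hv, hw, TensorProduct.add_tmul]
    | tmul p q => simp [F, Algebra.algebraMap_eq_smul_one, TensorProduct.smul_tmul]
  have h2 (v w : H ⊗[k] H) : F (leg12 v * leg13 w) = v * (antipode k).lTensor H w := by
    induction v with
    | zero => simp
    | add v v' hv hv' => simp only [map_add, leg12_add, add_mul, hv, hv']
    | tmul p q =>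
      induction w with
      | zero => simp
      | add w w' hw hw' => simp only [map_add, leg13_add, mul_add, hw, hw']
      | tmul a b => simp [F]
  -- Contracting the last two legs of `(id ⊗ Δ)(R̄) = R̄¹² R̄¹³` shows that `(id ⊗ S)(R̄)` is a
  -- right inverse of `R̄`, so it equals `R`.
  refine (left_inv_eq_right_inv (a := antipodeFst R) hR.mul_antipodeFst ?_).symm
  rw [← h2, ← hR.comul_lTensor_antipodeFst, h1, hR.counitSnd_antipodeFst,
    Algebra.TensorProduct.one_def]

/-- `S²(h) u = u h` -/
theorem antipode_antipode_mul_drinfeldElement (hR : IsQuasitriangular R) (h : H) :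
    antipode k (antipode k h) * drinfeldElement R = drinfeldElement R * h := by
  -- After `R Δ(g) = Δᶜᵒᵖ(g) R` the coproduct of `g` appears as `S(g₍₁₎) g₍₂₎` between `S(R²)` and
  -- `R¹`.
  have h1 (g : H) : drinfeldElement (R * comul g) = counit (R := k) g • drinfeldElement R := by
    rw [hR.mul_comul]
    have h2 (p q : H) (v : H ⊗[k] H) : drinfeldElement (flipT v * (p ⊗ₜ q)) =
        antipode k q * LinearMap.mul' k H ((antipode k).rTensor H v) * p := by
      induction v with
      | zero => simp
      | add v w hv hw =>
        simp only [flipT_add, drinfeldElement_add, map_add, mul_add, add_mul, hv, hw]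
      | tmul a b => simp [drinfeldElement_tmul, antipode_mul_antidistrib, mul_assoc]
    generalize R = w
    induction w with
    | zero => simp
    | add v w hv hw => simp only [drinfeldElement_add, mul_add, smul_add, hv, hw]
    | tmul p q => simp [h2, drinfeldElement_tmul, Algebra.algebraMap_eq_smul_one]
  -- `G` is `p ⊗ q ⊗ r ↦ S(q S(r)) u p`. On `h₍₁₎ ⊗ h₍₂₎ ⊗ h₍₃₎`, grouping the last two legs gives
  -- `u h`; grouping the first two gives `S²(h) u` by `h1`.
  let G : H ⊗[k] (H ⊗[k] H) →ₗ[k] H :=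
    LinearMap.mul' k H ∘ₗ TensorProduct.map
      (antipode k ∘ₗ LinearMap.mul' k H ∘ₗ (antipode k).lTensor H)
      (LinearMap.mulLeft k (drinfeldElement R)) ∘ₗ
      (TensorProduct.comm k H (H ⊗[k] H)).toLinearMap
  have hG (p q r : H) : G (p ⊗ₜ (q ⊗ₜ r)) =
      antipode k (antipode k r) * drinfeldElement (R * (p ⊗ₜ q)) := by
    have (w : H ⊗[k] H) :
        antipode k q * (drinfeldElement w * p) = drinfeldElement (w * (p ⊗ₜ q)) := by
      induction w with
      | zero => simp
      | add v w hv hw => simp only [drinfeldElement_add, mul_add, add_mul, hv, hw]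
      | tmul a b => simp [drinfeldElement_tmul, antipode_mul_antidistrib, mul_assoc]
    simp [G, antipode_mul_antidistrib, mul_assoc, this]
  have h3 (z : H ⊗[k] H) : G (TensorProduct.assoc k H H H (comul.rTensor H z)) =
      antipode k (antipode k (counitFst z)) * drinfeldElement R := by
    induction z with
    | zero => simp
    | add v w hv hw => simp only [map_add, add_mul, hv, hw]
    | tmul g r =>
      have (w : H ⊗[k] H) : G (TensorProduct.assoc k H H H (w ⊗ₜ r)) =
          antipode k (antipode k r) * drinfeldElement (R * w) := by
        induction w with
        | zero => simp
        | add v w hv hw =>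
          simp only [map_add, TensorProduct.add_tmul, mul_add, drinfeldElement_add, hv, hw]
        | tmul a b => simp [hG]
      simp [this, h1]
  have h4 (z : H ⊗[k] H) : G (comul.lTensor H z) = drinfeldElement R * counitSnd z := by
    induction z with
    | zero => simp
    | add v w hv hw => simp only [map_add, mul_add, hv, hw]
    | tmul g r => simp [G, Algebra.algebraMap_eq_smul_one]
  have h5 := congrArg G (Coalgebra.coassoc_apply (R := k) h)
  rwa [h3, h4, counitFst_comul, counitSnd_comul] at h5

end IsQuasitriangular

end Quasitriangular

/-! ### The form dual to a symmetric separability idempotent -/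

section Frobenius

variable {k A : Type*} [Field k] [Ring A] [Algebra k A] {x : A ⊗[k] A}

theorem IsSymmetricSeparabilityIdempotent.central'
    (hx : IsSymmetricSeparabilityIdempotent x) (a : A) :
    ((1 : A) ⊗ₜ[k] a) * x = x * (a ⊗ₜ[k] (1 : A)) := by
  have h := congrArg flipT (hx.central a)
  rwa [flipT_mul, flipT_mul, hx.symm] at h

/-- The elements `⟨f, x¹⟩ x²`, for `f` a linear form, include `1`. -/
theorem IsSymmetricSeparabilityIdempotent.exists_isDualForm
    (hx : IsSymmetricSeparabilityIdempotent x) : ∃ α : A →ₗ[k] k, IsDualForm x α := by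
  let θ : (A →ₗ[k] k) →ₗ[k] A := (TensorProduct.lid k A).toLinearMap ∘ₗ
    (LinearMap.applyₗ x) ∘ₗ LinearMap.rTensorHom A
  have hθ (f : A →ₗ[k] k) : θ f = TensorProduct.lid k A (f.rTensor A x) := rfl
  -- The range of `θ` is a left ideal, by centrality of `x`.
  have hl (a : A) (f : A →ₗ[k] k) : a * θ f = θ (f ∘ₗ LinearMap.mulRight k a) := by
    have h1 (w : A ⊗[k] A) : TensorProduct.lid k A (f.rTensor A ((1 ⊗ₜ a) * w)) =
        a * TensorProduct.lid k A (f.rTensor A w) := by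
      induction w with
      | zero => simp
      | add v w hv hw => simp only [map_add, mul_add, hv, hw]
      | tmul p q => simp
    have h2 (w : A ⊗[k] A) : TensorProduct.lid k A (f.rTensor A (w * (a ⊗ₜ 1))) =
        TensorProduct.lid k A ((f ∘ₗ LinearMap.mulRight k a).rTensor A w) := by
      induction w with
      | zero => simp
      | add v w hv hw => simp only [map_add, add_mul, hv, hw]
      | tmul p q => simp
    rw [hθ, hθ, ← h1, hx.central', h2]
  have h1 : (1 : A) ∈ LinearMap.range θ := by
    classical
    let b := Module.Basis.ofVectorSpace k A
    let c := TensorProduct.equivFinsuppOfBasisLeft (N := A) b x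
    have hc : (c.sum fun i n => b i ⊗ₜ[k] n) = x := by
      rw [← TensorProduct.equivFinsuppOfBasisLeft_symm_apply, LinearEquiv.symm_apply_apply]
    have hmem (j) : c j ∈ LinearMap.range θ :=
      ⟨b.coord j, (TensorProduct.equivFinsuppOfBasisLeft_apply b x j).symm⟩
    -- With `x = ∑ bⱼ ⊗ cⱼ` in a basis of `A`, each `cⱼ` is the value of `θ` at a coordinate form,
    -- so `1 = ∑ bⱼ cⱼ` lies in the left ideal.
    rw [← hx.mul_eq_one, ← hc, Finsupp.sum, map_sum]
    refine Submodule.sum_mem _ fun j _ => ?_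
    obtain ⟨f, hf⟩ := hmem j
    rw [LinearMap.mul'_apply, ← hf, hl]
    exact ⟨_, rfl⟩
  exact h1

variable {α : A →ₗ[k] k}

/-- `x¹ ⟨f, x²⟩` -/
noncomputable def evalSnd (f : A →ₗ[k] k) : A ⊗[k] A →ₗ[k] A :=
  (TensorProduct.rid k A).toLinearMap ∘ₗ f.lTensor A

@[simp] theorem evalSnd_tmul (f : A →ₗ[k] k) (a b : A) : evalSnd f (a ⊗ₜ[k] b) = f b • a := rfl

section Dual

variable (hx : IsSymmetricSeparabilityIdempotent x) (hα : IsDualForm x α)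
include hx hα

/-- `x¹ ⟨α, x²⟩ = 1` -/
theorem evalSnd_eq_one : evalSnd α x = 1 := by
  have h (w : A ⊗[k] A) : evalSnd α (flipT w) = TensorProduct.lid k A (α.rTensor A w) := by
    induction w with
    | zero => simp
    | add v w hv hw => simp only [map_add, flipT_add, hv, hw]
    | tmul p q => simp
  rw [← hx.symm, h]
  exact hα

/-- `x¹ ⟨α, a x²⟩ = a` -/
theorem evalSnd_mulLeft (a : A) : evalSnd (α ∘ₗ LinearMap.mulLeft k a) x = a := by
  have h1 (w : A ⊗[k] A) :
      evalSnd (α ∘ₗ LinearMap.mulLeft k a) w = evalSnd α ((1 ⊗ₜ a) * w) := by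
    induction w with
    | zero => simp
    | add v w hv hw => simp only [map_add, mul_add, hv, hw]
    | tmul p q => simp
  have h2 (w : A ⊗[k] A) : evalSnd α (w * (a ⊗ₜ 1)) = evalSnd α w * a := by
    induction w with
    | zero => simp
    | add v w hv hw => simp only [map_add, add_mul, hv, hw]
    | tmul p q => simp
  rw [h1, hx.central', h2, evalSnd_eq_one hx hα, one_mul]

/-- `x¹ ⟨α, x² a⟩ = a` -/
theorem evalSnd_mulRight (a : A) : evalSnd (α ∘ₗ LinearMap.mulRight k a) x = a := by
  have h1 (w : A ⊗[k] A) :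
      evalSnd (α ∘ₗ LinearMap.mulRight k a) w = evalSnd α (w * (1 ⊗ₜ a)) := by
    induction w with
    | zero => simp
    | add v w hv hw => simp only [map_add, add_mul, hv, hw]
    | tmul p q => simp
  have h2 (w : A ⊗[k] A) : evalSnd α ((a ⊗ₜ 1) * w) = a * evalSnd α w := by
    induction w with
    | zero => simp
    | add v w hv hw => simp only [map_add, mul_add, hv, hw]
    | tmul p q => simp
  rw [h1, ← hx.central, h2, evalSnd_eq_one hx hα, mul_one]

/-- An expansion of `x` with the expansions of elements in the dual bases it provides. -/
theorem exists_dualBases : ∃ (n : ℕ) (y z : Fin n → A), x = ∑ j, y j ⊗ₜ[k] z j ∧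
    (∀ a, ∑ j, α (a * z j) • y j = a) ∧ ∀ a, ∑ j, α (z j * a) • y j = a := by
  obtain ⟨n, y, z, h⟩ : ∃ (n : ℕ) (y z : Fin n → A), x = ∑ j, y j ⊗ₜ[k] z j := by
    obtain ⟨S, hS⟩ := TensorProduct.exists_finset x
    refine ⟨S.card, fun j => (S.equivFin.symm j).1.1, fun j => (S.equivFin.symm j).1.2, ?_⟩
    rw [hS, ← Finset.sum_coe_sort]
    exact (Equiv.sum_comp S.equivFin.symm (fun p : S => p.1.1 ⊗ₜ[k] p.1.2)).symm
  refine ⟨n, y, z, h, fun a => ?_, fun a => ?_⟩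
  · conv_rhs => rw [← evalSnd_mulLeft hx hα a, h]
    simp
  · conv_rhs => rw [← evalSnd_mulRight hx hα a, h]
    simp

/-- The first legs of `x` span `A`, because each `a` equals `x¹ ⟨α, a x²⟩`. Finite dimension gives
access to the trace. -/
theorem finite_of_isDualForm : Module.Finite k A := by
  obtain ⟨n, y, z, -, h, -⟩ := exists_dualBases hx hα
  classical
  refine ⟨⟨Finset.univ.image y, ?_⟩⟩
  rw [eq_top_iff]
  intro a _
  rw [← h a]
  exact Submodule.sum_mem _ fun j _ => Submodule.smul_mem _ _ (Submodule.subset_span (by simp))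

/-- The dual form is the trace of the regular representation. -/
theorem IsDualForm.eq_trace (a : A) : α a = LinearMap.trace k A (LinearMap.mulLeft k a) := by
  have := finite_of_isDualForm hx hα
  obtain ⟨n, y, z, hxs, h, -⟩ := exists_dualBases hx hα
  -- Multiplying the expansion `b = ∑ α(b zⱼ) yⱼ` by `a` writes left multiplication as a sum of rank
  -- one maps; its trace is `∑ α(a yⱼ zⱼ) = α(a)`, since `x¹ x² = 1`.
  have h1 : LinearMap.mulLeft k a = dualTensorHom k A A
      (∑ j, (α ∘ₗ LinearMap.mulRight k (z j)) ⊗ₜ[k] (a * y j)) := by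
    ext b
    conv_lhs => rw [← h b]
    simp
  rw [h1, LinearMap.trace_eq_contract_apply, map_sum]
  have h2 := hx.mul_eq_one
  rw [hxs, map_sum] at h2
  conv_lhs => rw [← mul_one a, ← h2]
  simp [Finset.mul_sum, mul_assoc]

/-- The trace of the regular representation does not depend on the form. -/
theorem IsDualForm.eq {β : A →ₗ[k] k} (hβ : IsDualForm x β) : β = α := by
  ext a
  rw [IsDualForm.eq_trace hx hα, IsDualForm.eq_trace hx hβ]

theorem IsDualForm.apply_mul_comm (a b : A) : α (a * b) = α (b * a) := by
  rw [IsDualForm.eq_trace hx hα, IsDualForm.eq_trace hx hα, LinearMap.mulLeft_mul,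
    LinearMap.mulLeft_mul]
  exact LinearMap.trace_mul_comm k _ _

/-- Two-tensors are separated by the forms `⟨α, b -⟩` on their second leg. -/
theorem IsDualForm.tensor_ext {v w : A ⊗[k] A}
    (h : ∀ b, evalSnd (α ∘ₗ LinearMap.mulLeft k b) v = evalSnd (α ∘ₗ LinearMap.mulLeft k b) w) :
    v = w := by
  obtain ⟨n, y, z, -, -, h2⟩ := exists_dualBases hx hα
  have h3 (w : A ⊗[k] A) :
      ∑ j, evalSnd (α ∘ₗ LinearMap.mulLeft k (z j)) w ⊗ₜ[k] y j = w := by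
    induction w with
    | zero => simp
    | add v w hv hw =>
      conv_rhs => rw [← hv, ← hw]
      simp only [map_add, TensorProduct.add_tmul, Finset.sum_add_distrib]
    | tmul p q =>
      conv_rhs => rw [← h2 q]
      simp [TensorProduct.tmul_sum, TensorProduct.smul_tmul]
  rw [← h3 v, ← h3 w]
  simp only [h]

end Dual

end Frobenius

/-! ### Invariance of the dual form -/

section Invariance

open Coalgebra HopfAlgebra

variable {k H A : Type*} [Field k] [Ring H] [HopfAlgebra k H] [Ring A] [Algebra k A]
  [Module H A] [IsScalarTower k H A]

/-- Let both sides of `S²(h) u = u h` act, with `u` trivial. From here on, `S²` may be dropped in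
front of elements of `A`. -/
theorem IsQuasitriangular.antipode_antipode_smul {R : H ⊗[k] H} (hR : IsQuasitriangular R)
    (hu : ∀ a : A, drinfeldElement R • a = a) (h : H) (a : A) :
    antipode k (antipode k h) • a = h • a := by
  conv_lhs => rw [← hu a]
  rw [← mul_smul, hR.antipode_antipode_mul_drinfeldElement, mul_smul, hu]

/-- `(h • a) b = h₍₁₎ • (a (S(h₍₂₎) • b))` -/
theorem smul_mul_eq [ModuleAlgebra k H A] (h : H) (a b : A) :
    (h • a) * b = TensorProduct.lift ((act k H A).compl₂
      (LinearMap.mulLeft k a ∘ₗ (act k H A).flip b ∘ₗ antipode k)) (comul h) := by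
  -- Both sides are groupings of `(h₍₁₎·a) (h₍₂₎ S(h₍₃₎)·b)`.
  let F : H ⊗[k] (H ⊗[k] H) →ₗ[k] A :=
    LinearMap.mul' k A ∘ₗ TensorProduct.map ((act k H A).flip a)
      ((act k H A).flip b ∘ₗ LinearMap.mul' k H ∘ₗ (antipode k).lTensor H)
  have h1 (z : H ⊗[k] H) : F (TensorProduct.assoc k H H H (comul.rTensor H z)) =
      TensorProduct.lift ((act k H A).compl₂
        (LinearMap.mulLeft k a ∘ₗ (act k H A).flip b ∘ₗ antipode k)) z := by
    induction z with
    | zero => simp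
    | add v w hv hw => simp only [map_add, hv, hw]
    | tmul p r =>
      have h2 (w : H ⊗[k] H) : F (TensorProduct.assoc k H H H (w ⊗ₜ r)) =
          LinearMap.mul' k A (actBoth k H A w (a ⊗ₜ (antipode k r • b))) := by
        induction w with
        | zero => simp
        | add v w hv hw =>
          simp only [map_add, TensorProduct.add_tmul, LinearMap.add_apply, hv, hw]
        | tmul p q => simp [F, mul_smul]
      simp [h2, ModuleAlgebra.smul_mul (k := k)]
  have h3 (z : H ⊗[k] H) : F (comul.lTensor H z) = (counitSnd z • a) * b := by
    induction z with
    | zero => simp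
    | add v w hv hw => simp only [map_add, add_smul, add_mul, hv, hw]
    | tmul p r => simp [F, Algebra.algebraMap_eq_smul_one]
  rw [← h1, Coalgebra.coassoc_apply, h3, counitSnd_comul]

variable {x : A ⊗[k] A} {α : A →ₗ[k] k}

section Dual

variable [ModuleAlgebra k H A]
  (hx : IsSymmetricSeparabilityIdempotent x) (hα : IsDualForm x α)
  (hS : ∀ (h : H) (a : A), antipode k (antipode k h) • a = h • a)
include hx hα hS

/-- `⟨α, h • a⟩ = ε(h) ⟨α, a⟩` -/
theorem IsDualForm.apply_smul (h : H) (a : A) : α (h • a) = counit (R := k) h * α a := by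
  have := finite_of_isDualForm hx hα
  let G : H ⊗[k] H →ₗ[k] Module.End k A :=
    TensorProduct.lift (((LinearMap.mul k (Module.End k A)).compl₂
      (LinearMap.mulLeft k (LinearMap.mulLeft k a) ∘ₗ act k H A ∘ₗ antipode k)) ∘ₗ act k H A)
  -- With `L` denoting left multiplication, `smul_mul_eq` reads `L(h·a) = h₍₁₎ L(a) S(h₍₂₎)` in
  -- `End(A)`.
  have h1 : LinearMap.mulLeft k (h • a) = G (comul h) := by
    have h2 (b : A) (w : H ⊗[k] H) : TensorProduct.lift ((act k H A).compl₂
        (LinearMap.mulLeft k a ∘ₗ (act k H A).flip b ∘ₗ antipode k)) w = G w b := by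
      induction w with
      | zero => simp
      | add v w hv hw => simp only [map_add, LinearMap.add_apply, hv, hw]
      | tmul p q => simp [G]
    ext b
    rw [LinearMap.mulLeft_apply, smul_mul_eq (k := k), h2]
  have h3 (w : H ⊗[k] H) : LinearMap.trace k A (G w) = LinearMap.trace k A
      (LinearMap.mulLeft k a * act k H A
        (antipode k (LinearMap.mul' k H ((antipode k).rTensor H w)))) := by
    induction w with
    | zero => simp
    | add v w hv hw => simp only [map_add, mul_add, hv, hw]
    | tmul p q =>
      -- Cyclicity of the trace produces `S(h₍₂₎) h₍₁₎`, in the wrong order for the antipode axiom;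
      -- as `S²` acts trivially it acts as `S(S(h₍₁₎) h₍₂₎) = ε(h)`.
      have h4 : act k H A (antipode k (antipode k p * q)) =
          act k H A (antipode k q) * act k H A p := by
        ext b
        simp [antipode_mul_antidistrib, mul_smul, hS]
      simp only [LinearMap.rTensor_tmul, LinearMap.mul'_apply, h4, G, TensorProduct.lift.tmul,
        LinearMap.comp_apply, LinearMap.compl₂_apply, LinearMap.mul_apply',
        LinearMap.mulLeft_apply]
      rw [LinearMap.trace_mul_comm, mul_assoc]
  rw [IsDualForm.eq_trace hx hα, IsDualForm.eq_trace hx hα, h1, h3,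
    mul_antipode_rTensor_comul_apply, Algebra.algebraMap_eq_smul_one, map_smul, antipode_one,
    map_smul, mul_smul_comm, map_smul, smul_eq_mul]
  congr 2
  ext b
  simp

/-- `⟨α, (h • a) b⟩ = ⟨α, a (S(h) • b)⟩` -/
theorem IsDualForm.apply_smul_mul (h : H) (a b : A) :
    α ((h • a) * b) = α (a * (antipode k h • b)) := by
  have h1 (w : H ⊗[k] H) : α (TensorProduct.lift ((act k H A).compl₂
      (LinearMap.mulLeft k a ∘ₗ (act k H A).flip b ∘ₗ antipode k)) w) =
        α (a * (antipode k (counitFst w) • b)) := by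
    induction w with
    | zero => simp
    | add v w hv hw => simp only [map_add, add_smul, mul_add, hv, hw]
    | tmul p q => simp [IsDualForm.apply_smul hx hα hS]
  rw [smul_mul_eq (k := k), h1, counitFst_comul]

/-- `S(h) • x¹ ⊗ x² = x¹ ⊗ h • x²` -/
theorem IsDualForm.antipode_smul_fst (h : H) :
    actBoth k H A (antipode k h ⊗ₜ 1) x = actBoth k H A (1 ⊗ₜ h) x := by
  -- Pairing the second leg with `⟨α, b -⟩` sends both sides to `S(h)·b`.
  refine IsDualForm.tensor_ext hx hα fun b => ?_
  have h1 (w : A ⊗[k] A) : evalSnd (α ∘ₗ LinearMap.mulLeft k b)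
      (actBoth k H A (antipode k h ⊗ₜ 1) w) =
      antipode k h • evalSnd (α ∘ₗ LinearMap.mulLeft k b) w := by
    induction w with
    | zero => simp
    | add v w hv hw => simp only [map_add, smul_add, hv, hw]
    | tmul p q => simp [smul_comm (antipode k h) (α (b * q))]
  have h2 (w : A ⊗[k] A) : evalSnd (α ∘ₗ LinearMap.mulLeft k b)
      (actBoth k H A (1 ⊗ₜ h) w) =
      evalSnd (α ∘ₗ LinearMap.mulRight k (antipode k h • b)) w := by
    induction w with
    | zero => simp
    | add v w hv hw => simp only [map_add, hv, hw]
    | tmul p q =>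
      simp [IsDualForm.apply_mul_comm hx hα b, IsDualForm.apply_smul_mul hx hα hS]
  rw [h1, h2, evalSnd_mulLeft hx hα, evalSnd_mulRight hx hα]

/-- `S(u)` is the adjoint of `u` for the nondegenerate pairing `⟨α, a b⟩`. -/
theorem IsDualForm.antipode_smul_eq {u : H} (hu : ∀ a : A, u • a = a) (a : A) :
    antipode k u • a = a := by
  rw [← evalSnd_mulRight hx hα (antipode k u • a)]
  conv_rhs => rw [← evalSnd_mulRight hx hα a]
  congr 2
  ext b
  simp [← IsDualForm.apply_smul_mul hx hα hS, hu]

variable {R : H ⊗[k] H} (hR : IsQuasitriangular R) (hu : ∀ a : A, drinfeldElement R • a = a)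
include hR hu

/-- `S(R¹) R²` acts trivially. -/
theorem IsDualForm.mul'_antipodeFst_smul (a : A) :
    LinearMap.mul' k H (antipodeFst R) • a = a := by
  -- `S(S(R²) R¹) = S(R¹) S²(R²)`, and the `S²` disappears in the action.
  have h (w : H ⊗[k] H) : LinearMap.mul' k H (antipodeFst w) • a =
      antipode k (drinfeldElement w) • a := by
    induction w with
    | zero => simp
    | add v w hv hw => simp only [map_add, drinfeldElement_add, add_smul, hv, hw]
    | tmul p q => simp [drinfeldElement_tmul, antipode_mul_antidistrib, mul_smul, hS]
  rw [h, IsDualForm.antipode_smul_eq hx hα hS hu]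

/-- `R² S(R¹)` acts trivially. -/
theorem IsDualForm.mul'_flipT_antipodeFst_smul (a : A) :
    LinearMap.mul' k H (flipT (antipodeFst R)) • a = a := by
  have h1 (w : H ⊗[k] H) : LinearMap.mul' k H (flipT (antipodeFst w)) • a =
      antipode k (LinearMap.mul' k H ((antipode k).lTensor H w)) • a := by
    induction w with
    | zero => simp
    | add v w hv hw => simp only [map_add, flipT_add, add_smul, hv, hw]
    | tmul p q => simp [antipode_mul_antidistrib, mul_smul, hS]
  have h2 (w : H ⊗[k] H) : LinearMap.mul' k H
      ((antipode k).lTensor H ((antipode k).lTensor H (antipodeFst w))) =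
      antipode k (drinfeldElement w) := by
    induction w with
    | zero => simp
    | add v w hv hw => simp only [map_add, drinfeldElement_add, hv, hw]
    | tmul p q => simp [drinfeldElement_tmul, antipode_mul_antidistrib]
  have h3 := hR.antipode_map_antipode
  -- `R² S(R¹)` acts as `S(R¹ S(R²))`. Replacing `R` by `(S ⊗ S)(R)` turns `R¹ S(R²)` into `S(R¹)
  -- S²(R²) = S(u)`, so the action is that of `S²(u)`, hence of `u`.
  rw [h1]
  conv_lhs => rw [← h3]
  rw [h2, hS, hu]

end Dual

end Invariance

/-! ### Smash product relations

The relations of the smash product are derived in any algebra `B` with algebra maps `t : A → B`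
and `i : H → B` such that `i(h) t(a) = t(h₍₁₎ • a) i(h₍₂₎)`. -/

section Relations

open Coalgebra HopfAlgebra

variable {k H A B : Type*} [Field k] [Ring H] [HopfAlgebra k H] [Ring A] [Algebra k A]
  [Module H A] [IsScalarTower k H A] [Ring B] [Algebra k B]

/-- `p ⊗ q ⊗ r ↦ f(p) g(q) h(r)` -/
noncomputable def mulThree {C : Type*} [Ring C] [Algebra k C] (f g h : H →ₗ[k] C) :
    H ⊗[k] (H ⊗[k] H) →ₗ[k] C :=
  LinearMap.mul' k C ∘ₗ TensorProduct.map f (LinearMap.mul' k C ∘ₗ TensorProduct.map g h)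

@[simp] theorem mulThree_tmul {C : Type*} [Ring C] [Algebra k C] (f g h : H →ₗ[k] C) (p q r : H) :
    mulThree f g h (p ⊗ₜ (q ⊗ₜ r)) = f p * (g q * h r) := rfl

/-- `(p ⊗ q, a) ↦ f(q • a) i(p)` -/
noncomputable def placeLeft (f : A →ₗ[k] B) (i : H →ₐ[k] B) : H ⊗[k] H →ₗ[k] A →ₗ[k] B :=
  (actFst k H A ∘ₗ (TensorProduct.comm k H H).toLinearMap).compr₂
    (LinearMap.mul' k B ∘ₗ TensorProduct.map f i.toLinearMap)

/-- `(p ⊗ q, a) ↦ i(p) f(q • a)` -/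
noncomputable def placeRight (f : A →ₗ[k] B) (i : H →ₐ[k] B) : H ⊗[k] H →ₗ[k] A →ₗ[k] B :=
  (actFst k H A ∘ₗ (TensorProduct.comm k H H).toLinearMap).compr₂
    (LinearMap.mul' k B ∘ₗ TensorProduct.map i.toLinearMap f ∘ₗ
      (TensorProduct.comm k A H).toLinearMap)

@[simp] theorem placeLeft_tmul (f : A →ₗ[k] B) (i : H →ₐ[k] B) (p q : H) (a : A) :
    placeLeft f i (p ⊗ₜ q) a = f (q • a) * i p := rfl

@[simp] theorem placeRight_tmul (f : A →ₗ[k] B) (i : H →ₐ[k] B) (p q : H) (a : A) :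
    placeRight f i (p ⊗ₜ q) a = i p * f (q • a) := rfl

/-- The source map `a ↦ t(R² • a) i(R¹)`. -/
noncomputable def src (R : H ⊗[k] H) (i : H →ₐ[k] B) (t : A →ₐ[k] B) : A →ₗ[k] B :=
  placeLeft t.toLinearMap i R

/-- `i(h) t(a) = t(h₍₁₎ • a) i(h₍₂₎)` -/
def IsSmashPair (i : H →ₐ[k] B) (t : A →ₐ[k] B) : Prop :=
  ∀ (h : H) (a : A), i h * t a = placeLeft t.toLinearMap i (flipT (comul (R := k) h)) a

variable {R : H ⊗[k] H} {i : H →ₐ[k] B} {t : A →ₐ[k] B}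

/-- Nested placements compose by multiplication in `H ⊗ H`, which lets `R` cancel against `R̄`
inside `src`. -/
theorem placeLeft_mul (f : A →ₗ[k] B) (v w : H ⊗[k] H) (a : A) :
    placeLeft f i (v * w) a = placeLeft (placeLeft f i v) i w a := by
  induction w with
  | zero => simp
  | add w w' hw hw' => simp only [mul_add, map_add, LinearMap.add_apply, hw, hw']
  | tmul p q =>
    induction v with
    | zero => simp
    | add v v' hv hv' =>
      rw [placeLeft_tmul] at hv hv' ⊢
      simp only [add_mul, map_add, LinearMap.add_apply, hv, hv']
    | tmul p' q' => simp [mul_smul, mul_assoc]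

theorem placeLeft_one (f : A →ₗ[k] B) (a : A) : placeLeft f i 1 a = f a := by
  simp [Algebra.TensorProduct.one_def]

theorem src_one [ModuleAlgebra k H A] (hR : IsQuasitriangular R) : src R i t 1 = 1 := by
  have h (w : H ⊗[k] H) : placeLeft t.toLinearMap i w 1 = i (counitSnd w) := by
    induction w with
    | zero => simp
    | add v w hv hw => simp only [map_add, LinearMap.add_apply, hv, hw]
    | tmul p q => simp [ModuleAlgebra.smul_one (k := k)]
  rw [src, h, hR.counitSnd_eq, map_one]

section Pair

variable (hti : IsSmashPair i t)
include hti

/-- `s(a) t(b) = t(b) s(a)` -/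
theorem src_mul_comm (hR : IsQuasitriangular R) (hA : IsQuantumCommutative A R) (a b : A) :
    src R i t a * t b = t b * src R i t a := by
  -- Moving `t(b)` past `i(R¹)` splits `R¹`. The first hexagon identity turns the result into
  -- `t((R²·c)(R¹·b)) i(R'¹)` with `c = R'²·a`, and quantum commutativity contracts the product to
  -- `b c`.
  let F : H ⊗[k] (H ⊗[k] H) →ₗ[k] B :=
    mulThree (t.toLinearMap ∘ₗ (act k H A).flip a) (t.toLinearMap ∘ₗ (act k H A).flip b)
        i.toLinearMap ∘ₗ
      (TensorProduct.comm k (H ⊗[k] H) H).toLinearMap ∘ₗ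
      (TensorProduct.assoc k H H H).symm.toLinearMap
  have h1 (w : H ⊗[k] H) : F (TensorProduct.assoc k H H H (comul.rTensor H w)) =
      placeLeft t.toLinearMap i w a * t b := by
    induction w with
    | zero => simp
    | add v w hv hw => simp only [map_add, LinearMap.add_apply, add_mul, hv, hw]
    | tmul p r =>
      have h2 (z : H ⊗[k] H) : F (TensorProduct.assoc k H H H (z ⊗ₜ r)) =
          t (r • a) * placeLeft t.toLinearMap i (flipT z) b := by
        induction z with
        | zero => simp
        | add v w hv hw => simp only [map_add, TensorProduct.add_tmul, flipT_add,
            LinearMap.add_apply, mul_add, hv, hw]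
        | tmul p q => simp [F]
      rw [LinearMap.rTensor_tmul, h2, ← hti, placeLeft_tmul, mul_assoc]
      rfl
  have h3 (v w : H ⊗[k] H) : F (leg13 v * leg23 w) =
      placeLeft (t.toLinearMap ∘ₗ LinearMap.mul' k A ∘ₗ actBoth k H A (flipT v) ∘ₗ
        (TensorProduct.mk k A A).flip b) i w a := by
    induction w with
    | zero => simp
    | add w w' hw hw' =>
      simp only [leg23_add, mul_add, map_add, LinearMap.add_apply, hw, hw']
    | tmul p q =>
      induction v with
      | zero => simp
      | add v v' hv hv' =>
        rw [placeLeft_tmul] at hv hv' ⊢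
        simp only [leg13_add, add_mul, map_add, hv, hv', flipT_add, LinearMap.comp_apply,
          LinearMap.add_apply]
      | tmul p' q' => simp [F, mul_smul, mul_assoc]
  have h4 : t.toLinearMap ∘ₗ LinearMap.mul' k A ∘ₗ actBoth k H A (flipT R) ∘ₗ
        (TensorProduct.mk k A A).flip b = LinearMap.mulLeft k (t b) ∘ₗ t.toLinearMap := by
    ext c
    simp [← hA b c]
  have h5 (w : H ⊗[k] H) : placeLeft (LinearMap.mulLeft k (t b) ∘ₗ t.toLinearMap) i w a =
      t b * placeLeft t.toLinearMap i w a := by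
    induction w with
    | zero => simp
    | add v w hv hw => simp only [map_add, LinearMap.add_apply, mul_add, hv, hw]
    | tmul p q => simp [mul_assoc]
  rw [src, ← h1, hR.comul_rTensor, h3, h4, h5]

/-- `s(a b) = s(b) s(a)` -/
theorem src_mul [ModuleAlgebra k H A] (hR : IsQuasitriangular R) (hA : IsQuantumCommutative A R)
    (a b : A) : src R i t (a * b) = src R i t b * src R i t a := by
  -- Splitting `R²` over the product `a b`, the second hexagon identity gives `t(R'²·a) s(b)
  -- i(R'¹)`; commuting `s(b)` to the left leaves `s(b) s(a)`.
  let F : H ⊗[k] (H ⊗[k] H) →ₗ[k] B :=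
    mulThree (t.toLinearMap ∘ₗ (act k H A).flip a) (t.toLinearMap ∘ₗ (act k H A).flip b)
        i.toLinearMap ∘ₗ
      (TensorProduct.assoc k H H H).toLinearMap ∘ₗ
      (TensorProduct.comm k H (H ⊗[k] H)).toLinearMap
  have h1 (w : H ⊗[k] H) : F (comul.lTensor H w) = placeLeft t.toLinearMap i w (a * b) := by
    induction w with
    | zero => simp
    | add v w hv hw => simp only [map_add, LinearMap.add_apply, hv, hw]
    | tmul p r =>
      have h2 (z : H ⊗[k] H) : F (p ⊗ₜ z) =
          t (LinearMap.mul' k A (actBoth k H A z (a ⊗ₜ b))) * i p := by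
        induction z with
        | zero => simp
        | add v w hv hw => simp only [map_add, TensorProduct.tmul_add,
            LinearMap.add_apply, add_mul, hv, hw]
        | tmul p q => simp [F, mul_assoc]
      simp [h2, ModuleAlgebra.smul_mul (k := k)]
  have h3 (v : H ⊗[k] H) : F (leg13 R * leg12 v) =
      src R i t b * placeLeft t.toLinearMap i v a := by
    induction v with
    | zero => simp
    | add w w' hw hw' =>
      simp only [leg12_add, mul_add, map_add, LinearMap.add_apply, hw, hw']
    | tmul p q =>
      have h4 (w : H ⊗[k] H) : F (leg13 w * leg12 (p ⊗ₜ q)) =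
          t (q • a) * placeLeft t.toLinearMap i w b * i p := by
        induction w with
        | zero => simp
        | add v v' hv hv' =>
          simp only [leg13_add, add_mul, mul_add, map_add, hv, hv', LinearMap.add_apply]
        | tmul p' q' => simp [F, mul_assoc]
      rw [h4, ← src, ← src_mul_comm hti hR hA, placeLeft_tmul, mul_assoc]
      rfl
  rw [src, ← h1, hR.comul_lTensor, h3, src]

/-- `i(h) s(a) = s(h₍₂₎ • a) i(h₍₁₎)` -/
theorem mul_src (hR : IsQuasitriangular R) (h : H) (a : A) :
    i h * src R i t a = placeLeft (src R i t) i (comul h) a := by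
  have h1 (w : H ⊗[k] H) : i h * placeLeft t.toLinearMap i w a =
      placeLeft t.toLinearMap i (flipT (comul h) * w) a := by
    induction w with
    | zero => simp
    | add v w hv hw => simp only [map_add, LinearMap.add_apply, mul_add, hv, hw]
    | tmul p q =>
      rw [placeLeft_mul, placeLeft_tmul, placeLeft_tmul, ← hti, mul_assoc]
      rfl
  rw [src, h1, ← hR.mul_comul, placeLeft_mul]

/-- `s(a) i(h) = i(h₍₁₎) s(S(h₍₂₎) • a)` -/
theorem src_mul_apply (hR : IsQuasitriangular R) (h : H) (a : A) :
    src R i t a * i h =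
      placeRight (src R i t) i ((antipode k).lTensor H (comul h)) a := by
  let F : H ⊗[k] (H ⊗[k] H) →ₗ[k] B := (placeLeft (src R i t) i).flip a ∘ₗ
    (LinearMap.mul' k H ∘ₗ (antipode k).lTensor H).lTensor H
  have h1 (z : H ⊗[k] H) : F (comul.lTensor H z) = src R i t a * i (counitSnd z) := by
    induction z with
    | zero => simp
    | add v w hv hw => simp only [map_add, mul_add, hv, hw]
    | tmul p r => simp [F, Algebra.algebraMap_eq_smul_one]
  have h2 (z : H ⊗[k] H) : F (TensorProduct.assoc k H H H (comul.rTensor H z)) =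
      placeRight (src R i t) i ((antipode k).lTensor H z) a := by
    induction z with
    | zero => simp
    | add v w hv hw => simp only [map_add, LinearMap.add_apply, hv, hw]
    | tmul p r =>
      have h3 (w : H ⊗[k] H) : F (TensorProduct.assoc k H H H (w ⊗ₜ r)) =
          placeLeft (src R i t) i w (antipode k r • a) := by
        induction w with
        | zero => simp
        | add v w hv hw =>
          simp only [map_add, TensorProduct.add_tmul, LinearMap.add_apply, hv, hw]
        | tmul p q => simp [F, mul_smul]
      rw [LinearMap.rTensor_tmul, h3, ← mul_src hti hR, LinearMap.lTensor_tmul, placeRight_tmul]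
  rw [← h2, Coalgebra.coassoc_apply, h1, counitSnd_comul]

/-- `i(S(R¹)) s(R² • a) = t(a)` -/
theorem placeRight_src (hR : IsQuasitriangular R)
    (hRA : ∀ a : A, LinearMap.mul' k H (antipodeFst R) • a = a) (a : A) :
    placeRight (src R i t) i (antipodeFst R) a = t a := by
  let F : H ⊗[k] (H ⊗[k] H) →ₗ[k] B := (placeLeft (src R i t) i).flip a ∘ₗ
    (LinearMap.mul' k H).lTensor H
  have h1 (z : H ⊗[k] H) : F (TensorProduct.assoc k H H H (comul.rTensor H z)) =
      placeRight (src R i t) i z a := by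
    induction z with
    | zero => simp
    | add v w hv hw => simp only [map_add, LinearMap.add_apply, hv, hw]
    | tmul p r =>
      have h3 (w : H ⊗[k] H) : F (TensorProduct.assoc k H H H (w ⊗ₜ r)) =
          placeLeft (src R i t) i w (r • a) := by
        induction w with
        | zero => simp
        | add v w hv hw =>
          simp only [map_add, TensorProduct.add_tmul, LinearMap.add_apply, hv, hw]
        | tmul p q => simp [F, mul_smul]
      rw [LinearMap.rTensor_tmul, h3, ← mul_src hti hR, placeRight_tmul]
  have h2 (v w : H ⊗[k] H) : F (leg23 w * leg13 v) =
      placeLeft (src R i t ∘ₗ act k H A (LinearMap.mul' k H w)) i v a := by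
    induction v with
    | zero => simp
    | add v v' hv hv' => simp only [leg13_add, mul_add, map_add, LinearMap.add_apply, hv, hv']
    | tmul p q =>
      induction w with
      | zero => simp
      | add w w' hw hw' =>
        rw [placeLeft_tmul] at hw hw' ⊢
        simp only [leg23_add, add_mul, map_add, hw, hw', LinearMap.comp_apply,
          LinearMap.add_apply]
      | tmul p' q' => simp [F, mul_smul]
  have h3 : act k H A (LinearMap.mul' k H (antipodeFst R)) = LinearMap.id := by
    ext b
    exact hRA b
  -- Moving `i(R̄¹)` past `s` and using the hexagon identity for `R̄` leaves `s(R̄¹R̄²R̄'²·a)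
  -- i(R̄'¹)`. The product `R̄¹R̄² = S(R¹)R²` acts trivially, and the `R` inside `s` cancels `R̄'`.
  rw [← h1, hR.comul_rTensor_antipodeFst, h2, h3, LinearMap.comp_id, src, ← placeLeft_mul,
    hR.mul_antipodeFst, placeLeft_one]
  rfl

end Pair

end Relations

/-! ### The separability idempotent in the smash product -/

section SepElement

open Coalgebra HopfAlgebra

variable {k H A B : Type*} [Field k] [Ring H] [HopfAlgebra k H] [Ring A] [Algebra k A]
  [Module H A] [IsScalarTower k H A] [Ring B] [Algebra k B]

/-- `i(h) ⊗ i(g)` -/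
noncomputable def dblMap (i : H →ₐ[k] B) : H ⊗[k] H →ₐ[k] B ⊗[k] B :=
  Algebra.TensorProduct.map i i

@[simp] theorem dblMap_tmul (i : H →ₐ[k] B) (g h : H) :
    dblMap i (g ⊗ₜ h) = i g ⊗ₜ[k] i h := rfl

/-- `s(x¹) ⊗ t(x²)` -/
noncomputable def sepElement (R : H ⊗[k] H) (i : H →ₐ[k] B) (t : A →ₐ[k] B) (x : A ⊗[k] A) :
    B ⊗[k] B :=
  TensorProduct.map (src R i t) t.toLinearMap x

variable {R : H ⊗[k] H} {i : H →ₐ[k] B} {t : A →ₐ[k] B} {x : A ⊗[k] A}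

theorem flipT_dblMap (w : H ⊗[k] H) : flipT (dblMap i w) = dblMap i (flipT w) := by
  induction w with
  | zero => simp
  | add v w hv hw => simp only [map_add, flipT_add, hv, hw]
  | tmul p q => simp

section Pair

variable [ModuleAlgebra k H A] (hti : IsSmashPair i t) (hR : IsQuasitriangular R)
  (hA : IsQuantumCommutative A R)
include hti hR hA

theorem sepElement_mul_fst (a : A) :
    sepElement R i t x * (t a ⊗ₜ 1) = (t a ⊗ₜ 1) * sepElement R i t x := by
  unfold sepElement
  induction x with
  | zero => simp
  | add v w hv hw => simp only [map_add, add_mul, mul_add, hv, hw]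
  | tmul p q => simp [src_mul_comm hti hR hA]

section Separability

variable (hx : IsSymmetricSeparabilityIdempotent x)
include hx

/-- Centrality of `x`, read through `s(x¹) s(a) = s(a x¹)`. -/
theorem sepElement_mul_right (a : A) :
    sepElement R i t x * (1 ⊗ₜ t a) = sepElement R i t x * (src R i t a ⊗ₜ 1) := by
  have h1 (y : A ⊗[k] A) : sepElement R i t y * (1 ⊗ₜ t a) = sepElement R i t (y * (1 ⊗ₜ a)) := by
    unfold sepElement
    induction y with
    | zero => simp
    | add v w hv hw => simp only [map_add, add_mul, hv, hw]
    | tmul p q => simp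
  have h2 (y : A ⊗[k] A) :
      sepElement R i t y * (src R i t a ⊗ₜ 1) = sepElement R i t ((a ⊗ₜ 1) * y) := by
    unfold sepElement
    induction y with
    | zero => simp
    | add v w hv hw => simp only [map_add, add_mul, mul_add, hv, hw]
    | tmul p q => simp [src_mul hti hR hA]
  rw [h1, h2, hx.central]

theorem sepElement_mul_left (a : A) :
    (1 ⊗ₜ t a) * sepElement R i t x = (src R i t a ⊗ₜ 1) * sepElement R i t x := by
  have h1 (y : A ⊗[k] A) : (1 ⊗ₜ t a) * sepElement R i t y = sepElement R i t ((1 ⊗ₜ a) * y) := by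
    unfold sepElement
    induction y with
    | zero => simp
    | add v w hv hw => simp only [map_add, mul_add, hv, hw]
    | tmul p q => simp
  have h2 (y : A ⊗[k] A) :
      (src R i t a ⊗ₜ 1) * sepElement R i t y = sepElement R i t (y * (a ⊗ₜ 1)) := by
    unfold sepElement
    induction y with
    | zero => simp
    | add v w hv hw => simp only [map_add, add_mul, mul_add, hv, hw]
    | tmul p q => simp [src_mul hti hR hA]
  rw [h1, h2, hx.central']

/-- By `sepElement_mul_right`, multiplying `e` by `s(x¹) ⊗ t(x²)` is multiplying it by `1 ⊗ t(x¹ x²)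
= 1`. -/
theorem sepElement_mul_sepElement :
    sepElement R i t x * sepElement R i t x = sepElement R i t x := by
  have h1 (y : A ⊗[k] A) : sepElement R i t x * sepElement R i t y =
      sepElement R i t x * (1 ⊗ₜ t (LinearMap.mul' k A y)) := by
    conv_lhs => rw [sepElement.eq_def R i t y]
    induction y with
    | zero => simp
    | add v w hv hw => simp only [map_add, mul_add, TensorProduct.tmul_add, hv, hw]
    | tmul p q =>
      rw [TensorProduct.map_tmul, ← one_mul (t.toLinearMap q), ← mul_one (src R i t p),
        ← Algebra.TensorProduct.tmul_mul_tmul, ← mul_assoc,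
        ← sepElement_mul_right hti hR hA hx, mul_assoc]
      simp
  rw [h1, hx.mul_eq_one, map_one, ← Algebra.TensorProduct.one_def, mul_one]

theorem flipT_sepElement_mul_left (a : A) :
    flipT (sepElement R i t x) * (t a ⊗ₜ 1) =
      flipT (sepElement R i t x) * (1 ⊗ₜ src R i t a) := by
  have h := congrArg flipT (sepElement_mul_right hti hR hA hx a)
  rwa [flipT_mul, flipT_mul] at h

end Separability

/-- Both sides equal `i(h₍₁₎) s(x¹) ⊗ t(h₍₂₎·x²) i(h₍₃₎)`: one by the smash relation in the second
leg, the other by transferring `h₍₂₎` to `S(h₍₂₎)·x¹` and applying `src_mul_apply`. -/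
theorem sepElement_comm
    (hinv : ∀ h : H, actBoth k H A (antipode k h ⊗ₜ 1) x = actBoth k H A (1 ⊗ₜ h) x) (h : H) :
    dblMap i (comul h) * sepElement R i t x = sepElement R i t x * dblMap i (comul h) := by
  let M := TensorProduct.map (src R i t) t.toLinearMap
  let F : H ⊗[k] (H ⊗[k] H) →ₗ[k] B ⊗[k] B :=
    mulThree ((TensorProduct.mk k B B).flip 1 ∘ₗ i.toLinearMap)
      (M ∘ₗ (actBoth k H A).flip x ∘ₗ TensorProduct.mk k H H 1)
      (TensorProduct.mk k B B 1 ∘ₗ i.toLinearMap)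
  have hF (p q r : H) : F (p ⊗ₜ (q ⊗ₜ r)) =
      (i p ⊗ₜ 1) * (M (actBoth k H A (1 ⊗ₜ q) x) * (1 ⊗ₜ i r)) := rfl
  have h1 (z : H ⊗[k] H) : F (comul.lTensor H z) = dblMap i z * sepElement R i t x := by
    induction z with
    | zero => simp
    | add v w hv hw => simp only [map_add, add_mul, hv, hw]
    | tmul p r =>
      have h2 (z : H ⊗[k] H) : F (p ⊗ₜ z) = (i p ⊗ₜ 1) *
          TensorProduct.map (src R i t) (placeLeft t.toLinearMap i (flipT z)) x := by
        induction z with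
        | zero => simp
        | add v w hv hw => simp only [map_add, TensorProduct.tmul_add, mul_add, hv, hw, flipT_add,
            TensorProduct.map_add_right, LinearMap.add_apply]
        | tmul q r =>
          rw [hF]
          congr 1
          generalize x = y
          induction y with
          | zero => simp
          | add v w hv hw => simp only [map_add, add_mul, hv, hw]
          | tmul a b => simp [M]
      have h3 (y : A ⊗[k] A) : TensorProduct.map (src R i t)
          (placeLeft t.toLinearMap i (flipT (comul r))) y = (1 ⊗ₜ i r) * M y := by
        induction y with
        | zero => simp
        | add v w hv hw => simp only [map_add, mul_add, hv, hw]
        | tmul a b => simp [M, hti r b]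
      rw [LinearMap.lTensor_tmul, h2, h3, ← mul_assoc]
      simp [M, sepElement]
  have h4 (z : H ⊗[k] H) : F (TensorProduct.assoc k H H H (comul.rTensor H z)) =
      sepElement R i t x * dblMap i z := by
    induction z with
    | zero => simp
    | add v w hv hw => simp only [map_add, mul_add, hv, hw]
    | tmul p r =>
      have h2 (z : H ⊗[k] H) : F (TensorProduct.assoc k H H H (z ⊗ₜ r)) =
          TensorProduct.map (placeRight (src R i t) i ((antipode k).lTensor H z))
            t.toLinearMap x * (1 ⊗ₜ i r) := by
        induction z with
        | zero => simp
        | add v w hv hw => simp only [map_add, TensorProduct.add_tmul, add_mul, hv, hw,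
            TensorProduct.map_add_left, LinearMap.add_apply]
        | tmul p q =>
          rw [TensorProduct.assoc_tmul, hF, ← hinv, ← mul_assoc]
          congr 1
          generalize x = y
          induction y with
          | zero => simp
          | add v w hv hw => simp only [map_add, mul_add, hv, hw]
          | tmul a b => simp [M]
      have h3 (y : A ⊗[k] A) : TensorProduct.map
          (placeRight (src R i t) i ((antipode k).lTensor H (comul p))) t.toLinearMap y =
            M y * (i p ⊗ₜ 1) := by
        induction y with
        | zero => simp
        | add v w hv hw => simp only [map_add, add_mul, hv, hw]
        | tmul a b => simp [M, src_mul_apply hti hR]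
      rw [LinearMap.rTensor_tmul, h2, h3, mul_assoc]
      simp [M, sepElement]
  have h5 := h4 (comul h)
  rw [Coalgebra.coassoc_apply, h1] at h5
  exact h5

end Pair

end SepElement

/-! ### Modules in the Müger center -/

section Mueger

open Coalgebra HopfAlgebra

variable {k H A : Type*} [Field k] [Ring H] [HopfAlgebra k H] [Ring A] [Algebra k A]
  [Module H A] [IsScalarTower k H A]

variable (k H A) in
/-- The action `(p ⊗ q) (a ⊗ h) = p • a ⊗ q h` of `H ⊗ H` on `A ⊗ H`. -/
noncomputable def actMul : H ⊗[k] H →ₐ[k] Module.End k (A ⊗[k] H) :=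
  Module.endTensorEndAlgHom.comp
    (Algebra.TensorProduct.map (Algebra.lsmul k k A : H →ₐ[k] Module.End k A) (Algebra.lmul k H))

@[simp] theorem actMul_tmul (p q h : H) (a : A) :
    actMul k H A (p ⊗ₜ q) (a ⊗ₜ h) = (p • a) ⊗ₜ[k] (q * h) := rfl

theorem actMul_apply (w : H ⊗[k] H) (a : A) (h : H) :
    actMul k H A w (a ⊗ₜ h) = actFst k H A w a * (1 ⊗ₜ h) := by
  induction w with
  | zero => simp
  | add v w hv hw => simp only [map_add, LinearMap.add_apply, add_mul, hv, hw]
  | tmul p q => simp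

theorem actMul_apply_one (w : H ⊗[k] H) (a : A) :
    actMul k H A w (a ⊗ₜ 1) = actFst k H A w a := by
  rw [actMul_apply, ← Algebra.TensorProduct.one_def, mul_one]

variable {R : H ⊗[k] H} (hR : IsQuasitriangular R) (hM : IsInMuegerCenter A R)
include hR hM

theorem IsInMuegerCenter.actMul_flipT_mul : actMul k H A (flipT R) * actMul k H A R = 1 := by
  rw [← map_mul]
  refine TensorProduct.ext' fun a h => ?_
  rw [actMul_apply, hM a]
  simp

/-- In `End(A ⊗ H)` the condition says that `R²¹ R` acts as the identity. So `R` acts as the inverse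
of `R²¹` and, in the next lemma, `R²¹` as `R̄`. -/
theorem IsInMuegerCenter.actFst_eq (a : A) :
    actFst k H A R a = actFst k H A (flipT (antipodeFst R)) a := by
  have h : actMul k H A R = actMul k H A (flipT (antipodeFst R)) := by
    refine (left_inv_eq_right_inv ?_ (IsInMuegerCenter.actMul_flipT_mul hR hM)).symm
    rw [← map_mul, ← flipT_mul, hR.antipodeFst_mul, flipT_one, map_one]
  rw [← actMul_apply_one, h, actMul_apply_one]

theorem IsInMuegerCenter.actFst_flipT_eq (a : A) :
    actFst k H A (flipT R) a = actFst k H A (antipodeFst R) a := by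
  have h : actMul k H A (flipT R) = actMul k H A (antipodeFst R) := by
    refine left_inv_eq_right_inv (IsInMuegerCenter.actMul_flipT_mul hR hM) ?_
    rw [← map_mul, hR.mul_antipodeFst, map_one]
  rw [← actMul_apply_one, h, actMul_apply_one]

end Mueger

/-! ### Commutation of the R-matrix with the separability idempotent -/

section Braiding

open Coalgebra HopfAlgebra

variable {k H A B : Type*} [Field k] [Ring H] [HopfAlgebra k H] [Ring A] [Algebra k A]
  [Module H A] [IsScalarTower k H A] [Ring B] [Algebra k B]

variable {R : H ⊗[k] H} {i : H →ₐ[k] B} {t : A →ₐ[k] B} {x : A ⊗[k] A}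

theorem dblMap_antipodeFst_mul (hR : IsQuasitriangular R) :
    dblMap i (antipodeFst R) * dblMap i R = 1 := by
  rw [← map_mul, hR.antipodeFst_mul, map_one]

theorem dblMap_mul_antipodeFst (hR : IsQuasitriangular R) :
    dblMap i R * dblMap i (antipodeFst R) = 1 := by
  rw [← map_mul, hR.mul_antipodeFst, map_one]

section Conj

variable (hti : IsSmashPair i t) (hR : IsQuasitriangular R)
include hti hR

/-- `s(a) = i(R̄²) t(R̄¹ • a)`, for `R̄` the inverse of `R` -/
theorem placeRight_flipT (hM : IsInMuegerCenter A R)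
    (hRA : ∀ a : A, LinearMap.mul' k H (flipT (antipodeFst R)) • a = a) (a : A) :
    placeRight t.toLinearMap i (flipT (antipodeFst R)) a = src R i t a := by
  let F : H ⊗[k] (H ⊗[k] H) →ₗ[k] B := (placeLeft t.toLinearMap i).flip a ∘ₗ
    (TensorProduct.comm k H H).toLinearMap ∘ₗ
    (LinearMap.mul' k H ∘ₗ (TensorProduct.comm k H H).toLinearMap).rTensor H ∘ₗ
    (TensorProduct.assoc k H H H).symm.toLinearMap
  have h1 (z : H ⊗[k] H) : F (comul.lTensor H z) =
      placeRight t.toLinearMap i (flipT z) a := by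
    induction z with
    | zero => simp
    | add v w hv hw => simp only [map_add, flipT_add, LinearMap.add_apply, hv, hw]
    | tmul p r =>
      have h3 (w : H ⊗[k] H) : F (p ⊗ₜ w) =
          placeLeft t.toLinearMap i (flipT w) (p • a) := by
        induction w with
        | zero => simp
        | add v w hv hw =>
          simp only [map_add, TensorProduct.tmul_add, flipT_add, LinearMap.add_apply, hv, hw]
        | tmul p q => simp [F, mul_smul]
      rw [LinearMap.lTensor_tmul, h3, ← hti, flipT_tmul, placeRight_tmul]
      rfl
  have h2 (v w : H ⊗[k] H) : F (leg12 w * leg13 v) =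
      placeLeft (t.toLinearMap ∘ₗ act k H A (LinearMap.mul' k H (flipT w))) i (flipT v) a := by
    induction v with
    | zero => simp
    | add v v' hv hv' =>
      simp only [leg13_add, mul_add, map_add, flipT_add, LinearMap.add_apply, hv, hv']
    | tmul p q =>
      induction w with
      | zero => simp
      | add w w' hw hw' =>
        rw [flipT_tmul, placeLeft_tmul] at hw hw' ⊢
        simp only [leg12_add, add_mul, map_add, flipT_add, hw, hw', LinearMap.comp_apply,
          LinearMap.add_apply]
      | tmul p' q' => simp [F, mul_smul]
  have h3 : act k H A (LinearMap.mul' k H (flipT (antipodeFst R))) = LinearMap.id := by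
    ext b
    exact hRA b
  have h4 (w : H ⊗[k] H) : placeLeft t.toLinearMap i w a =
      LinearMap.mul' k B (TensorProduct.map t.toLinearMap i.toLinearMap
        (actFst k H A (flipT w) a)) := rfl
  -- The smash relation and the hexagon identity for `R̄` give `t(R̄²R̄¹R̄'¹·a) i(R̄'²)`, where
  -- `R̄²R̄¹ = R²S(R¹)` acts trivially. The Müger condition identifies `t(R̄'¹·a) i(R̄'²)` with
  -- `s(a)`.
  rw [← h1, hR.comul_lTensor_antipodeFst, h2, h3, LinearMap.comp_id, src, h4, h4, flipT_flipT,
    IsInMuegerCenter.actFst_flipT_eq hR hM]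

/-- The smash relation splits a leg of `R`, and a hexagon identity turns the split leg into a second
copy of `R`. The next two lemmas do this with `R̄`. -/
theorem dblMap_mul_fst (a : A) : dblMap i R * (t a ⊗ₜ 1) =
    TensorProduct.map t.toLinearMap i.toLinearMap (actFst k H A R a) * dblMap i R := by
  let F : H ⊗[k] (H ⊗[k] H) →ₗ[k] B ⊗[k] B :=
    mulThree ((TensorProduct.mk k B B).flip 1 ∘ₗ t.toLinearMap ∘ₗ (act k H A).flip a)
      ((TensorProduct.mk k B B).flip 1 ∘ₗ i.toLinearMap)
      (TensorProduct.mk k B B 1 ∘ₗ i.toLinearMap)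
  have h1 (w : H ⊗[k] H) : F (TensorProduct.assoc k H H H (comul.rTensor H w)) =
      dblMap i w * (t a ⊗ₜ 1) := by
    induction w with
    | zero => simp
    | add v w hv hw => simp only [map_add, add_mul, hv, hw]
    | tmul p r =>
      have h2 (z : H ⊗[k] H) : F (TensorProduct.assoc k H H H (z ⊗ₜ r)) =
          placeLeft t.toLinearMap i (flipT z) a ⊗ₜ i r := by
        induction z with
        | zero => simp
        | add v w hv hw => simp only [map_add, TensorProduct.add_tmul, flipT_add,
            LinearMap.add_apply, hv, hw]
        | tmul p q => simp [F]
      rw [LinearMap.rTensor_tmul, h2, ← hti]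
      simp
  have h2 (v w : H ⊗[k] H) : F (leg13 v * leg23 w) =
      TensorProduct.map t.toLinearMap i.toLinearMap (actFst k H A v a) * dblMap i w := by
    induction v with
    | zero => simp
    | add v v' hv hv' => simp only [leg13_add, add_mul, map_add, LinearMap.add_apply, hv, hv']
    | tmul p q =>
      induction w with
      | zero => simp
      | add w w' hw hw' => simp only [leg23_add, mul_add, map_add, hw, hw']
      | tmul p' q' => simp [F]
  rw [← h1, hR.comul_rTensor, h2]

theorem snd_mul_dblMap (a : A) : (1 ⊗ₜ t a) * dblMap i R = dblMap i R *
    TensorProduct.map i.toLinearMap (t.toLinearMap ∘ₗ (act k H A).flip a) (antipodeFst R) := by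
  let F : H ⊗[k] (H ⊗[k] H) →ₗ[k] B ⊗[k] B :=
    mulThree ((TensorProduct.mk k B B).flip 1 ∘ₗ i.toLinearMap)
      (TensorProduct.mk k B B 1 ∘ₗ t.toLinearMap ∘ₗ (act k H A).flip a)
      (TensorProduct.mk k B B 1 ∘ₗ i.toLinearMap)
  have h1 (w : H ⊗[k] H) : F (comul.lTensor H w) = dblMap i w * (1 ⊗ₜ t a) := by
    induction w with
    | zero => simp
    | add v w hv hw => simp only [map_add, add_mul, hv, hw]
    | tmul p r =>
      have h2 (z : H ⊗[k] H) : F (p ⊗ₜ z) =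
          i p ⊗ₜ placeLeft t.toLinearMap i (flipT z) a := by
        induction z with
        | zero => simp
        | add v w hv hw => simp only [map_add, TensorProduct.tmul_add, flipT_add,
            LinearMap.add_apply, hv, hw]
        | tmul p q => simp [F]
      rw [LinearMap.lTensor_tmul, h2, ← hti]
      simp
  have h2 (v w : H ⊗[k] H) : F (leg12 v * leg13 w) =
      TensorProduct.map i.toLinearMap (t.toLinearMap ∘ₗ (act k H A).flip a) v * dblMap i w := by
    induction v with
    | zero => simp
    | add v v' hv hv' => simp only [leg12_add, add_mul, map_add, hv, hv']
    | tmul p q =>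
      induction w with
      | zero => simp
      | add w w' hw hw' => simp only [leg13_add, mul_add, map_add, hw, hw']
      | tmul p' q' => simp [F]
  have h3 := h1 (antipodeFst R)
  rw [hR.comul_lTensor_antipodeFst, h2] at h3
  -- Conjugating by `R` turns the relation for `R̄` into one for `R`.
  calc (1 ⊗ₜ t a) * dblMap i R
      = dblMap i R * (dblMap i (antipodeFst R) * (1 ⊗ₜ t a)) * dblMap i R := by
        rw [← mul_assoc, dblMap_mul_antipodeFst hR, one_mul]
    _ = _ := by rw [← h3, mul_assoc, mul_assoc, dblMap_antipodeFst_mul hR, mul_one]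

theorem fst_mul_dblMap (a : A) : (src R i t a ⊗ₜ 1) * dblMap i R = dblMap i R *
    TensorProduct.map (src R i t) i.toLinearMap (actFst k H A (antipodeFst R) a) := by
  let F : H ⊗[k] (H ⊗[k] H) →ₗ[k] B ⊗[k] B :=
    mulThree ((TensorProduct.mk k B B).flip 1 ∘ₗ src R i t ∘ₗ (act k H A).flip a)
      ((TensorProduct.mk k B B).flip 1 ∘ₗ i.toLinearMap)
      (TensorProduct.mk k B B 1 ∘ₗ i.toLinearMap) ∘ₗ
    (TensorProduct.leftComm k H H H).toLinearMap
  have h1 (w : H ⊗[k] H) : F (TensorProduct.assoc k H H H (comul.rTensor H w)) =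
      dblMap i w * (src R i t a ⊗ₜ 1) := by
    induction w with
    | zero => simp
    | add v w hv hw => simp only [map_add, add_mul, hv, hw]
    | tmul p r =>
      have h2 (z : H ⊗[k] H) : F (TensorProduct.assoc k H H H (z ⊗ₜ r)) =
          placeLeft (src R i t) i z a ⊗ₜ i r := by
        induction z with
        | zero => simp
        | add v w hv hw => simp only [map_add, TensorProduct.add_tmul,
            LinearMap.add_apply, hv, hw]
        | tmul p q => simp [F]
      rw [LinearMap.rTensor_tmul, h2, ← mul_src hti hR]
      simp
  have h2 (v w : H ⊗[k] H) : F (leg23 v * leg13 w) =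
      TensorProduct.map (src R i t) i.toLinearMap (actFst k H A v a) * dblMap i w := by
    induction v with
    | zero => simp
    | add v v' hv hv' => simp only [leg23_add, add_mul, map_add, LinearMap.add_apply, hv, hv']
    | tmul p q =>
      induction w with
      | zero => simp
      | add w w' hw hw' => simp only [leg13_add, mul_add, map_add, hw, hw']
      | tmul p' q' => simp [F]
  have h3 := h1 (antipodeFst R)
  rw [hR.comul_rTensor_antipodeFst, h2] at h3
  calc (src R i t a ⊗ₜ 1) * dblMap i R
      = dblMap i R * (dblMap i (antipodeFst R) * (src R i t a ⊗ₜ 1)) * dblMap i R := by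
        rw [← mul_assoc, dblMap_mul_antipodeFst hR, one_mul]
    _ = _ := by rw [← h3, mul_assoc, mul_assoc, dblMap_antipodeFst_mul hR, mul_one]

variable [ModuleAlgebra k H A] (hA : IsQuantumCommutative A R)
  (hx : IsSymmetricSeparabilityIdempotent x)
include hA hx

/-- `t(a)` in the second leg of `s(x¹) ⊗ t(x²)` passes through the R-matrix to the first leg. -/
theorem snd_mul_dblMap_mul_sepElement
    (hRA : ∀ a : A, LinearMap.mul' k H (antipodeFst R) • a = a) (a : A) :
    (1 ⊗ₜ t a) * (dblMap i R * sepElement R i t x) =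
      dblMap i R * ((t a ⊗ₜ 1) * sepElement R i t x) := by
  -- Next to `e` the factor `1 ⊗ t(R̄²·a)` may be written `s(R̄²·a) ⊗ 1`, so the correction term
  -- becomes `i(R̄¹) s(R̄²·a) ⊗ 1`, which is `t(a) ⊗ 1`.
  have h (w : H ⊗[k] H) :
      TensorProduct.map i.toLinearMap (t.toLinearMap ∘ₗ (act k H A).flip a) w *
        sepElement R i t x = (placeRight (src R i t) i w a ⊗ₜ 1) * sepElement R i t x := by
    induction w with
    | zero => simp
    | add v w hv hw =>
      simp only [map_add, LinearMap.add_apply, TensorProduct.add_tmul, add_mul, hv, hw]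
    | tmul p q =>
      have : i p ⊗ₜ[k] t (q • a) = (i p ⊗ₜ 1) * (1 ⊗ₜ t (q • a)) := by simp
      rw [TensorProduct.map_tmul]
      change i p ⊗ₜ[k] t (q • a) * _ = _
      rw [this, mul_assoc, sepElement_mul_left hti hR hA hx, ← mul_assoc]
      simp
  rw [← mul_assoc, snd_mul_dblMap hti hR, mul_assoc, h, placeRight_src hti hR hRA]

/-- Under the Müger condition, `s(a)` in the first leg passes through the R-matrix to the second
leg. -/
theorem fst_mul_dblMap_mul_sepElement (hM : IsInMuegerCenter A R)
    (hRA' : ∀ a : A, LinearMap.mul' k H (flipT (antipodeFst R)) • a = a) (a : A) :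
    (src R i t a ⊗ₜ 1) * (dblMap i R * sepElement R i t x) =
      dblMap i R * ((1 ⊗ₜ src R i t a) * sepElement R i t x) := by
  have h (w : H ⊗[k] H) :
      TensorProduct.map (src R i t) i.toLinearMap (actFst k H A w a) *
        sepElement R i t x =
      (1 ⊗ₜ placeRight t.toLinearMap i (flipT w) a) * sepElement R i t x := by
    induction w with
    | zero => simp
    | add v w hv hw =>
      simp only [map_add, LinearMap.add_apply, flipT_add, TensorProduct.tmul_add, add_mul, hv, hw]
    | tmul p q =>
      have : src R i t (p • a) ⊗ₜ[k] i q = (1 ⊗ₜ i q) * (src R i t (p • a) ⊗ₜ 1) := by simp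
      rw [actFst_tmul, TensorProduct.map_tmul, AlgHom.toLinearMap_apply, this, mul_assoc,
        ← sepElement_mul_left hti hR hA hx, ← mul_assoc]
      simp
  rw [← mul_assoc, fst_mul_dblMap hti hR, mul_assoc, h, placeRight_flipT hti hR hM hRA']

/-- Moving `t(a)` across `R` produces `t(R¹·a) ⊗ i(R²)`, which the Müger condition rewrites as
`t(R̄²·a) ⊗ i(R̄¹)`. Behind `e²¹` this is `1 ⊗ s(R̄²·a) i(R̄¹) = 1 ⊗ t(a)`. -/
theorem flipT_sepElement_mul_dblMap_mul (hM : IsInMuegerCenter A R) (a : A) :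
    flipT (sepElement R i t x) * (dblMap i R * (t a ⊗ₜ 1)) =
      flipT (sepElement R i t x) * ((1 ⊗ₜ t a) * dblMap i R) := by
  have h (w : H ⊗[k] H) : flipT (sepElement R i t x) *
      TensorProduct.map t.toLinearMap i.toLinearMap (actFst k H A (flipT w) a) =
      flipT (sepElement R i t x) * (1 ⊗ₜ placeLeft (src R i t) i w a) := by
    induction w with
    | zero => simp
    | add v w hv hw =>
      simp only [map_add, LinearMap.add_apply, flipT_add, TensorProduct.tmul_add, mul_add, hv, hw]
    | tmul p q =>
      have : t (q • a) ⊗ₜ[k] i p = (t (q • a) ⊗ₜ 1) * (1 ⊗ₜ i p) := by simp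
      rw [flipT_tmul, actFst_tmul, TensorProduct.map_tmul, AlgHom.toLinearMap_apply,
        AlgHom.toLinearMap_apply, this, ← mul_assoc,
        flipT_sepElement_mul_left hti hR hA hx, mul_assoc]
      simp
  rw [dblMap_mul_fst hti hR, IsInMuegerCenter.actFst_eq hR hM, ← mul_assoc, h, src,
    ← placeLeft_mul, hR.mul_antipodeFst, placeLeft_one, mul_assoc]
  rfl

/-- The second hexagon identity writes `R (1 ⊗ t(a))` as `(1 ⊗ t(R'²·a)) R (i(R'¹) ⊗ 1)`. Behind
`e²¹` the previous lemma moves `t(R'²·a)` to the right of `R` in the first leg, where it forms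
`s(a)` with `i(R'¹)`. -/
theorem flipT_sepElement_mul_dblMap_mul_src (hM : IsInMuegerCenter A R) (a : A) :
    flipT (sepElement R i t x) * (dblMap i R * (src R i t a ⊗ₜ 1)) =
      flipT (sepElement R i t x) * (dblMap i R * (1 ⊗ₜ t a)) := by
  let F : H ⊗[k] (H ⊗[k] H) →ₗ[k] B ⊗[k] B :=
    mulThree ((TensorProduct.mk k B B).flip 1 ∘ₗ i.toLinearMap)
      (TensorProduct.mk k B B 1 ∘ₗ t.toLinearMap ∘ₗ (act k H A).flip a)
      (TensorProduct.mk k B B 1 ∘ₗ i.toLinearMap)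
  have h1 (w : H ⊗[k] H) : F (comul.lTensor H w) = dblMap i w * (1 ⊗ₜ t a) := by
    induction w with
    | zero => simp
    | add v w hv hw => simp only [map_add, add_mul, hv, hw]
    | tmul p r =>
      have h2 (z : H ⊗[k] H) : F (p ⊗ₜ z) =
          i p ⊗ₜ placeLeft t.toLinearMap i (flipT z) a := by
        induction z with
        | zero => simp
        | add v w hv hw => simp only [map_add, TensorProduct.tmul_add, flipT_add,
            LinearMap.add_apply, hv, hw]
        | tmul p q => simp [F]
      rw [LinearMap.lTensor_tmul, h2, ← hti]
      simp
  have h2 (v : H ⊗[k] H) : flipT (sepElement R i t x) * F (leg13 R * leg12 v) =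
      flipT (sepElement R i t x) *
        (dblMap i R * (placeLeft t.toLinearMap i v a ⊗ₜ 1)) := by
    induction v with
    | zero => simp
    | add v v' hv hv' =>
      simp only [leg12_add, mul_add, map_add, LinearMap.add_apply, TensorProduct.add_tmul, hv, hv']
    | tmul p q =>
      have h3 (w : H ⊗[k] H) : F (leg13 w * leg12 (p ⊗ₜ q)) =
          (1 ⊗ₜ t (q • a)) * dblMap i w * (i p ⊗ₜ 1) := by
        induction w with
        | zero => simp
        | add w w' hw hw' => simp only [leg13_add, add_mul, mul_add, map_add, hw, hw']
        | tmul p' q' => simp [F]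
      have h4 : placeLeft t.toLinearMap i (p ⊗ₜ q) a ⊗ₜ[k] (1 : B) =
          (t (q • a) ⊗ₜ 1) * (i p ⊗ₜ 1) := by simp
      rw [h3, h4, ← mul_assoc, ← flipT_sepElement_mul_dblMap_mul hti hR hA hx hM]
      simp only [mul_assoc]
  rw [← h1, hR.comul_lTensor, h2, src]

/-- Under the Müger condition, `s(a)` in the second leg acts on the R-matrix as `t(a)` in the
first leg. -/
theorem src_snd_mul_dblMap_mul_sepElement (hM : IsInMuegerCenter A R)
    (hS : ∀ (h : H) (a : A), antipode k (antipode k h) • a = h • a)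
    (hRA : ∀ a : A, LinearMap.mul' k H (antipodeFst R) • a = a)
    (hRA' : ∀ a : A, LinearMap.mul' k H (flipT (antipodeFst R)) • a = a) (a : A) :
    (1 ⊗ₜ src R i t a) * (dblMap i R * sepElement R i t x) =
      (t a ⊗ₜ 1) * (dblMap i R * sepElement R i t x) := by
  have h1 (v : H ⊗[k] H) :
      (1 ⊗ₜ placeRight t.toLinearMap i (flipT (antipodeFst v)) a) *
        (dblMap i R * sepElement R i t x) =
      TensorProduct.map t.toLinearMap i.toLinearMap
        (actFst k H A (antipodeFst (v * antipodeFst R)) a) *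
          (dblMap i R * sepElement R i t x) := by
    induction v with
    | zero => simp
    | add v v' hv hv' =>
      simp only [map_add, flipT_add, LinearMap.add_apply, TensorProduct.tmul_add, add_mul, hv, hv']
    | tmul p q =>
      -- Writing `s(a) = i(R̄²) t(R̄¹·a)` and passing `t` through `R` yields `t(R¹R̄¹·a) ⊗
      -- i(R̄²R²)`, with the legs multiplied in opposite orders. Since `S²` acts trivially, this is
      -- the placement of `(S ⊗ id)(R R̄) = 1`.
      have h2 (w : H ⊗[k] H) : (1 ⊗ₜ i q) * TensorProduct.map t.toLinearMap i.toLinearMap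
          (actFst k H A w (antipode k p • a)) =
          TensorProduct.map t.toLinearMap i.toLinearMap
            (actFst k H A (antipodeFst ((p ⊗ₜ q) * antipodeFst w)) a) := by
        induction w with
        | zero => simp
        | add v w hv hw => simp only [map_add, mul_add, LinearMap.add_apply, hv, hw]
        | tmul p' q' => simp [antipode_mul_antidistrib, mul_smul, hS]
      have h3 : (1 : B) ⊗ₜ[k] placeRight t.toLinearMap i (flipT (antipodeFst (p ⊗ₜ q))) a =
          (1 ⊗ₜ i q) * (1 ⊗ₜ t (antipode k p • a)) := by simp
      rw [← h2, h3, mul_assoc, snd_mul_dblMap_mul_sepElement hti hR hA hx hRA,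
        ← mul_assoc (dblMap i R), dblMap_mul_fst hti hR, mul_assoc, mul_assoc]
  have h2 := h1 R
  rw [placeRight_flipT hti hR hM hRA', hR.mul_antipodeFst, Algebra.TensorProduct.one_def,
    antipodeFst_tmul, antipode_one, actFst_tmul, one_smul] at h2
  simpa using h2

/-- Evaluate `e²¹ R e` twice: absorbing the right `e` into `e²¹ R` leaves the factor `1 ⊗ t(x¹x²) =
1`, and absorbing the left `e²¹` into `R e` leaves `t(x²x¹) ⊗ 1 = 1`. -/
theorem flipT_sepElement_mul_dblMap (hM : IsInMuegerCenter A R)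
    (hS : ∀ (h : H) (a : A), antipode k (antipode k h) • a = h • a)
    (hRA : ∀ a : A, LinearMap.mul' k H (antipodeFst R) • a = a)
    (hRA' : ∀ a : A, LinearMap.mul' k H (flipT (antipodeFst R)) • a = a) :
    flipT (sepElement R i t x) * dblMap i R = dblMap i R * sepElement R i t x := by
  have h1 (y : A ⊗[k] A) :
      flipT (sepElement R i t x) * (dblMap i R * sepElement R i t y) =
      flipT (sepElement R i t x) * (dblMap i R * (1 ⊗ₜ t (LinearMap.mul' k A y))) := by
    conv_lhs => rw [sepElement.eq_def R i t y]
    induction y with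
    | zero => simp
    | add v w hv hw => simp only [map_add, mul_add, TensorProduct.tmul_add, hv, hw]
    | tmul p q =>
      have h2 : TensorProduct.map (src R i t) t.toLinearMap (p ⊗ₜ q) =
          (src R i t p ⊗ₜ 1) * (1 ⊗ₜ t q) := by simp
      have h3 : (1 : B) ⊗ₜ[k] t (LinearMap.mul' k A (p ⊗ₜ q)) = (1 ⊗ₜ t p) * (1 ⊗ₜ t q) := by simp
      rw [h2, h3, ← mul_assoc (dblMap i R), ← mul_assoc,
        flipT_sepElement_mul_dblMap_mul_src hti hR hA hx hM]
      simp only [mul_assoc]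
  have h4 (y : A ⊗[k] A) :
      flipT (sepElement R i t y) * (dblMap i R * sepElement R i t x) =
      (t (LinearMap.mul' k A (flipT y)) ⊗ₜ 1) * (dblMap i R * sepElement R i t x) := by
    unfold sepElement
    induction y with
    | zero => simp
    | add v w hv hw =>
      simp only [map_add, flipT_add, add_mul, TensorProduct.add_tmul, hv, hw]
    | tmul p q =>
      have h2 : flipT (TensorProduct.map (src R i t) t.toLinearMap (p ⊗ₜ q)) =
          (t q ⊗ₜ 1) * (1 ⊗ₜ src R i t p) := by simp
      have h3 := src_snd_mul_dblMap_mul_sepElement hti hR hA hx hM hS hRA hRA' p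
      unfold sepElement at h3
      rw [h2, mul_assoc, h3, ← mul_assoc]
      simp
  have h5 := h1 x
  rw [h4, hx.symm, hx.mul_eq_one, map_one, ← Algebra.TensorProduct.one_def, one_mul,
    mul_one] at h5
  exact h5.symm

end Conj

end Braiding

/-! ### The weak Hopf algebra structure -/

section Model

open Coalgebra HopfAlgebra

variable {k H A B : Type*} [Field k] [Ring H] [HopfAlgebra k H] [Ring A] [Algebra k A]
  [Module H A] [IsScalarTower k H A] [Ring B] [Algebra k B]

/-- `B` is spanned by the products `t(a) i(h)`, which multiply as in the smash product; it acts on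
`A`, and `δ` is the algebra map `t(a) i(h) ↦ t(a) i(h₍₁₎) ⊗ i(h₍₂₎)`. The maps `Δ`, `ε` and `S`
are given by the formulas for the comultiplication, counit and antipode of the smash product. -/
structure IsSmashModel (R : H ⊗[k] H) (x : A ⊗[k] A) (α : A →ₗ[k] k) (i : H →ₐ[k] B)
    (t : A →ₐ[k] B) (ρ : B →ₐ[k] Module.End k A) (δ : B →ₐ[k] B ⊗[k] B)
    (Δ : B →ₗ[k] B ⊗[k] B) (ε : B →ₗ[k] k) (S : B →ₗ[k] B) : Prop where
  isQuasitriangular : IsQuasitriangular R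
  isQuantumCommutative : IsQuantumCommutative A R
  isSeparability : IsSymmetricSeparabilityIdempotent x
  isDualForm : IsDualForm x α
  drinfeldElement_smul (a : A) : drinfeldElement R • a = a
  isSmashPair : IsSmashPair i t
  surjective : Function.Surjective
    (LinearMap.mul' k B ∘ₗ TensorProduct.map t.toLinearMap i.toLinearMap)
  rho_t (a b : A) : ρ (t a) b = a * b
  rho_i (h : H) (b : A) : ρ (i h) b = h • b
  delta_t (a : A) : δ (t a) = t a ⊗ₜ 1
  delta_i (h : H) : δ (i h) = dblMap i (comul h)
  comul_apply (a : A) (h : H) :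
    Δ (t a * i h) = (t a ⊗ₜ 1) * (sepElement R i t x * dblMap i (comul h))
  counit_apply (b : B) : ε b = α (ρ b 1)
  antipode_apply (a : A) (h : H) : S (t a * i h) = i (antipode k h) * src R i t a

variable {R : H ⊗[k] H} {x : A ⊗[k] A} {α : A →ₗ[k] k} {i : H →ₐ[k] B}
  {t : A →ₐ[k] B} {ρ : B →ₐ[k] Module.End k A} {δ : B →ₐ[k] B ⊗[k] B}
  {Δ : B →ₗ[k] B ⊗[k] B} {ε : B →ₗ[k] k} {S : B →ₗ[k] B}

/-- `δ ⊗ id` -/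
noncomputable def deltaFst (δ : B →ₐ[k] B ⊗[k] B) : B ⊗[k] B →ₐ[k] B ⊗[k] (B ⊗[k] B) :=
  (Algebra.TensorProduct.assoc k k k B B B).toAlgHom.comp
    (Algebra.TensorProduct.map δ (AlgHom.id k B))

/-- `id ⊗ δ` -/
noncomputable def deltaSnd (δ : B →ₐ[k] B ⊗[k] B) : B ⊗[k] B →ₐ[k] B ⊗[k] (B ⊗[k] B) :=
  Algebra.TensorProduct.map (AlgHom.id k B) δ

theorem deltaFst_tmul (b c : B) :
    deltaFst δ (b ⊗ₜ c) = TensorProduct.assoc k B B B (δ b ⊗ₜ c) := rfl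

theorem deltaSnd_tmul (b c : B) : deltaSnd δ (b ⊗ₜ c) = b ⊗ₜ δ c := rfl

theorem assoc_tmul_eq (w : B ⊗[k] B) (c : B) :
    TensorProduct.assoc k B B B (w ⊗ₜ c) = leg12 w * (1 ⊗ₜ (1 ⊗ₜ c)) := by
  induction w with
  | zero => simp
  | add v w hv hw => simp only [TensorProduct.add_tmul, map_add, leg12_add, add_mul, hv, hw]
  | tmul p q => simp

/-- `(p ⊗ q, b) ↦ p b q` -/
noncomputable def sandwich : B ⊗[k] B →ₗ[k] B →ₗ[k] B :=
  (LinearMap.rTensorHom B ∘ₗ (LinearMap.mul k B).flip).flip.compr₂ (LinearMap.mul' k B)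

@[simp] theorem sandwich_tmul (p q b : B) : sandwich (k := k) (p ⊗ₜ q) b = p * b * q := rfl

theorem commute_leg12 (w : B ⊗[k] B) (c : B) :
    leg12 w * (1 ⊗ₜ (1 ⊗ₜ[k] c)) = (1 ⊗ₜ (1 ⊗ₜ[k] c)) * leg12 w := by
  induction w with
  | zero => simp
  | add v w hv hw => simp only [leg12_add, add_mul, mul_add, hv, hw]
  | tmul p q => simp

theorem commute_leg23 (w : B ⊗[k] B) (c : B) :
    leg23 w * (c ⊗ₜ 1) = (c ⊗ₜ 1) * leg23 w := by
  simp [leg23]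

/-- `i ⊗ i ⊗ i` -/
noncomputable def triMap (i : H →ₐ[k] B) : H ⊗[k] (H ⊗[k] H) →ₐ[k] B ⊗[k] (B ⊗[k] B) :=
  Algebra.TensorProduct.map i (dblMap i)

theorem triMap_leg12 (w : H ⊗[k] H) : triMap i (leg12 w) = leg12 (dblMap i w) := by
  induction w with
  | zero => simp
  | add v w hv hw => simp only [leg12_add, map_add, hv, hw]
  | tmul p q => simp [triMap]

theorem triMap_leg13 (w : H ⊗[k] H) : triMap i (leg13 w) = leg13 (dblMap i w) := by
  induction w with
  | zero => simp
  | add v w hv hw => simp only [leg13_add, map_add, hv, hw]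
  | tmul p q => simp [triMap]

theorem triMap_leg23 (w : H ⊗[k] H) : triMap i (leg23 w) = leg23 (dblMap i w) := by
  simp [triMap, leg23]

theorem triMap_assoc (w : H ⊗[k] H) (h : H) : triMap i (TensorProduct.assoc k H H H (w ⊗ₜ h)) =
    TensorProduct.assoc k B B B (dblMap i w ⊗ₜ i h) := by
  induction w with
  | zero => simp
  | add v w hv hw => simp only [TensorProduct.add_tmul, map_add, hv, hw]
  | tmul p q => simp [triMap]

namespace IsSmashModel

variable (M : IsSmashModel R x α i t ρ δ Δ ε S)
include M

theorem induction_on {p : B → Prop} (b : B) (zero : p 0) (add : ∀ b c, p b → p c → p (b + c))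
    (mul : ∀ a h, p (t a * i h)) : p b := by
  obtain ⟨z, rfl⟩ := M.surjective b
  induction z with
  | zero => simpa using zero
  | add v w hv hw => rw [map_add]; exact add _ _ hv hw
  | tmul a h => exact mul a h

theorem src_one [ModuleAlgebra k H A] : src R i t 1 = 1 :=
  QTSmash.src_one M.isQuasitriangular

theorem antipode_antipode_smul (h : H) (a : A) : antipode k (antipode k h) • a = h • a :=
  M.isQuasitriangular.antipode_antipode_smul M.drinfeldElement_smul h a

/-- `(R²·a)(R¹·b) = b a` is quantum commutativity. -/
theorem rho_src (a b : A) : ρ (src R i t a) b = b * a := by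
  have h (w : H ⊗[k] H) : ρ (placeLeft t.toLinearMap i w a) b =
      LinearMap.mul' k A (actBoth k H A (flipT w) (a ⊗ₜ b)) := by
    induction w with
    | zero => simp
    | add v w hv hw => simp only [flipT_add, map_add, LinearMap.add_apply, hv, hw]
    | tmul p q => simp [M.rho_t, M.rho_i]
  rw [src, h, ← M.isQuantumCommutative]

theorem deltaFst_dblMap (w : H ⊗[k] H) : deltaFst δ (dblMap i w) =
    triMap i (TensorProduct.assoc k H H H (comul.rTensor H w)) := by
  induction w with
  | zero => simp
  | add v w hv hw => simp only [map_add, hv, hw]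
  | tmul p q => rw [dblMap_tmul, deltaFst_tmul, M.delta_i, LinearMap.rTensor_tmul, triMap_assoc]

theorem deltaSnd_dblMap (w : H ⊗[k] H) : deltaSnd δ (dblMap i w) =
    triMap i (comul.lTensor H w) := by
  induction w with
  | zero => simp
  | add v w hv hw => simp only [map_add, hv, hw]
  | tmul p q => rw [dblMap_tmul, deltaSnd_tmul, M.delta_i]; rfl

variable [ModuleAlgebra k H A]

theorem antipode_smul_fst (h : H) :
    actBoth k H A (antipode k h ⊗ₜ 1) x = actBoth k H A (1 ⊗ₜ h) x :=
  IsDualForm.antipode_smul_fst M.isSeparability M.isDualForm M.antipode_antipode_smul h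

theorem antipodeFst_smul (a : A) : LinearMap.mul' k H (antipodeFst R) • a = a :=
  IsDualForm.mul'_antipodeFst_smul M.isSeparability M.isDualForm M.antipode_antipode_smul
    M.isQuasitriangular M.drinfeldElement_smul a

theorem flipT_antipodeFst_smul (a : A) : LinearMap.mul' k H (flipT (antipodeFst R)) • a = a :=
  IsDualForm.mul'_flipT_antipodeFst_smul M.isSeparability M.isDualForm M.antipode_antipode_smul
    M.isQuasitriangular M.drinfeldElement_smul a

theorem sepElement_mul_sepElement :
    sepElement R i t x * sepElement R i t x = sepElement R i t x :=
  QTSmash.sepElement_mul_sepElement M.isSmashPair M.isQuasitriangular M.isQuantumCommutative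
    M.isSeparability

/-- This separates the idempotent `e` from the algebra map `δ`; the weak bialgebra axioms involving
only `Δ` are derived from this form. -/
theorem comul_eq (b : B) : Δ b = sepElement R i t x * δ b := by
  induction b using M.induction_on with
  | zero => simp
  | add b c hb hc => simp only [map_add, mul_add, hb, hc]
  | mul a h =>
    rw [M.comul_apply, map_mul, M.delta_t, M.delta_i, ← mul_assoc, ← mul_assoc,
      sepElement_mul_fst M.isSmashPair M.isQuasitriangular M.isQuantumCommutative]

theorem delta_mul_sepElement (b : B) :
    δ b * sepElement R i t x = sepElement R i t x * δ b := by
  induction b using M.induction_on with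
  | zero => simp
  | add b c hb hc => simp only [map_add, mul_add, add_mul, hb, hc]
  | mul a h =>
    rw [map_mul, M.delta_t, M.delta_i, mul_assoc, sepElement_comm M.isSmashPair
      M.isQuasitriangular M.isQuantumCommutative M.antipode_smul_fst, ← mul_assoc, ← mul_assoc,
      sepElement_mul_fst M.isSmashPair M.isQuasitriangular M.isQuantumCommutative]

theorem comul_one : Δ 1 = sepElement R i t x := by
  rw [M.comul_eq, map_one, mul_one]

theorem comul_mul (b c : B) : Δ (b * c) = Δ b * Δ c := by
  rw [M.comul_eq, M.comul_eq, M.comul_eq, mul_assoc, ← mul_assoc (δ b), M.delta_mul_sepElement,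
    mul_assoc, ← mul_assoc (sepElement R i t x), M.sepElement_mul_sepElement, map_mul]

theorem comul_rTensor_eq (z : B ⊗[k] B) : TensorProduct.assoc k B B B (Δ.rTensor B z) =
    leg12 (sepElement R i t x) * deltaFst δ z := by
  induction z with
  | zero => simp
  | add v w hv hw => simp only [map_add, mul_add, hv, hw]
  | tmul b c =>
    rw [LinearMap.rTensor_tmul, deltaFst_tmul, M.comul_eq, assoc_tmul_eq, assoc_tmul_eq,
      leg12_mul, mul_assoc]

theorem comul_lTensor_eq (z : B ⊗[k] B) : Δ.lTensor B z =
    leg23 (sepElement R i t x) * deltaSnd δ z := by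
  induction z with
  | zero => simp
  | add v w hv hw => simp only [map_add, mul_add, hv, hw]
  | tmul b c =>
    rw [LinearMap.lTensor_tmul, deltaSnd_tmul, M.comul_eq, leg23,
      Algebra.TensorProduct.tmul_mul_tmul, one_mul]

/-- The first hexagon identity gives `δ(s(a)) = s(R²·a) ⊗ i(R¹)`. Behind `e`, `s(R²·a) ⊗ 1` becomes
`1 ⊗ t(R²·a)`, which rebuilds `s(a)` in the second leg. -/
theorem sepElement_mul_delta_src (a : A) : sepElement R i t x * δ (src R i t a) =
    sepElement R i t x * (1 ⊗ₜ src R i t a) := by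
  let F : H ⊗[k] (H ⊗[k] H) →ₗ[k] B ⊗[k] B :=
    mulThree ((TensorProduct.mk k B B).flip 1 ∘ₗ t.toLinearMap ∘ₗ (act k H A).flip a)
      ((TensorProduct.mk k B B).flip 1 ∘ₗ i.toLinearMap)
      (TensorProduct.mk k B B 1 ∘ₗ i.toLinearMap) ∘ₗ
    (TensorProduct.comm k (H ⊗[k] H) H).toLinearMap ∘ₗ
    (TensorProduct.assoc k H H H).symm.toLinearMap
  have h1 (w : H ⊗[k] H) : F (TensorProduct.assoc k H H H (comul.rTensor H w)) =
      δ (placeLeft t.toLinearMap i w a) := by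
    induction w with
    | zero => simp
    | add v w hv hw => simp only [map_add, LinearMap.add_apply, hv, hw]
    | tmul p r =>
      have h2 (z : H ⊗[k] H) : F (TensorProduct.assoc k H H H (z ⊗ₜ r)) =
          (t (r • a) ⊗ₜ 1) * dblMap i z := by
        induction z with
        | zero => simp
        | add v w hv hw => simp only [map_add, TensorProduct.add_tmul, mul_add, hv, hw]
        | tmul p q => simp [F]
      rw [LinearMap.rTensor_tmul, h2, placeLeft_tmul, map_mul, AlgHom.toLinearMap_apply,
        M.delta_t, M.delta_i]
  have h2 (v : H ⊗[k] H) : sepElement R i t x * F (leg13 R * leg23 v) =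
      sepElement R i t x * (1 ⊗ₜ placeLeft t.toLinearMap i v a) := by
    induction v with
    | zero => simp
    | add v v' hv hv' =>
      simp only [leg23_add, mul_add, map_add, LinearMap.add_apply, TensorProduct.tmul_add, hv, hv']
    | tmul p q =>
      have h3 (w : H ⊗[k] H) : F (leg13 w * leg23 (p ⊗ₜ q)) =
          (placeLeft t.toLinearMap i w (q • a) ⊗ₜ 1) * (1 ⊗ₜ i p) := by
        induction w with
        | zero => simp
        | add w w' hw hw' => simp only [leg13_add, add_mul, map_add, LinearMap.add_apply,
            TensorProduct.add_tmul, hw, hw']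
        | tmul p' q' => simp [F, mul_smul]
      have h4 : (1 : B) ⊗ₜ[k] placeLeft t.toLinearMap i (p ⊗ₜ q) a =
          (1 ⊗ₜ t (q • a)) * (1 ⊗ₜ i p) := by simp
      rw [h3, h4, ← mul_assoc, ← mul_assoc, ← src,
        sepElement_mul_right M.isSmashPair M.isQuasitriangular M.isQuantumCommutative
          M.isSeparability]
  rw [src, ← h1, M.isQuasitriangular.comul_rTensor, h2]

theorem leg12_mul_deltaFst : leg12 (sepElement R i t x) * deltaFst δ (sepElement R i t x) =
    leg12 (sepElement R i t x) * leg23 (sepElement R i t x) := by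
  have h (y : A ⊗[k] A) : leg12 (sepElement R i t x) * deltaFst δ (sepElement R i t y) =
      leg12 (sepElement R i t x) * leg23 (sepElement R i t y) := by
    conv_lhs => rw [sepElement.eq_def R i t y]
    conv_rhs => rw [sepElement.eq_def R i t y]
    induction y with
    | zero => simp
    | add v w hv hw => simp only [map_add, leg23_add, mul_add, hv, hw]
    | tmul p q =>
      rw [TensorProduct.map_tmul, deltaFst_tmul, assoc_tmul_eq, ← mul_assoc, ← leg12_mul,
        M.sepElement_mul_delta_src, leg12_mul, mul_assoc]
      simp
  exact h x

theorem deltaSnd_sepElement : deltaSnd δ (sepElement R i t x) = leg12 (sepElement R i t x) := by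
  have h (y : A ⊗[k] A) : deltaSnd δ (sepElement R i t y) = leg12 (sepElement R i t y) := by
    unfold sepElement
    induction y with
    | zero => simp
    | add v w hv hw => simp only [map_add, leg12_add, hv, hw]
    | tmul p q =>
      rw [TensorProduct.map_tmul, deltaSnd_tmul, AlgHom.toLinearMap_apply, M.delta_t, leg12_tmul]
  exact h x

/-- The two factors meet only in the middle leg, where `t(x²)` commutes with `s(x¹)`. -/
theorem leg12_mul_leg23_comm : leg12 (sepElement R i t x) * leg23 (sepElement R i t x) =
    leg23 (sepElement R i t x) * leg12 (sepElement R i t x) := by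
  have h (y z : A ⊗[k] A) : leg12 (sepElement R i t y) * leg23 (sepElement R i t z) =
      leg23 (sepElement R i t z) * leg12 (sepElement R i t y) := by
    unfold sepElement
    induction y with
    | zero => simp
    | add v w hv hw => simp only [map_add, leg12_add, mul_add, add_mul, hv, hw]
    | tmul p q =>
      induction z with
      | zero => simp
      | add v w hv hw => simp only [map_add, leg23_add, mul_add, add_mul, hv, hw]
      | tmul p' q' =>
        simp [src_mul_comm M.isSmashPair M.isQuasitriangular M.isQuantumCommutative]
  exact h x x

theorem deltaFst_comp_delta (b : B) : deltaFst δ (δ b) = deltaSnd δ (δ b) := by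
  induction b using M.induction_on with
  | zero => simp
  | add b c hb hc => simp only [map_add, hb, hc]
  | mul a h =>
    simp only [map_mul, M.delta_t, M.delta_i, M.deltaFst_dblMap, M.deltaSnd_dblMap,
      Coalgebra.coassoc_apply, deltaFst_tmul, deltaSnd_tmul, map_one]
    rfl

/-- Both iterated coproducts are `e₁₂ e₂₃` times the iterated coproduct of `δ`. -/
theorem coassoc (b : B) : TensorProduct.assoc k B B B (Δ.rTensor B (Δ b)) =
    Δ.lTensor B (Δ b) := by
  rw [M.comul_rTensor_eq, M.comul_lTensor_eq, M.comul_eq, map_mul, map_mul, ← mul_assoc,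
    ← mul_assoc, M.leg12_mul_deltaFst, M.deltaSnd_sepElement, M.deltaFst_comp_delta,
    M.leg12_mul_leg23_comm]

theorem rho_mul_i (b : B) (h : H) : ρ (b * i h) 1 = counit (R := k) h • ρ b 1 := by
  rw [map_mul, Module.End.mul_apply, M.rho_i, ModuleAlgebra.smul_one (k := k), map_smul]

theorem evalSnd_flipT (f : A →ₗ[k] k) : evalSnd f (flipT x) = evalSnd f x := by
  rw [M.isSeparability.symm]

theorem evalSnd_mulLeft (a : A) : evalSnd (α ∘ₗ LinearMap.mulLeft k a) x = a :=
  QTSmash.evalSnd_mulLeft M.isSeparability M.isDualForm a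

theorem evalSnd_mulRight (a : A) : evalSnd (α ∘ₗ LinearMap.mulRight k a) x = a :=
  QTSmash.evalSnd_mulRight M.isSeparability M.isDualForm a

/-- A linear map is evaluated on `Δ(t(a) i(h))` by evaluating it on
`t(a) s(x¹) i(h₍₁₎) ⊗ t(x²) i(h₍₂₎)`. -/
theorem map_comul {N : Type*} [AddCommGroup N] [Module k N] (f : B ⊗[k] B →ₗ[k] N)
    (g : A ⊗[k] A →ₗ[k] H ⊗[k] H →ₗ[k] N) (a : A) (h : H)
    (hfg : ∀ p q u v, f ((t a * (src R i t p * i u)) ⊗ₜ (t q * i v)) = g (p ⊗ₜ q) (u ⊗ₜ v)) :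
    f (Δ (t a * i h)) = g x (comul h) := by
  have h1 (y : A ⊗[k] A) (z : H ⊗[k] H) :
      f ((t a ⊗ₜ 1) * (sepElement R i t y * dblMap i z)) = g y z := by
    unfold sepElement
    induction y with
    | zero => simp
    | add v w hv hw => simp only [map_add, mul_add, add_mul, LinearMap.add_apply, hv, hw]
    | tmul p q =>
      induction z with
      | zero => simp
      | add v w hv hw => simp only [map_add, mul_add, hv, hw]
      | tmul u v => simp [← hfg]
  rw [M.comul_apply, h1]

theorem counit_mul_i (b : B) (h : H) : ε (b * i h) = counit (R := k) h * ε b := by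
  rw [M.counit_apply, M.rho_mul_i, map_smul, smul_eq_mul, M.counit_apply]

/-- `s(p)` acts as right multiplication, so here the counit is the pairing for which `x` is the dual
tensor. -/
theorem counit_t_mul_src (a p : A) : ε (t a * src R i t p) = α (a * p) := by
  simp [M.counit_apply, M.rho_t, M.rho_src]

theorem rTensor_counit (b : B) : ε.rTensor B (Δ b) = 1 ⊗ₜ[k] b := by
  refine (TensorProduct.lid k B).injective ?_
  rw [TensorProduct.lid_tmul, one_smul]
  induction b using M.induction_on with
  | zero => simp
  | add b c hb hc => simp only [map_add, hb, hc]
  | mul a h =>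
    have := M.map_comul ((TensorProduct.lid k B).toLinearMap ∘ₗ ε.rTensor B)
      ((LinearMap.mul k B).compl₁₂ (t.toLinearMap ∘ₗ evalSnd (α ∘ₗ LinearMap.mulLeft k a) ∘ₗ
        (TensorProduct.comm k A A).toLinearMap) (i.toLinearMap ∘ₗ counitFst)) a h
      (fun p q u v => by simp [← mul_assoc, M.counit_mul_i, M.counit_t_mul_src, smul_smul])
    refine this.trans ?_
    change t (evalSnd _ (flipT x)) * i (counitFst _) = _
    rw [M.evalSnd_flipT, M.evalSnd_mulLeft, counitFst_comul]

theorem lTensor_counit (b : B) : ε.lTensor B (Δ b) = b ⊗ₜ[k] 1 := by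
  refine (TensorProduct.rid k B).injective ?_
  rw [TensorProduct.rid_tmul, one_smul]
  induction b using M.induction_on with
  | zero => simp
  | add b c hb hc => simp only [map_add, hb, hc]
  | mul a h =>
    have := M.map_comul ((TensorProduct.rid k B).toLinearMap ∘ₗ ε.lTensor B)
      ((LinearMap.mul k B).compl₁₂ (LinearMap.mulLeft k (t a) ∘ₗ src R i t ∘ₗ evalSnd α)
        (i.toLinearMap ∘ₗ counitSnd)) a h
      (fun p q u v => by
        simp [← mul_assoc, M.counit_mul_i, M.counit_apply (t q), M.rho_t, smul_smul])
    refine this.trans ?_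
    change t a * src R i t (evalSnd α x) * i (counitSnd _) = _
    rw [evalSnd_eq_one M.isSeparability M.isDualForm, M.src_one, mul_one, counitSnd_comul]

theorem evalSnd_mul_tmul (a : A) : evalSnd α (x * (1 ⊗ₜ a)) = a := by
  have h (w : A ⊗[k] A) :
      evalSnd (α ∘ₗ LinearMap.mulRight k a) w = evalSnd α (w * (1 ⊗ₜ a)) := by
    induction w with
    | zero => simp
    | add v w hv hw => simp only [map_add, add_mul, hv, hw]
    | tmul p q => simp
  rw [← h, M.evalSnd_mulRight]

theorem evalSnd_tmul_mul (a : A) : evalSnd α ((1 ⊗ₜ a) * x) = a := by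
  have h (w : A ⊗[k] A) :
      evalSnd (α ∘ₗ LinearMap.mulLeft k a) w = evalSnd α ((1 ⊗ₜ a) * w) := by
    induction w with
    | zero => simp
    | add v w hv hw => simp only [map_add, mul_add, hv, hw]
    | tmul p q => simp
  rw [← h, M.evalSnd_mulLeft]

end IsSmashModel

end Model

/-! ### The remaining counit axioms and the antipode axioms. -/

section Model

open Coalgebra HopfAlgebra

variable {k H A B : Type*} [Field k] [Ring H] [HopfAlgebra k H] [Ring A] [Algebra k A]
  [Module H A] [IsScalarTower k H A] [Ring B] [Algebra k B]

variable {R : H ⊗[k] H} {x : A ⊗[k] A} {α : A →ₗ[k] k} {i : H →ₐ[k] B}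
  {t : A →ₐ[k] B} {ρ : B →ₐ[k] Module.End k A} {δ : B →ₐ[k] B ⊗[k] B}
  {Δ : B →ₗ[k] B ⊗[k] B} {ε : B →ₗ[k] k} {S : B →ₗ[k] B}

namespace IsSmashModel

variable (M : IsSmashModel R x α i t ρ δ Δ ε S) [ModuleAlgebra k H A]
include M

/-- For `c = t(a) i(h)` and `d₀ = ρ(d) 1`, the right side is `α(ρ(b)(a x¹)) α(x² (h·d₀))`; the dual
basis property contracts it to `α(ρ(b)(a (h·d₀)))`. The flipped version contracts `x` in the other
order. -/
theorem counit_mul (b c d : B) : ε (b * c * d) = LinearMap.mul' k k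
    (TensorProduct.map (ε ∘ₗ LinearMap.mulLeft k b) (ε ∘ₗ LinearMap.mulRight k d) (Δ c)) := by
  induction c using M.induction_on with
  | zero => simp
  | add c c' hc hc' => simp only [map_add, mul_add, add_mul, hc, hc']
  | mul a h =>
    have := M.map_comul (LinearMap.mul' k k ∘ₗ
        TensorProduct.map (ε ∘ₗ LinearMap.mulLeft k b) (ε ∘ₗ LinearMap.mulRight k d))
      (((LinearMap.mul k (A ⊗[k] A)).compl₂ (TensorProduct.mk k A A 1 ∘ₗ
        (act k H A).flip (ρ d 1) ∘ₗ counitFst)).compr₂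
          (α ∘ₗ ρ b ∘ₗ LinearMap.mulLeft k a ∘ₗ evalSnd α)) a h
      (fun p q u v => by
        simp [M.counit_apply, M.rho_t, M.rho_i, M.rho_src, ModuleAlgebra.smul_one (k := k),
          mul_assoc]
        exact Or.inl (mul_comm _ _))
    refine Eq.trans ?_ this.symm
    change _ = α (ρ b (a * evalSnd α (x * (1 ⊗ₜ (counitFst (comul h) • ρ d 1)))))
    rw [M.evalSnd_mul_tmul, counitFst_comul]
    simp [M.counit_apply, M.rho_t, M.rho_i]

theorem counit_mul' (b c d : B) : ε (b * c * d) = LinearMap.mul' k k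
    (TensorProduct.map (ε ∘ₗ LinearMap.mulLeft k b) (ε ∘ₗ LinearMap.mulRight k d)
      (flipT (Δ c))) := by
  induction c using M.induction_on with
  | zero => simp
  | add c c' hc hc' => simp only [map_add, flipT_add, mul_add, add_mul, hc, hc']
  | mul a h =>
    have := M.map_comul (LinearMap.mul' k k ∘ₗ
        TensorProduct.map (ε ∘ₗ LinearMap.mulLeft k b) (ε ∘ₗ LinearMap.mulRight k d) ∘ₗ
        (TensorProduct.comm k B B).toLinearMap)
      (((LinearMap.mul k (A ⊗[k] A)).flip.compl₁₂ (TensorProduct.comm k A A).toLinearMap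
        (TensorProduct.mk k A A 1 ∘ₗ LinearMap.mulLeft k a ∘ₗ
        (act k H A).flip (ρ d 1) ∘ₗ counitSnd)).compr₂
          (α ∘ₗ ρ b ∘ₗ evalSnd α)) a h
      (fun p q u v => by
        simp [M.counit_apply, M.rho_t, M.rho_i, M.rho_src, ModuleAlgebra.smul_one (k := k),
          mul_assoc]
        exact Or.inl (mul_comm _ _))
    refine Eq.trans ?_ this.symm
    change _ = α (ρ b (evalSnd α ((1 ⊗ₜ (a * (counitSnd (comul h) • ρ d 1))) * flipT x)))
    rw [M.isSeparability.symm, M.evalSnd_tmul_mul, counitSnd_comul]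
    simp [M.counit_apply, M.rho_t, M.rho_i]

theorem targetCounital_eq (b : B) : targetCounital Δ ε b = t (ρ b 1) := by
  have h (y : A ⊗[k] A) :
      TensorProduct.lid k B ((ε ∘ₗ LinearMap.mulRight k b).rTensor B (sepElement R i t y)) =
        t (evalSnd (α ∘ₗ LinearMap.mulLeft k (ρ b 1)) (flipT y)) := by
    unfold sepElement
    induction y with
    | zero => simp
    | add v w hv hw => simp only [map_add, flipT_add, hv, hw]
    | tmul p q => simp [M.counit_apply, M.rho_src]
  rw [targetCounital, M.comul_one, h, M.evalSnd_flipT, M.evalSnd_mulLeft]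

theorem sourceCounital_eq (a : A) (h : H) :
    sourceCounital Δ ε (t a * i h) = src R i t (antipode k h • a) := by
  have h1 (q : A) : α (a * (h • q)) = α (q * (antipode k h • a)) := by
    rw [IsDualForm.apply_mul_comm M.isSeparability M.isDualForm,
      IsDualForm.apply_smul_mul M.isSeparability M.isDualForm M.antipode_antipode_smul]
  have h2 (y : A ⊗[k] A) :
      TensorProduct.rid k B ((ε ∘ₗ LinearMap.mulLeft k (t a * i h)).lTensor B
        (sepElement R i t y)) =
        src R i t (evalSnd (α ∘ₗ LinearMap.mulRight k (antipode k h • a)) y) := by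
    unfold sepElement
    induction y with
    | zero => simp
    | add v w hv hw => simp only [map_add, hv, hw]
    | tmul p q => simp [M.counit_apply, M.rho_t, M.rho_i, h1]
  rw [sourceCounital, M.comul_one, h2, M.evalSnd_mulRight]

/-- Expanding `s(p)` and applying the formula for `S` puts `i(S(R¹)) s(R²·p)` in the middle, which
is `t(p)` by `placeRight_src`. -/
theorem antipode_t_mul_src (a p : A) (h : H) :
    S (t a * (src R i t p * i h)) = i (antipode k h) * (t p * src R i t a) := by
  have h1 (w : H ⊗[k] H) : S (t a * (placeLeft t.toLinearMap i w p * i h)) =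
      i (antipode k h) * (placeRight (src R i t) i (antipodeFst w) p * src R i t a) := by
    induction w with
    | zero => simp
    | add v w hv hw => simp only [map_add, LinearMap.add_apply, add_mul, mul_add, hv, hw]
    | tmul u v =>
      have h2 : t a * (placeLeft t.toLinearMap i (u ⊗ₜ v) p * i h) =
          t (a * (v • p)) * i (u * h) := by simp [mul_assoc]
      rw [h2, M.antipode_apply, antipode_mul_antidistrib, map_mul,
        src_mul M.isSmashPair M.isQuasitriangular M.isQuantumCommutative]
      simp [mul_assoc]
  rw [src, h1, placeRight_src M.isSmashPair M.isQuasitriangular M.antipodeFst_smul]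
  rfl

theorem mul_antipode (b : B) :
    LinearMap.mul' k B (S.lTensor B (Δ b)) = targetCounital Δ ε b := by
  rw [M.targetCounital_eq]
  induction b using M.induction_on with
  | zero => simp
  | add b c hb hc => simp only [map_add, LinearMap.add_apply, hb, hc]
  | mul a h =>
    have := M.map_comul (LinearMap.mul' k B ∘ₗ S.lTensor B)
      ((sandwich.compl₁₂ (TensorProduct.map (src R i t) (src R i t))
        (i.toLinearMap ∘ₗ LinearMap.mul' k H ∘ₗ (antipode k).lTensor H)).compr₂
          (LinearMap.mulLeft k (t a))) a h
      (fun p q u v => by simp [M.antipode_apply, mul_assoc])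
    refine this.trans ?_
    -- Once `h₍₁₎ S(h₍₂₎)` has collapsed to a scalar, `s(x¹) s(x²) = s(x² x¹)` remains; symmetry of
    -- `x` makes it `1`.
    have h1 (y : A ⊗[k] A) (c : k) :
        sandwich (TensorProduct.map (src R i t) (src R i t) y) (algebraMap k B c) =
          c • src R i t (LinearMap.mul' k A (flipT y)) := by
      induction y with
      | zero => simp
      | add v w hv hw => simp only [map_add, flipT_add, LinearMap.add_apply, smul_add, hv, hw]
      | tmul p q =>
        simp [src_mul M.isSmashPair M.isQuasitriangular M.isQuantumCommutative,
          Algebra.algebraMap_eq_smul_one]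
    change t a * sandwich _ (i (LinearMap.mul' k H ((antipode k).lTensor H (comul h)))) = _
    rw [mul_antipode_lTensor_comul_apply, AlgHom.commutes, h1, M.isSeparability.symm,
      M.isSeparability.mul_eq_one, M.src_one, M.rho_mul_i, M.rho_t]
    simp

/-- Moving `s(a)` past `i(h₍₂₎)` on the right creates `S(h₍₃₎)·a` and leaves `S(h₍₁₎) h₍₂₎` to
cancel. -/
theorem sandwich_antipode (a : A) (h : H) :
    sandwich (TensorProduct.map (i.toLinearMap ∘ₗ antipode k) i.toLinearMap (comul h))
      (src R i t a) = src R i t (antipode k h • a) := by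
  let F : H ⊗[k] (H ⊗[k] H) →ₗ[k] B :=
    mulThree (i.toLinearMap ∘ₗ antipode k) i.toLinearMap
      (src R i t ∘ₗ (act k H A).flip a ∘ₗ antipode k)
  have h1 (z : H ⊗[k] H) : F (TensorProduct.assoc k H H H (comul.rTensor H z)) =
      src R i t (antipode k (counitFst z) • a) := by
    induction z with
    | zero => simp
    | add v w hv hw => simp only [map_add, add_smul, hv, hw]
    | tmul p r =>
      have h2 (w : H ⊗[k] H) : F (TensorProduct.assoc k H H H (w ⊗ₜ r)) =
          i (LinearMap.mul' k H ((antipode k).rTensor H w)) *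
            src R i t (antipode k r • a) := by
        induction w with
        | zero => simp
        | add v w hv hw => simp only [map_add, TensorProduct.add_tmul, add_mul, hv, hw]
        | tmul p q => simp [F, mul_assoc]
      rw [LinearMap.rTensor_tmul, h2, mul_antipode_rTensor_comul_apply]
      simp [Algebra.algebraMap_eq_smul_one]
  have h3 (z : H ⊗[k] H) : F (comul.lTensor H z) =
      sandwich (TensorProduct.map (i.toLinearMap ∘ₗ antipode k) i.toLinearMap z)
        (src R i t a) := by
    induction z with
    | zero => simp
    | add v w hv hw => simp only [map_add, LinearMap.add_apply, hv, hw]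
    | tmul p r =>
      have h2 (w : H ⊗[k] H) : F (p ⊗ₜ w) = i (antipode k p) *
          placeRight (src R i t) i ((antipode k).lTensor H w) a := by
        induction w with
        | zero => simp
        | add v w hv hw =>
          simp only [map_add, TensorProduct.tmul_add, LinearMap.add_apply, mul_add, hv, hw]
        | tmul p q => simp [F]
      rw [LinearMap.lTensor_tmul, h2, ← src_mul_apply M.isSmashPair M.isQuasitriangular,
        ← mul_assoc]
      rfl
  rw [← h3, ← Coalgebra.coassoc_apply, h1, counitFst_comul]

/-- On `t(a) i(h)` the left side is `i(S(h₍₁₎)) t(x¹) s(a) t(x²) i(h₍₂₎)`. Since `s(a)` commutes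
with `t(x²)`, the idempotent contributes `x¹x² = 1`. -/
theorem antipode_mul (b : B) :
    LinearMap.mul' k B (S.rTensor B (Δ b)) = sourceCounital Δ ε b := by
  induction b using M.induction_on with
  | zero => simp [sourceCounital, LinearMap.mulLeft_zero_eq_zero]
  | add b c hb hc =>
    have h1 : LinearMap.mulLeft k (b + c) = LinearMap.mulLeft k b + LinearMap.mulLeft k c :=
      map_add (LinearMap.mul k B) b c
    simp only [map_add, hb, hc, sourceCounital, h1, LinearMap.comp_add, LinearMap.lTensor_add,
      LinearMap.add_apply]
  | mul a h =>
    rw [M.sourceCounital_eq]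
    have := M.map_comul (LinearMap.mul' k B ∘ₗ S.rTensor B)
      (sandwich.compl₁₂ (TensorProduct.map (i.toLinearMap ∘ₗ antipode k) i.toLinearMap)
        (LinearMap.mulRight k (src R i t a) ∘ₗ t.toLinearMap ∘ₗ LinearMap.mul' k A)).flip a h
      (fun p q u v => by
        have h1 := src_mul_comm M.isSmashPair M.isQuasitriangular M.isQuantumCommutative a q
        simp [M.antipode_t_mul_src, mul_assoc]
        rw [← mul_assoc (src R i t a), h1, mul_assoc])
    refine this.trans ?_
    change sandwich _ (t (LinearMap.mul' k A x) * src R i t a) = _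
    rw [M.isSeparability.mul_eq_one, map_one, one_mul, M.sandwich_antipode]

theorem antipode_mul_antipode (b : B) : LinearMap.mul' k B
    (TensorProduct.map S (LinearMap.mul' k B ∘ₗ S.lTensor B ∘ₗ Δ) (Δ b)) = S b := by
  have h1 (q : A) (v : H) : (LinearMap.mul' k B ∘ₗ S.lTensor B ∘ₗ Δ) (t q * i v) =
      counit (R := k) v • t q := by
    rw [LinearMap.comp_apply, LinearMap.comp_apply, M.mul_antipode, M.targetCounital_eq,
      M.rho_mul_i, M.rho_t, mul_one, map_smul]
  induction b using M.induction_on with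
  | zero => simp
  | add b c hb hc => simp only [map_add, hb, hc]
  | mul a h =>
    have := M.map_comul (LinearMap.mul' k B ∘ₗ
        TensorProduct.map S (LinearMap.mul' k B ∘ₗ S.lTensor B ∘ₗ Δ))
      ((LinearMap.mul k B).compl₁₂ (i.toLinearMap ∘ₗ antipode k ∘ₗ counitSnd)
        (LinearMap.mulRight k (src R i t a) ∘ₗ t.toLinearMap ∘ₗ LinearMap.mul' k A)).flip a h
      (fun p q u v => by
        have h2 := src_mul_comm M.isSmashPair M.isQuasitriangular M.isQuantumCommutative a q
        rw [LinearMap.comp_apply, TensorProduct.map_tmul, M.antipode_t_mul_src, h1]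
        simp [mul_assoc, h2])
    refine this.trans ?_
    change i (antipode k (counitSnd (comul h))) *
      (t (LinearMap.mul' k A x) * src R i t a) = _
    rw [M.isSeparability.mul_eq_one, map_one, one_mul, counitSnd_comul, M.antipode_apply]

theorem isWeakHopfAlgebra : IsWeakHopfAlgebra Δ ε S where
  coassoc := LinearMap.ext M.coassoc
  rTensor_counit := M.rTensor_counit
  lTensor_counit := M.lTensor_counit
  comul_mul := M.comul_mul
  comul_one := by
    rw [M.comul_rTensor_eq, M.comul_one, M.leg12_mul_deltaFst]
  comul_one' := by
    rw [M.comul_rTensor_eq, M.comul_one, M.leg12_mul_deltaFst, M.leg12_mul_leg23_comm]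
  counit_mul := M.counit_mul
  counit_mul' := M.counit_mul'
  mul_antipode := M.mul_antipode
  antipode_mul := M.antipode_mul
  antipode_mul_antipode := M.antipode_mul_antipode

end IsSmashModel

end Model

/-! ### The R-matrix of the smash product. -/

section Model

open Coalgebra HopfAlgebra

variable {k H A B : Type*} [Field k] [Ring H] [HopfAlgebra k H] [Ring A] [Algebra k A]
  [Module H A] [IsScalarTower k H A] [Ring B] [Algebra k B]

variable {R : H ⊗[k] H} {x : A ⊗[k] A} {α : A →ₗ[k] k} {i : H →ₐ[k] B}
  {t : A →ₐ[k] B} {ρ : B →ₐ[k] Module.End k A} {δ : B →ₐ[k] B ⊗[k] B}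
  {Δ : B →ₗ[k] B ⊗[k] B} {ε : B →ₗ[k] k} {S : B →ₗ[k] B}

namespace IsSmashModel

variable (M : IsSmashModel R x α i t ρ δ Δ ε S) [ModuleAlgebra k H A]
  (hM : IsInMuegerCenter A R)
include M

theorem flipT_mul_flipT : flipT (sepElement R i t x) * flipT (sepElement R i t x) =
    flipT (sepElement R i t x) := by
  rw [← flipT_mul, M.sepElement_mul_sepElement]

include hM

theorem flipT_mul_dblMap :
    flipT (sepElement R i t x) * dblMap i R = dblMap i R * sepElement R i t x :=
  flipT_sepElement_mul_dblMap M.isSmashPair M.isQuasitriangular M.isQuantumCommutative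
    M.isSeparability hM M.antipode_antipode_smul M.antipodeFst_smul M.flipT_antipodeFst_smul

theorem rMatrix_eq_left : flipT (Δ 1) * dblMap i R * Δ 1 =
    flipT (sepElement R i t x) * dblMap i R := by
  rw [M.comul_one, mul_assoc, ← M.flipT_mul_dblMap hM, ← mul_assoc, M.flipT_mul_flipT]

theorem rMatrix_eq_right : flipT (Δ 1) * dblMap i R * Δ 1 =
    dblMap i R * sepElement R i t x := by
  rw [M.rMatrix_eq_left hM, M.flipT_mul_dblMap hM]

theorem flip_comul_mul (b : B) : flipT (Δ b) * (flipT (Δ 1) * dblMap i R * Δ 1) =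
    flipT (Δ 1) * dblMap i R * Δ 1 * Δ b := by
  -- It suffices to intertwine `δ` on generators: for `t(a)` this is the passage of `t(a)` through
  -- `R` behind `e²¹`, for `i(h)` it is `R Δ(h) = Δᶜᵒᵖ(h) R` in `H`.
  have ht (a : A) : flipT (δ (t a)) * (flipT (sepElement R i t x) * dblMap i R) =
      flipT (sepElement R i t x) * dblMap i R * δ (t a) := by
    have h1 := congrArg flipT (sepElement_mul_fst (x := x) M.isSmashPair M.isQuasitriangular
      M.isQuantumCommutative a)
    rw [flipT_mul, flipT_mul, flipT_tmul] at h1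
    rw [M.delta_t, flipT_tmul, ← mul_assoc, ← h1, mul_assoc, mul_assoc,
      flipT_sepElement_mul_dblMap_mul M.isSmashPair M.isQuasitriangular M.isQuantumCommutative
      M.isSeparability hM]
  have hi (h : H) : flipT (δ (i h)) * (flipT (sepElement R i t x) * dblMap i R) =
      flipT (sepElement R i t x) * dblMap i R * δ (i h) := by
    rw [M.flipT_mul_dblMap hM, M.delta_i, flipT_dblMap, ← mul_assoc, ← map_mul,
      ← M.isQuasitriangular.mul_comul, map_mul, mul_assoc, mul_assoc,
      sepElement_comm M.isSmashPair M.isQuasitriangular M.isQuantumCommutative M.antipode_smul_fst]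
  have hb : flipT (δ b) * (flipT (sepElement R i t x) * dblMap i R) =
      flipT (sepElement R i t x) * dblMap i R * δ b := by
    induction b using M.induction_on with
    | zero => simp
    | add b c hb hc => simp only [map_add, flipT_add, add_mul, mul_add, hb, hc]
    | mul a h => rw [map_mul, flipT_mul, mul_assoc, hi, ← mul_assoc, ht, mul_assoc]
  rw [M.rMatrix_eq_left hM, M.comul_eq, flipT_mul, mul_assoc, hb, ← mul_assoc, ← mul_assoc,
    M.flipT_mul_flipT, M.flipT_mul_dblMap hM, mul_assoc (dblMap i R),
    mul_assoc (dblMap i R), ← mul_assoc (sepElement R i t x), M.sepElement_mul_sepElement]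

/-- Carrying `s(x¹)` through `R¹²` from the first leg to the second turns `e₁₃` into `e₂₃`. In
`leg13_mul_leg23`, `t(x²)` is carried through `R²³` from the third leg to the second, turning `e₁₃`
into `e₁₂`. -/
theorem leg13_mul_leg12 : leg13 (sepElement R i t x) * leg12 (dblMap i R * sepElement R i t x) =
    leg12 (dblMap i R) * (leg23 (sepElement R i t x) * leg12 (sepElement R i t x)) := by
  have h (y : A ⊗[k] A) :
      leg13 (sepElement R i t y) * leg12 (dblMap i R * sepElement R i t x) =
      leg12 (dblMap i R) * (leg23 (sepElement R i t y) * leg12 (sepElement R i t x)) := by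
    conv_lhs => rw [sepElement.eq_def R i t y]
    conv_rhs => rw [sepElement.eq_def R i t y]
    induction y with
    | zero => simp
    | add v w hv hw => simp only [map_add, leg13_add, leg23_add, mul_add, add_mul, hv, hw]
    | tmul p q =>
      have h1 : leg13 (TensorProduct.map (src R i t) t.toLinearMap (p ⊗ₜ q)) =
          (1 ⊗ₜ (1 ⊗ₜ t q)) * leg12 (src R i t p ⊗ₜ 1) := by simp
      have h2 : leg23 (TensorProduct.map (src R i t) t.toLinearMap (p ⊗ₜ q)) =
          (1 ⊗ₜ (1 ⊗ₜ t q)) * leg12 (1 ⊗ₜ src R i t p) := by simp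
      rw [h1, h2, mul_assoc, ← leg12_mul, fst_mul_dblMap_mul_sepElement M.isSmashPair
        M.isQuasitriangular M.isQuantumCommutative M.isSeparability hM M.flipT_antipodeFst_smul,
        leg12_mul, ← mul_assoc, ← commute_leg12, leg12_mul]
      simp only [mul_assoc]
  exact h x

omit hM in
theorem leg13_mul_leg23 : leg13 (sepElement R i t x) * leg23 (dblMap i R * sepElement R i t x) =
    leg23 (dblMap i R) * (leg12 (sepElement R i t x) * leg23 (sepElement R i t x)) := by
  have h (y : A ⊗[k] A) :
      leg13 (sepElement R i t y) * leg23 (dblMap i R * sepElement R i t x) =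
      leg23 (dblMap i R) * (leg12 (sepElement R i t y) * leg23 (sepElement R i t x)) := by
    conv_lhs => rw [sepElement.eq_def R i t y]
    conv_rhs => rw [sepElement.eq_def R i t y]
    induction y with
    | zero => simp
    | add v w hv hw => simp only [map_add, leg13_add, leg12_add, mul_add, add_mul, hv, hw]
    | tmul p q =>
      have h1 : leg13 (TensorProduct.map (src R i t) t.toLinearMap (p ⊗ₜ q)) =
          (src R i t p ⊗ₜ 1) * leg23 (1 ⊗ₜ t q) := by simp
      have h2 : leg12 (TensorProduct.map (src R i t) t.toLinearMap (p ⊗ₜ q)) =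
          (src R i t p ⊗ₜ 1) * leg23 (t q ⊗ₜ 1) := by
        simp [Algebra.TensorProduct.one_def]
      rw [h1, h2, mul_assoc, ← leg23_mul, snd_mul_dblMap_mul_sepElement M.isSmashPair
        M.isQuasitriangular M.isQuantumCommutative M.isSeparability M.antipodeFst_smul,
        leg23_mul, ← mul_assoc, ← commute_leg23, leg23_mul]
      simp only [mul_assoc]
  exact h x

omit hM in
theorem leg23_mul_deltaSnd_dblMap (w : H ⊗[k] H) :
    leg23 (sepElement R i t x) * deltaSnd δ (dblMap i w) =
      deltaSnd δ (dblMap i w) * leg23 (sepElement R i t x) := by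
  induction w with
  | zero => simp
  | add v w hv hw => simp only [map_add, mul_add, add_mul, hv, hw]
  | tmul p q =>
    simp [leg23, deltaSnd_tmul, M.delta_mul_sepElement]

omit hM in
theorem leg12_mul_deltaFst_dblMap (w : H ⊗[k] H) :
    leg12 (sepElement R i t x) * deltaFst δ (dblMap i w) =
      deltaFst δ (dblMap i w) * leg12 (sepElement R i t x) := by
  induction w with
  | zero => simp
  | add v w hv hw => simp only [map_add, mul_add, add_mul, hv, hw]
  | tmul p q =>
    rw [dblMap_tmul, deltaFst_tmul, assoc_tmul_eq, mul_assoc, ← commute_leg12, ← mul_assoc,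
      ← mul_assoc, ← leg12_mul, ← leg12_mul, M.delta_mul_sepElement]

theorem isQuasitriangularWeakHopfAlgebra :
    IsQuasitriangularWeakHopfAlgebra Δ ε S (flipT (Δ 1) * dblMap i R * Δ 1) where
  toIsWeakHopfAlgebra := M.isWeakHopfAlgebra
  mem := ⟨_, rfl⟩
  flip_comul_mul := M.flip_comul_mul hM
  comul_lTensor := by
    -- With `𝓡 = R e`, both sides reduce to `R¹³ R¹² e₂₃ e₁₂`.
    have h1 : leg13 (flipT (Δ 1) * dblMap i R * Δ 1) * leg12 (flipT (Δ 1) * dblMap i R * Δ 1) =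
        leg13 (dblMap i R) * (leg13 (sepElement R i t x) *
          leg12 (dblMap i R * sepElement R i t x)) := by
      rw [M.rMatrix_eq_right hM, leg13_mul, mul_assoc]
    rw [h1, M.leg13_mul_leg12 hM, M.rMatrix_eq_right hM, M.comul_lTensor_eq, map_mul,
      ← mul_assoc, M.leg23_mul_deltaSnd_dblMap, M.deltaSnd_dblMap,
      M.isQuasitriangular.comul_lTensor, map_mul, triMap_leg13, triMap_leg12,
      M.deltaSnd_sepElement]
    simp only [mul_assoc]
  comul_rTensor := by
    have h1 : leg13 (flipT (Δ 1) * dblMap i R * Δ 1) * leg23 (flipT (Δ 1) * dblMap i R * Δ 1) =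
        leg13 (dblMap i R) * (leg13 (sepElement R i t x) *
          leg23 (dblMap i R * sepElement R i t x)) := by
      rw [M.rMatrix_eq_right hM, leg13_mul, mul_assoc]
    rw [h1, M.leg13_mul_leg23, M.rMatrix_eq_right hM, M.comul_rTensor_eq, map_mul,
      ← mul_assoc, M.leg12_mul_deltaFst_dblMap, M.deltaFst_dblMap,
      M.isQuasitriangular.comul_rTensor, map_mul, triMap_leg13, triMap_leg23, mul_assoc,
      M.leg12_mul_deltaFst]
    simp only [mul_assoc]
  exists_inverse := by
    -- The weak inverse is `e R̄ e²¹`; writing `𝓡` as `R e` or as `e²¹ R` lets `R` meet `R̄`.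
    refine ⟨sepElement R i t x * dblMap i (antipodeFst R) * flipT (sepElement R i t x),
      ⟨dblMap i (antipodeFst R), by rw [M.comul_one]⟩, ?_, ?_⟩
    · rw [M.rMatrix_eq_right hM, M.comul_one, mul_assoc, ← mul_assoc (sepElement R i t x),
        ← mul_assoc (sepElement R i t x), M.sepElement_mul_sepElement, ← mul_assoc, ← mul_assoc,
        ← M.flipT_mul_dblMap hM, mul_assoc (flipT _), dblMap_mul_antipodeFst M.isQuasitriangular,
        mul_one, M.flipT_mul_flipT]
    · rw [M.rMatrix_eq_left hM, M.comul_one, mul_assoc, ← mul_assoc (flipT _) (flipT _),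
        M.flipT_mul_flipT, M.flipT_mul_dblMap hM, mul_assoc, ← mul_assoc (dblMap i _),
        dblMap_antipodeFst_mul M.isQuasitriangular, one_mul, M.sepElement_mul_sepElement]

/-- With `𝓡 = e²¹ R` and `𝓡²¹ = R²¹ e²¹`, the middle factor `R R²¹ = 1` drops out and an idempotent
remains; the other product uses `R e` and `e R²¹`. -/
theorem isTriangularWeakHopfAlgebra (hT : IsTriangular R) :
    IsTriangularWeakHopfAlgebra Δ ε S (flipT (Δ 1) * dblMap i R * Δ 1) where
  toIsQuasitriangularWeakHopfAlgebra := M.isQuasitriangularWeakHopfAlgebra hM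
  mul_flip := by
    have h1 : dblMap i R * flipT (dblMap i R) = 1 := by
      rw [flipT_dblMap, ← map_mul, hT.mul_flip, map_one]
    have h2 : flipT (flipT (Δ 1) * dblMap i R * Δ 1) =
        flipT (dblMap i R) * flipT (sepElement R i t x) := by
      rw [M.rMatrix_eq_right hM, flipT_mul]
    rw [h2, M.rMatrix_eq_left hM, M.comul_one, mul_assoc, ← mul_assoc (dblMap i R), h1, one_mul,
      M.flipT_mul_flipT]
  flip_mul := by
    have h1 : flipT (dblMap i R) * dblMap i R = 1 := by
      rw [flipT_dblMap, ← map_mul, hT.flip_mul, map_one]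
    have h2 : flipT (flipT (Δ 1) * dblMap i R * Δ 1) =
        sepElement R i t x * flipT (dblMap i R) := by
      rw [M.rMatrix_eq_left hM, flipT_mul, flipT_flipT]
    rw [h2, M.rMatrix_eq_right hM, M.comul_one, mul_assoc, ← mul_assoc (flipT _), h1, one_mul,
      M.sepElement_mul_sepElement]

end IsSmashModel

end Model

/-! ### The smash product as a model -/

namespace SmashProduct

open Coalgebra HopfAlgebra

variable {k H A : Type*} [Field k] [Ring H] [HopfAlgebra k H] [Ring A] [Algebra k A]
  [Module H A] [IsScalarTower k H A] [ModuleAlgebra k H A]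

variable (k H A) in
/-- The algebra map `a ↦ a # 1`. -/
noncomputable def inl : A →ₐ[k] SmashProduct k H A :=
  AlgHom.ofLinearMap (inlMap k H A) rfl fun a b => (mk_one_mul_mk a b (1 : H)).symm

variable (k H A) in
/-- The algebra map `h ↦ 1 # h`. -/
noncomputable def inr : H →ₐ[k] SmashProduct k H A :=
  AlgHom.ofLinearMap (inrMap k H A) rfl fun g h => (mk_mul_mk_one (1 : A) g h).symm

theorem inl_apply (a : A) : inl k H A a = mk k a 1 := rfl

theorem inr_apply (h : H) : inr k H A h = mk k 1 h := rfl

theorem inl_mul_inr (a : A) (h : H) : inl k H A a * inr k H A h = mk k a h := by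
  rw [inl_apply, inr_apply, mk_one_mul_mk, mul_one]

theorem isSmashPair : IsSmashPair (inr k H A) (inl k H A) := by
  intro h a
  have h1 (w : H ⊗[k] H) : placeLeft (inl k H A).toLinearMap (inr k H A) (flipT w) a =
      ofTensor k H A (actFst k H A w a) := by
    induction w with
    | zero => simp
    | add v w hv hw => simp only [flipT_add, map_add, LinearMap.add_apply, hv, hw]
    | tmul p q =>
      rw [flipT_tmul, placeLeft_tmul, actFst_tmul]
      exact inl_mul_inr _ _
  rw [h1, inl_apply, inr_apply]
  change ofTensor k H A (mulMap k H A (1 ⊗ₜ h) (a ⊗ₜ 1)) = _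
  rw [mulMap_tmul, ← Algebra.TensorProduct.one_def, one_mul, mul_one]
  rfl

theorem src_eq_sourceMap (R : H ⊗[k] H) : src R (inr k H A) (inl k H A) = sourceMap R := by
  ext a
  have h1 (w : H ⊗[k] H) : placeLeft (inl k H A).toLinearMap (inr k H A) w a =
      ofTensor k H A (actFst k H A (flipT w) a) := by
    induction w with
    | zero => simp
    | add v w hv hw => simp only [flipT_add, map_add, LinearMap.add_apply, hv, hw]
    | tmul p q =>
      rw [flipT_tmul, placeLeft_tmul, actFst_tmul]
      exact inl_mul_inr _ _
  exact h1 R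

/-! ### The universal property of the smash product. -/

section Lift

variable {C : Type*} [Ring C] [Algebra k C]

/-- The linear map `a # h ↦ f(a) g(h)`. -/
noncomputable def liftMap (f : A →ₐ[k] C) (g : H →ₐ[k] C) : SmashProduct k H A →ₗ[k] C :=
  LinearMap.mul' k C ∘ₗ TensorProduct.map f.toLinearMap g.toLinearMap ∘ₗ
    (ofTensor k H A).symm.toLinearMap

theorem liftMap_mk (f : A →ₐ[k] C) (g : H →ₐ[k] C) (a : A) (h : H) :
    liftMap f g (mk k a h) = f a * g h := rfl

theorem liftMap_mul (f : A →ₐ[k] C) (g : H →ₐ[k] C)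
    (hfg : ∀ h a, g h * f a = placeLeft f.toLinearMap g (flipT (Coalgebra.comul (R := k) h)) a)
    (y z : SmashProduct k H A) : liftMap f g (y * z) = liftMap f g y * liftMap f g z := by
  induction y using induction_on with
  | zero => simp
  | add y y' hy hy' => simp only [map_add, add_mul, hy, hy']
  | mk a h =>
    induction z using induction_on with
    | zero => simp
    | add z z' hz hz' => simp only [map_add, mul_add, hz, hz']
    | mk b g' =>
      have h1 (w : A ⊗[k] H) : liftMap f g (ofTensor k H A ((a ⊗ₜ 1) * w * (1 ⊗ₜ g'))) =
          f a * LinearMap.mul' k C (TensorProduct.map f.toLinearMap g.toLinearMap w) * g g' := by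
        induction w with
        | zero => simp
        | add v w hv hw => simp only [map_add, mul_add, add_mul, hv, hw]
        | tmul p q =>
          rw [Algebra.TensorProduct.tmul_mul_tmul, Algebra.TensorProduct.tmul_mul_tmul, mul_one,
            one_mul]
          refine (liftMap_mk f g _ _).trans ?_
          simp [mul_assoc]
      have h2 : LinearMap.mul' k C (TensorProduct.map f.toLinearMap g.toLinearMap
          (twist k H A h b)) = g h * f b := by
        rw [hfg]
        have h3 (w : H ⊗[k] H) : LinearMap.mul' k C
            (TensorProduct.map f.toLinearMap g.toLinearMap (actFst k H A w b)) =
            placeLeft f.toLinearMap g (flipT w) b := by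
          induction w with
          | zero => simp
          | add v w hv hw => simp only [flipT_add, map_add, LinearMap.add_apply, hv, hw]
          | tmul p q => simp
        exact h3 _
      refine (h1 (twist k H A h b)).trans ?_
      rw [h2, liftMap_mk, liftMap_mk]
      simp only [mul_assoc]

/-- The algebra map `a # h ↦ f(a) g(h)`. -/
noncomputable def lift (f : A →ₐ[k] C) (g : H →ₐ[k] C)
    (hfg : ∀ h a, g h * f a = placeLeft f.toLinearMap g (flipT (Coalgebra.comul (R := k) h)) a) :
    SmashProduct k H A →ₐ[k] C :=
  AlgHom.ofLinearMap (liftMap f g)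
    ((liftMap_mk f g 1 1).trans (by rw [map_one, map_one, mul_one])) (liftMap_mul f g hfg)

theorem lift_inl (f : A →ₐ[k] C) (g : H →ₐ[k] C) (hfg) (a : A) :
    lift f g hfg (inl k H A a) = f a :=
  (liftMap_mk f g a 1).trans (by rw [map_one, mul_one])

theorem lift_inr (f : A →ₐ[k] C) (g : H →ₐ[k] C) (hfg) (h : H) :
    lift f g hfg (inr k H A h) = g h :=
  (liftMap_mk f g 1 h).trans (by rw [map_one, one_mul])

end Lift

variable (k H A) in
/-- The action of `A # H` on `A`, `(a # h) b = a (h • b)`. -/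
noncomputable def rho : SmashProduct k H A →ₐ[k] Module.End k A :=
  lift (Algebra.lmul k A) (Algebra.lsmul k k A) fun h a => by
    ext b
    have h1 (w : H ⊗[k] H) : placeLeft (Algebra.lmul k A).toLinearMap
        (Algebra.lsmul k k A : H →ₐ[k] Module.End k A) (flipT w) a b =
        LinearMap.mul' k A (actBoth k H A w (a ⊗ₜ b)) := by
      induction w with
      | zero => simp
      | add v w hv hw => simp only [flipT_add, map_add, LinearMap.add_apply, hv, hw]
      | tmul p q => simp
    rw [h1, ← ModuleAlgebra.smul_mul]
    rfl

variable (k H A) in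
/-- The algebra map `a # h ↦ (a # h₍₁₎) ⊗ (1 # h₍₂₎)`. -/
noncomputable def delta :
    SmashProduct k H A →ₐ[k] SmashProduct k H A ⊗[k] SmashProduct k H A :=
  lift (Algebra.TensorProduct.includeLeft.comp (inl k H A))
    ((dblMap (inr k H A)).comp (Bialgebra.comulAlgHom k H)) fun h a => by
    -- `F` is `p ⊗ q ⊗ r ↦ t(p·a) i(q) ⊗ i(r)`; the two sides of the smash relation are its values
    -- on the two iterated coproducts of `h`.
    let F : H ⊗[k] (H ⊗[k] H) →ₗ[k] SmashProduct k H A ⊗[k] SmashProduct k H A :=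
      mulThree ((TensorProduct.mk k _ _).flip 1 ∘ₗ (inl k H A).toLinearMap ∘ₗ (act k H A).flip a)
        ((TensorProduct.mk k _ _).flip 1 ∘ₗ (inr k H A).toLinearMap)
        (TensorProduct.mk k _ _ 1 ∘ₗ (inr k H A).toLinearMap)
    have hF (p q r : H) : F (p ⊗ₜ (q ⊗ₜ r)) = (inl k H A (p • a) ⊗ₜ 1) *
        ((inr k H A q ⊗ₜ 1) * (1 ⊗ₜ inr k H A r)) := rfl
    have h1 (w : H ⊗[k] H) : F (TensorProduct.assoc k H H H (Coalgebra.comul.rTensor H w)) =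
        dblMap (inr k H A) w * (inl k H A a ⊗ₜ 1) := by
      induction w with
      | zero => simp
      | add v w hv hw => simp only [map_add, add_mul, hv, hw]
      | tmul p r =>
        have h2 (z : H ⊗[k] H) : F (TensorProduct.assoc k H H H (z ⊗ₜ r)) =
            placeLeft (inl k H A).toLinearMap (inr k H A) (flipT z) a ⊗ₜ inr k H A r := by
          induction z with
          | zero => simp
          | add v w hv hw => simp only [map_add, TensorProduct.add_tmul, flipT_add,
              LinearMap.add_apply, hv, hw]
          | tmul p q => simp [hF]
        rw [LinearMap.rTensor_tmul, h2, ← isSmashPair]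
        simp
    have h2 (w : H ⊗[k] H) : F (Coalgebra.comul.lTensor H w) =
        placeLeft (Algebra.TensorProduct.includeLeft.comp (inl k H A)).toLinearMap
          ((dblMap (inr k H A)).comp (Bialgebra.comulAlgHom k H)) (flipT w) a := by
      induction w with
      | zero => simp
      | add v w hv hw => simp only [map_add, flipT_add, LinearMap.add_apply, hv, hw]
      | tmul p r =>
        have h3 (z : H ⊗[k] H) : F (p ⊗ₜ z) =
            (inl k H A (p • a) ⊗ₜ 1) * dblMap (inr k H A) z := by
          induction z with
          | zero => simp
          | add v w hv hw => simp only [map_add, TensorProduct.tmul_add, mul_add, hv, hw]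
          | tmul p q => simp [hF]
        exact h3 _
    exact (h1 _).symm.trans ((congrArg F (Coalgebra.coassoc_apply h)).trans (h2 _))

theorem isSmashModel {R : H ⊗[k] H} {x : A ⊗[k] A} {α : A →ₗ[k] k} (hR : IsQuasitriangular R)
    (hA : IsQuantumCommutative A R) (hx : IsSymmetricSeparabilityIdempotent x)
    (hu : ∀ a : A, drinfeldElement R • a = a) (hα : IsDualForm x α) :
    IsSmashModel R x α (inr k H A) (inl k H A) (rho k H A) (delta k H A) (comul R x) (counit α)
      (antipode R) where
  isQuasitriangular := hR
  isQuantumCommutative := hA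
  isSeparability := hx
  isDualForm := hα
  drinfeldElement_smul := hu
  isSmashPair := isSmashPair
  surjective := by
    intro z
    induction z using induction_on with
    | zero => exact ⟨0, map_zero _⟩
    | mk a h => exact ⟨a ⊗ₜ h, inl_mul_inr a h⟩
    | add y z hy hz =>
      obtain ⟨v, rfl⟩ := hy
      obtain ⟨w, rfl⟩ := hz
      exact ⟨v + w, map_add _ _ _⟩
  rho_t a b := by rw [rho, lift_inl]; rfl
  rho_i h b := by rw [rho, lift_inr]; rfl
  delta_t a := lift_inl _ _ _ a
  delta_i h := lift_inr _ _ _ h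
  comul_apply a h := by
    rw [inl_mul_inr, ← mul_assoc, sepElement, src_eq_sourceMap]
    rfl
  counit_apply b := by
    induction b using induction_on with
    | zero => simp
    | add y z hy hz => simp only [map_add, LinearMap.add_apply, hy, hz]
    | mk a h =>
      conv_rhs => rw [← inl_mul_inr, map_mul, rho, lift_inl, lift_inr]
      rw [counit_mk]
      change _ = α (a * (h • 1))
      rw [ModuleAlgebra.smul_one (k := k)]
      simp [mul_comm]
  antipode_apply a h := by
    rw [inl_mul_inr, src_eq_sourceMap]
    rfl

end SmashProduct

end QTSmash

open QTSmash in
theorem mainTheorem1 {k H A : Type*} [Field k] [CharZero k]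
    [Ring H] [HopfAlgebra k H] [IsSemisimpleRing H]
    [Ring A] [Algebra k A] [Module H A] [IsScalarTower k H A] [ModuleAlgebra k H A]
    (R : H ⊗[k] H) (hR : IsQuasitriangular R)
    (hA : IsQuantumCommutative A R)
    (x : A ⊗[k] A) (hx : IsSymmetricSeparabilityIdempotent x)
    (hu : ∀ a : A, drinfeldElement R • a = a) :
    ∃ α : A →ₗ[k] k,
      (∀ β : A →ₗ[k] k, IsDualForm x β ↔ β = α) ∧
      IsWeakHopfAlgebra (B := SmashProduct k H A)
        (SmashProduct.comul R x) (SmashProduct.counit α) (SmashProduct.antipode R) ∧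
      (IsInMuegerCenter A R →
        IsQuasitriangularWeakHopfAlgebra (B := SmashProduct k H A)
          (SmashProduct.comul R x) (SmashProduct.counit α) (SmashProduct.antipode R)
          (SmashProduct.rMatrix R x) ∧
        (IsTriangular R →
          IsTriangularWeakHopfAlgebra (B := SmashProduct k H A)
            (SmashProduct.comul R x) (SmashProduct.counit α) (SmashProduct.antipode R)
            (SmashProduct.rMatrix R x))) := by
  obtain ⟨α, hα⟩ := hx.exists_isDualForm
  have M := SmashProduct.isSmashModel hR hA hx hu hα
  -- `SmashProduct.rMatrix R x` agrees by definition with `flipT (Δ 1) * dblMap i R * Δ 1` in the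
  -- model.
  refine ⟨α, fun β => ⟨fun hβ => IsDualForm.eq hx hα hβ, fun h => h ▸ hα⟩, M.isWeakHopfAlgebra,
    fun hM => ⟨M.isQuasitriangularWeakHopfAlgebra hM, fun hT => M.isTriangularWeakHopfAlgebra hM hT⟩⟩
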